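/- Let $(M,g)$ be a smooth spacetime of dimension $n>2$, with $g$ of signature $(-,+,\dots,+)$ and Levi-Civita connection $\nabla$. Let $\Delta\subset M$ be an $(n-1)$-dimensional null submanifold, i.e. the pullback $q_{ab}$ of $g$ to $\Delta$ is degenerate at every point, and let $\ell$ be a smooth nowhere vanishing null vector field on $\Delta$, tangent to $\Delta$. Suppose that $(\Delta,[\ell])$ is an isolated null surface, where $[\ell]=\{c\,\ell : c\neq 0 \text{ constant}\}$; that is, $\Delta$ is non-expanding (the trace of $\nabla_a\ell_b$ over $T\Delta/\mathbb R\ell$ vanishes), $$\mathcal L_\ell q_{ab}=0 ,\qquad [\mathcal L_\ell,D_a]=0 ,$$ where $D_XY=\nabla_XY$ is the covariant derivative induced on $\Delta$ (for $X,Y$ tangent to $\Delta$, $\nabla_XY$ is again tangent to $\Delta$ because $\mathcal L_\ell q_{ab}=0$). Let the rotation 1-form potential $\omega$ be given by $D_a\ell^b=\omega_a\ell^b$ and the surface gravity $\kappa$ by $\nabla_\ell\ell=\kappa\,\ell$, and suppose that $(\Delta,[\ell])$ is extremal: $\kappa=0$ on $\Delta$. Then for every $(n-2)$-dimensional spacelike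 submanifold $\mathcal S\subset\Delta$ transversal to the orbits of $\ell$, $$\tilde D_{(A}\tilde\omega_{B)}+\tilde\omega_A\tilde\omega_B-\tfrac12 R^{(n-2)}_{AB}+\tfrac12\tilde R_{AB}=0$$ on $\mathcal S$, where $\tilde q_{AB}$ is the metric induced by $g$ on $\mathcal S$, $\tilde D_A$ and $R^{(n-2)}_{AB}$ are its Levi-Civita connection and its Ricci tensor, $\tilde\omega_A$ and $\tilde R_{AB}$ are the pullbacks to $\mathcal S$ of $\omega$ and of the Ricci tensor of $g$, and $\tilde D_{(A}\tilde\omega_{B)}=\tfrac12(\tilde D_A\tilde\omega_B+\tilde D_B\tilde\omega_A)$. Here the Ricci tensor of a metric with Riemann tensor $R(u,v)w=\nabla_u\nabla_vw-\nabla_v\nabla_uw-\nabla_{[u,v]}w$ is $\mathrm{Ric}(v,w)=\operatorname{tr}(z\mapsto R(z,v)w)$. -/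

import Mathlib

open scoped Manifold ContDiff Topology Bundle

set_option linter.unusedSectionVars false

noncomputable section

namespace NullGeom

variable {E : Type*} [NormedAddCommGroup E] [NormedSpace ℝ E] [FiniteDimensional ℝ E]
  {M : Type*} [TopologicalSpace M] [ChartedSpace E M] [IsManifold 𝓘(ℝ, E) ∞ M]

/-- A smooth pseudo-Riemannian metric (of any signature) on the smooth manifold `M`: a smooth field
of nondegenerate symmetric bilinear forms on the tangent spaces. -/
structure PseudoMetric (E : Type*) [NormedAddCommGroup E] [NormedSpace ℝ E]
    (M : Type*) [TopologicalSpace M] [ChartedSpace E M] [IsManifold 𝓘(ℝ, E) ∞ M] where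
  val (x : M) : TangentSpace 𝓘(ℝ, E) x →L[ℝ] TangentSpace 𝓘(ℝ, E) x →L[ℝ] ℝ
  symm (x : M) (v w : TangentSpace 𝓘(ℝ, E) x) : val x v w = val x w v
  nondeg (x : M) (v : TangentSpace 𝓘(ℝ, E) x) : (∀ w, val x v w = 0) → v = 0
  contMDiff : ContMDiff 𝓘(ℝ, E) (𝓘(ℝ, E).prod 𝓘(ℝ, E →L[ℝ] E →L[ℝ] ℝ)) ∞
    (fun x => Bundle.TotalSpace.mk' (E →L[ℝ] E →L[ℝ] ℝ) x (val x))

namespace PseudoMetric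
variable (g : PseudoMetric E M)

/-- The function `x ↦ g_x(X x, Y x)`. -/
def pair (X Y : Π x : M, TangentSpace 𝓘(ℝ, E) x) (x : M) : ℝ := g.val x (X x) (Y x)

theorem mdiff_pair {X Y : Π x : M, TangentSpace 𝓘(ℝ, E) x} {x : M}
    (hX : MDiffAt (T% X) x) (hY : MDiffAt (T% Y) x) : MDiffAt (g.pair X Y) x := by
  have h : MDifferentiableAt 𝓘(ℝ, E) (𝓘(ℝ, E).prod 𝓘(ℝ))
      (fun m ↦ Bundle.TotalSpace.mk' ℝ (E := Bundle.Trivial M ℝ) m (g.pair X Y m)) x := by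
    apply MDifferentiableAt.clm_bundle_apply₂ (F₁ := E) (F₂ := E)
    · exact (g.contMDiff.mdifferentiable (by simp)) x
    · exact hX
    · exact hY
  simp only [mdifferentiableAt_totalSpace] at h
  exact h.2

/-- The right-hand side of the Koszul formula for `2 g(∇_X Y, Z)`. -/
def koszul (X Y Z : Π x : M, TangentSpace 𝓘(ℝ, E) x) (x : M) : ℝ :=
  mvfderiv 𝓘(ℝ, E) (g.pair Y Z) x (X x) + mvfderiv 𝓘(ℝ, E) (g.pair X Z) x (Y x)
    - mvfderiv 𝓘(ℝ, E) (g.pair X Y) x (Z x)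
    + g.val x (VectorField.mlieBracket 𝓘(ℝ, E) X Y x) (Z x)
    - g.val x (VectorField.mlieBracket 𝓘(ℝ, E) X Z x) (Y x)
    - g.val x (VectorField.mlieBracket 𝓘(ℝ, E) Y Z x) (X x)

variable {g}

theorem pair_smul_left (f : M → ℝ) (X Y : Π x : M, TangentSpace 𝓘(ℝ, E) x) :
    g.pair (f • X) Y = f * g.pair X Y := by
  funext x; simp [pair]
theorem pair_smul_right (f : M → ℝ) (X Y : Π x : M, TangentSpace 𝓘(ℝ, E) x) :
    g.pair X (f • Y) = f * g.pair X Y := by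
  funext x; simp [pair]
theorem pair_add_left (X X' Y : Π x : M, TangentSpace 𝓘(ℝ, E) x) :
    g.pair (X + X') Y = g.pair X Y + g.pair X' Y := by
  funext x; simp [pair]
theorem pair_add_right (X Y Y' : Π x : M, TangentSpace 𝓘(ℝ, E) x) :
    g.pair X (Y + Y') = g.pair X Y + g.pair X Y' := by
  funext x; simp [pair]

theorem koszul_tensorial_left {Y Z : Π x : M, TangentSpace 𝓘(ℝ, E) x} {x : M}
    (hY : MDiffAt (T% Y) x) (hZ : MDiffAt (T% Z) x) :
    TensorialAt 𝓘(ℝ, E) E (fun X => g.koszul X Y Z x) x where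
  smul {f X} hf hX := by
    have := g.symm x
    simp only [koszul, pair_smul_left, mvfderiv_mul hf (g.mdiff_pair hX hY),
      mvfderiv_mul hf (g.mdiff_pair hX hZ), VectorField.mlieBracket_smul_left hf hX]
    simp [pair, this (X x)]
    ring
  add {X X'} hX hX' := by
    simp only [koszul, pair_add_left, mvfderiv_add (g.mdiff_pair hX hY) (g.mdiff_pair hX' hY),
      mvfderiv_add (g.mdiff_pair hX hZ) (g.mdiff_pair hX' hZ),
      VectorField.mlieBracket_add_left hX hX']
    simp
    ring

theorem koszul_tensorial_right {X Y : Π x : M, TangentSpace 𝓘(ℝ, E) x} {x : M}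
    (hX : MDiffAt (T% X) x) (hY : MDiffAt (T% Y) x) :
    TensorialAt 𝓘(ℝ, E) E (fun Z => g.koszul X Y Z x) x where
  smul {f Z} hf hZ := by
    have := g.symm x
    simp only [koszul, pair_smul_right, mvfderiv_mul hf (g.mdiff_pair hX hZ),
      mvfderiv_mul hf (g.mdiff_pair hY hZ), VectorField.mlieBracket_smul_right hf hZ]
    simp [pair, this _ (Y x), this _ (X x)]
    ring
  add {Z Z'} hZ hZ' := by
    simp only [koszul, pair_add_right, mvfderiv_add (g.mdiff_pair hX hZ) (g.mdiff_pair hX hZ'),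
      mvfderiv_add (g.mdiff_pair hY hZ) (g.mdiff_pair hY hZ'),
      VectorField.mlieBracket_add_right hZ hZ']
    simp
    ring

theorem koszul_add {X Y Y' Z : Π x : M, TangentSpace 𝓘(ℝ, E) x} {x : M}
    (hX : MDiffAt (T% X) x) (hY : MDiffAt (T% Y) x) (hY' : MDiffAt (T% Y') x)
    (hZ : MDiffAt (T% Z) x) :
    g.koszul X (Y + Y') Z x = g.koszul X Y Z x + g.koszul X Y' Z x := by
  simp only [koszul, pair_add_right, pair_add_left,
    mvfderiv_add (g.mdiff_pair hX hY) (g.mdiff_pair hX hY'),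
    mvfderiv_add (g.mdiff_pair hY hZ) (g.mdiff_pair hY' hZ),
    VectorField.mlieBracket_add_right hY hY', VectorField.mlieBracket_add_left hY hY']
  simp
  ring

theorem koszul_smul {f : M → ℝ} {X Y Z : Π x : M, TangentSpace 𝓘(ℝ, E) x} {x : M}
    (hf : MDiffAt f x) (hX : MDiffAt (T% X) x) (hY : MDiffAt (T% Y) x)
    (hZ : MDiffAt (T% Z) x) :
    g.koszul X (f • Y) Z x =
      f x * g.koszul X Y Z x + 2 * (mvfderiv 𝓘(ℝ, E) f x (X x) * g.val x (Y x) (Z x)) := by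
  have := g.symm x
  simp only [koszul, pair_smul_right, pair_smul_left, mvfderiv_mul hf (g.mdiff_pair hX hY),
    mvfderiv_mul hf (g.mdiff_pair hY hZ), VectorField.mlieBracket_smul_right hf hY,
    VectorField.mlieBracket_smul_left hf hY]
  simp [pair, this _ (X x)]
  ring

variable (g) in
/-- The musical isomorphism `v ↦ g(v, ·)`. -/
def flat (x : M) : TangentSpace 𝓘(ℝ, E) x ≃ₗ[ℝ] (TangentSpace 𝓘(ℝ, E) x →L[ℝ] ℝ) :=
  have : FiniteDimensional ℝ (TangentSpace 𝓘(ℝ, E) x) := inferInstanceAs (FiniteDimensional ℝ E)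
  have : T2Space (TangentSpace 𝓘(ℝ, E) x) := inferInstanceAs (T2Space E)
  LinearEquiv.ofInjectiveOfFinrankEq (g.val x).toLinearMap
    ((injective_iff_map_eq_zero _).2 fun v hv => g.nondeg x v fun w =>
      congrArg (fun L : TangentSpace 𝓘(ℝ, E) x →L[ℝ] ℝ => L w) hv)
    ((Subspace.dual_finrank_eq (K := ℝ) (V := TangentSpace 𝓘(ℝ, E) x)).symm.trans
      (LinearMap.toContinuousLinearMap (𝕜 := ℝ) (E := TangentSpace 𝓘(ℝ, E) x)
        (F' := ℝ)).finrank_eq)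

theorem flat_apply (x : M) (v w : TangentSpace 𝓘(ℝ, E) x) : g.flat x v w = g.val x v w := rfl

open scoped Classical in
variable (g) in
/-- `g.nabla Y x v` is the Levi-Civita derivative `∇_v Y` at `x`, given by the Koszul formula
(with junk value `0` when `Y` is not differentiable at `x`). -/
def nabla (Y : Π x : M, TangentSpace 𝓘(ℝ, E) x) (x : M) :
    TangentSpace 𝓘(ℝ, E) x →L[ℝ] TangentSpace 𝓘(ℝ, E) x :=
  have : FiniteDimensional ℝ (TangentSpace 𝓘(ℝ, E) x) := inferInstanceAs (FiniteDimensional ℝ E)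
  have : T2Space (TangentSpace 𝓘(ℝ, E) x) := inferInstanceAs (T2Space E)
  if hY : MDiffAt (T% Y) x then
    LinearMap.toContinuousLinearMap <| (g.flat x).symm.toLinearMap ∘ₗ
      ((1 / 2 : ℝ) • (TensorialAt.mkHom₂ (fun X Z => g.koszul X Y Z x) x
        (fun _ hZ => koszul_tensorial_left hY hZ)
        (fun _ hX => koszul_tensorial_right hX hY)).toLinearMap)
  else 0

theorem two_mul_nabla {X Y Z : Π x : M, TangentSpace 𝓘(ℝ, E) x} {x : M}
    (hX : MDiffAt (T% X) x) (hY : MDiffAt (T% Y) x) (hZ : MDiffAt (T% Z) x) :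
    2 * g.val x (g.nabla Y x (X x)) (Z x) = g.koszul X Y Z x := by
  rw [← flat_apply, nabla]
  simp only [hY, dif_pos, LinearMap.coe_toContinuousLinearMap', LinearMap.comp_apply,
    LinearEquiv.coe_coe, LinearEquiv.apply_symm_apply, LinearMap.smul_apply,
    smul_apply, smul_eq_mul, ContinuousLinearMap.coe_coe]
  rw [TensorialAt.mkHom₂_apply _ _ hX hZ]
  ring

theorem eq_of_forall_val {x : M} {v w : TangentSpace 𝓘(ℝ, E) x}
    (h : ∀ z, g.val x v z = g.val x w z) : v = w := by
  rw [← sub_eq_zero]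
  exact g.nondeg x _ fun z => by simp [h]

variable (g) in
/-- The Levi-Civita connection of `g`; `g.leviCivita Y x v` is `∇_v Y` at `x`. -/
def leviCivita : CovariantDerivative 𝓘(ℝ, E) E (fun x : M => TangentSpace 𝓘(ℝ, E) x) where
  toFun := g.nabla
  isCovariantDerivativeOnUniv :=
    { add := by
        intro Y Y' x hY hY' _
        ext v
        refine eq_of_forall_val (g := g) fun z => ?_
        have hv := FiberBundle.mdifferentiableAt_extend 𝓘(ℝ, E) E v
        have hz := FiberBundle.mdifferentiableAt_extend 𝓘(ℝ, E) E z
        have hs : MDiffAt (T% (Y + Y')) x := mdifferentiableAt_add_section hY hY'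
        have h1 := two_mul_nabla (g := g) hv hs hz
        have h2 := two_mul_nabla (g := g) hv hY hz
        have h3 := two_mul_nabla (g := g) hv hY' hz
        rw [koszul_add hv hY hY' hz] at h1
        simp at h1 h2 h3 ⊢
        linarith
      leibniz := by
        intro Y f x hY hf _
        ext v
        refine eq_of_forall_val (g := g) fun z => ?_
        have hv := FiberBundle.mdifferentiableAt_extend 𝓘(ℝ, E) E v
        have hz := FiberBundle.mdifferentiableAt_extend 𝓘(ℝ, E) E z
        have hs : MDiffAt (T% (f • Y)) x := hf.smul_section hY
        have h1 := two_mul_nabla (g := g) hv hs hz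
        have h2 := two_mul_nabla (g := g) hv hY hz
        rw [koszul_smul hf hv hY hz] at h1
        simp at h1 h2 ⊢
        linear_combination h1 / 2 - f x * h2 / 2 }

/-- The Levi-Civita connection is metric. -/
theorem leviCivita_metric {X Y Z : Π x : M, TangentSpace 𝓘(ℝ, E) x} {x : M}
    (hX : MDiffAt (T% X) x) (hY : MDiffAt (T% Y) x) (hZ : MDiffAt (T% Z) x) :
    mvfderiv 𝓘(ℝ, E) (g.pair Y Z) x (X x) =
      g.val x (g.leviCivita Y x (X x)) (Z x) + g.val x (Y x) (g.leviCivita Z x (X x)) := by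
  have h1 := two_mul_nabla (g := g) hX hY hZ
  have h2 := two_mul_nabla (g := g) hX hZ hY
  have hc : ∀ A B, g.pair A B = g.pair B A := fun A B => funext fun y => g.symm y _ _
  change _ = g.val x (g.nabla Y x (X x)) (Z x) + g.val x (Y x) (g.nabla Z x (X x))
  rw [g.symm x (Y x)]
  simp only [koszul, hc Z Y, VectorField.mlieBracket_swap_apply (V := Z) (W := Y),
    map_neg, neg_apply] at h1 h2
  linarith

/-- The Levi-Civita connection is torsion free. -/
theorem leviCivita_torsion : (g.leviCivita).torsion = 0 := by
  rw [CovariantDerivative.torsion_eq_zero_iff]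
  intro X Y x hX hY
  refine eq_of_forall_val (g := g) fun z => ?_
  have hz := FiberBundle.mdifferentiableAt_extend 𝓘(ℝ, E) E z
  have h1 := two_mul_nabla (g := g) hX hY hz
  have h2 := two_mul_nabla (g := g) hY hX hz
  have hc : ∀ A B, g.pair A B = g.pair B A := fun A B => funext fun y => g.symm y _ _
  change g.val x (g.nabla Y x (X x) - g.nabla X x (Y x)) z = _
  simp only [koszul, hc Y X, VectorField.mlieBracket_swap_apply (V := Y) (W := X),
    map_neg, neg_apply] at h1 h2
  simp at h1 h2 ⊢
  linarith

variable (g)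

/-- The Riemann tensor `R(u, v) w = ∇_u ∇_v w - ∇_v ∇_u w - ∇_{[u, v]} w` at `x`, the tangent vectors
being extended to vector fields that are smooth near `x` (the choice is irrelevant). -/
def riemann (x : M) (u v w : TangentSpace 𝓘(ℝ, E) x) : TangentSpace 𝓘(ℝ, E) x :=
  let U : Π y : M, TangentSpace 𝓘(ℝ, E) y := FiberBundle.extend E u
  let V : Π y : M, TangentSpace 𝓘(ℝ, E) y := FiberBundle.extend E v
  let W : Π y : M, TangentSpace 𝓘(ℝ, E) y := FiberBundle.extend E w
  g.leviCivita (fun y => g.leviCivita W y (V y)) x u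
    - g.leviCivita (fun y => g.leviCivita W y (U y)) x v
    - g.leviCivita W x (VectorField.mlieBracket 𝓘(ℝ, E) U V x)

/-- The Ricci tensor: `Ric(v, w)` is the trace of `z ↦ R(z, v) w`, computed in a basis of the
tangent space. -/
def ricci (x : M) (v w : TangentSpace 𝓘(ℝ, E) x) : ℝ :=
  let b : Module.Basis (Fin (Module.finrank ℝ E)) ℝ (TangentSpace 𝓘(ℝ, E) x) :=
    Module.finBasis ℝ E
  ∑ i, b.coord i (g.riemann x (b i) v w)

/-- The covariant derivative of a 1-form `α`:
`(∇α)(u, w) = (∇_u α)(w) = u(α(W)) - α(∇_u W)`, where `W` extends `w`. -/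
def covDerivOneForm (α : Π y : M, TangentSpace 𝓘(ℝ, E) y → ℝ) (x : M)
    (u w : TangentSpace 𝓘(ℝ, E) x) : ℝ :=
  let W : Π y : M, TangentSpace 𝓘(ℝ, E) y := FiberBundle.extend E w
  mvfderiv 𝓘(ℝ, E) (fun y => α y (W y)) x u - α x (g.leviCivita W x u)

/-- Lorentzian signature `(-, +, …, +)`: at each point there is a timelike vector on whose
orthogonal complement the metric is positive definite. -/
def IsLorentzian : Prop :=
  ∀ x, ∃ t : TangentSpace 𝓘(ℝ, E) x, g.val x t t < 0 ∧
    ∀ v, g.val x t v = 0 → v ≠ 0 → 0 < g.val x v v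

end PseudoMetric

/-! ### Pullback of a metric to a manifold mapped into `M` -/

section Pullback

variable {G : Type*} [NormedAddCommGroup G] [NormedSpace ℝ G] [FiniteDimensional ℝ G]
  {S : Type*} [TopologicalSpace S] [ChartedSpace G S] [IsManifold 𝓘(ℝ, G) ∞ S]

/-- The pullback `φ^* g` of the metric `g` along `φ : S → M`, as a field of bilinear forms. -/
def pullbackForm (g : PseudoMetric E M) (φ : S → M) (s : S) :
    TangentSpace 𝓘(ℝ, G) s →L[ℝ] TangentSpace 𝓘(ℝ, G) s →L[ℝ] ℝ :=
  ContinuousLinearMap.precomp ℝ (mfderiv 𝓘(ℝ, G) 𝓘(ℝ, E) φ s) ∘L g.val (φ s) ∘L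
    mfderiv 𝓘(ℝ, G) 𝓘(ℝ, E) φ s

theorem pullbackForm_apply (g : PseudoMetric E M) (φ : S → M) (s : S)
    (v w : TangentSpace 𝓘(ℝ, G) s) :
    pullbackForm g φ s v w = g.val (φ s) (mfderiv 𝓘(ℝ, G) 𝓘(ℝ, E) φ s v)
      (mfderiv 𝓘(ℝ, G) 𝓘(ℝ, E) φ s w) := rfl

theorem contMDiffAt_of_coords {W ι : Type*} [NormedAddCommGroup W] [NormedSpace ℝ W] [Fintype ι]
    (Φ : W →ₗ[ℝ] (ι → ℝ)) (hΦ : ∀ A, Φ A = 0 → A = 0) {L : S → W} {s₀ : S}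
    (h : ∀ p, ContMDiffAt 𝓘(ℝ, G) 𝓘(ℝ) ∞ (fun s => Φ (L s) p) s₀) :
    ContMDiffAt 𝓘(ℝ, G) 𝓘(ℝ, W) ∞ L s₀ := by
  obtain ⟨Ψ, hΨ⟩ := Φ.exists_leftInverse_of_injective (LinearMap.ker_eq_bot'.2 hΦ)
  have hL : L = fun s => (LinearMap.toContinuousLinearMap Ψ) (Φ (L s)) := by
    funext s
    exact (LinearMap.congr_fun hΨ (L s)).symm
  rw [hL]
  refine (LinearMap.toContinuousLinearMap Ψ).contMDiff.contMDiffAt.comp s₀ ?_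
  rw [contMDiffAt_pi_space]
  exact h

theorem contMDiffAt_of_apply {L : S → G →L[ℝ] G →L[ℝ] ℝ} {s₀ : S}
    (h : ∀ a b, ContMDiffAt 𝓘(ℝ, G) 𝓘(ℝ) ∞ (fun s => L s a b) s₀) :
    ContMDiffAt 𝓘(ℝ, G) 𝓘(ℝ, G →L[ℝ] G →L[ℝ] ℝ) ∞ L s₀ := by
  let b := Module.finBasis ℝ G
  refine contMDiffAt_of_coords (ι := Fin (Module.finrank ℝ G) × Fin (Module.finrank ℝ G))
    { toFun := fun A p => A (b p.1) (b p.2)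
      map_add' := fun A B => rfl
      map_smul' := fun c A => rfl } (fun A hA => ?_) (fun p => h _ _)
  have h0 : ∀ i j, A (b i) (b j) = 0 := fun i j => congrFun hA (i, j)
  have h1 : ∀ i, A (b i) = 0 := fun i => ContinuousLinearMap.coe_injective (b.ext (h0 i))
  exact ContinuousLinearMap.coe_injective (b.ext h1)

theorem contMDiff_pullbackForm (g : PseudoMetric E M) {φ : S → M}
    (hφ : ContMDiff 𝓘(ℝ, G) 𝓘(ℝ, E) ∞ φ) :
    ContMDiff 𝓘(ℝ, G) (𝓘(ℝ, G).prod 𝓘(ℝ, G →L[ℝ] G →L[ℝ] ℝ)) ∞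
      (fun s : S => Bundle.TotalSpace.mk' (G →L[ℝ] G →L[ℝ] ℝ)
        (E := fun s : S => TangentSpace 𝓘(ℝ, G) s →L[ℝ] TangentSpace 𝓘(ℝ, G) s →L[ℝ] ℝ)
        s (pullbackForm g φ s)) := by
  intro s₀
  rw [contMDiffAt_hom_bundle]
  refine ⟨contMDiffAt_id, contMDiffAt_of_apply fun a b => ?_⟩
  let t := trivializationAt G (fun s : S => TangentSpace 𝓘(ℝ, G) s) s₀
  have hext : ∀ a : G, ContMDiffAt 𝓘(ℝ, G) (𝓘(ℝ, G).prod 𝓘(ℝ, G)) ∞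
      (fun s : S => Bundle.TotalSpace.mk' G (E := fun s : S => TangentSpace 𝓘(ℝ, G) s)
        s (t.symm s a)) s₀ := by
    intro a
    rw [Bundle.contMDiffAt_section]
    refine (contMDiffAt_const (c := a)).congr_of_eventuallyEq ?_
    filter_upwards [t.open_baseSet.mem_nhds (FiberBundle.mem_baseSet_trivializationAt' s₀)]
      with s hs
    change (t ⟨s, t.symm s a⟩).2 = a
    simp [hs]
  have hd : ∀ a : G, ContMDiffAt 𝓘(ℝ, G) (𝓘(ℝ, E).prod 𝓘(ℝ, E)) ∞
      (fun s : S => Bundle.TotalSpace.mk' E (E := fun x : M => TangentSpace 𝓘(ℝ, E) x)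
        (φ s) (mfderiv 𝓘(ℝ, G) 𝓘(ℝ, E) φ s (t.symm s a))) s₀ := fun a =>
    ((hφ.contMDiff_tangentMap (m := ∞) (by simp)).contMDiffAt).comp s₀ (hext a)
  have key : ContMDiffAt 𝓘(ℝ, G) (𝓘(ℝ, E).prod 𝓘(ℝ)) ∞
      (fun s ↦ Bundle.TotalSpace.mk' ℝ (E := Bundle.Trivial M ℝ) (φ s)
        (pullbackForm g φ s (t.symm s a) (t.symm s b))) s₀ := by
    apply ContMDiffAt.clm_bundle_apply₂ (F₁ := E) (F₂ := E)
    · exact ContMDiffAt.comp s₀ g.contMDiff.contMDiffAt hφ.contMDiffAt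
    · exact hd a
    · exact hd b
  simp only [Bundle.contMDiffAt_totalSpace] at key
  refine key.2.congr_of_eventuallyEq ?_
  filter_upwards [t.open_baseSet.mem_nhds (FiberBundle.mem_baseSet_trivializationAt' s₀)]
    with s hs
  have hs' : s ∈ (trivializationAt (G →L[ℝ] ℝ)
      (fun b : S => TangentSpace 𝓘(ℝ, G) b →L[ℝ] ℝ) s₀).baseSet := by
    rw [hom_trivializationAt_baseSet]
    exact ⟨hs, by simp⟩
  rw [ContinuousLinearMap.inCoordinates]
  simp only [ContinuousLinearMap.coe_comp, Function.comp_apply,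
    Bundle.Trivialization.continuousLinearMapAt_apply]
  rw [Bundle.Trivialization.linearMapAt_apply, if_pos hs', hom_trivializationAt_apply,
    ContinuousLinearMap.inCoordinates]
  simp only [ContinuousLinearMap.coe_comp, Function.comp_apply]
  rw [Bundle.Trivialization.symmL_apply _ hs, Bundle.Trivialization.symmL_apply _ hs]
  simp [t]

/-- The pullback of a metric, as a metric, when it is nondegenerate. -/
def pullbackMetric (g : PseudoMetric E M) (φ : S → M) (hφ : ContMDiff 𝓘(ℝ, G) 𝓘(ℝ, E) ∞ φ)
    (hnd : ∀ (s : S) (v : TangentSpace 𝓘(ℝ, G) s), (∀ w, pullbackForm g φ s v w = 0) → v = 0) : PseudoMetric G S where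
  val := pullbackForm g φ
  symm s _ _ := g.symm (φ s) _ _
  nondeg := hnd
  contMDiff := contMDiff_pullbackForm g hφ

end Pullback

/-! ### Hypersurfaces `ι : N → M` -/

section Hypersurface

variable {F : Type*} [NormedAddCommGroup F] [NormedSpace ℝ F] [FiniteDimensional ℝ F]
  {N : Type*} [TopologicalSpace N] [ChartedSpace F N] [IsManifold 𝓘(ℝ, F) ∞ N]
  (g : PseudoMetric E M) (ι : N → M)

/-- `Z`, a vector field on `M` differentiable at `ι p`, extends the vector field `Y` on `N`
near `p`, that is `Z ∘ ι = dι Y` near `p`. -/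
def IsExtensionAt (Y : Π p : N, TangentSpace 𝓘(ℝ, F) p) (p : N)
    (Z : Π x : M, TangentSpace 𝓘(ℝ, E) x) : Prop :=
  MDiffAt (T% Z) (ι p) ∧ ∀ᶠ p' in 𝓝 p, Z (ι p') = mfderiv 𝓘(ℝ, F) 𝓘(ℝ, E) ι p' (Y p')

/-- The spacetime derivative `∇_v Y` at `p` of a vector field `Y` tangent to the hypersurface in a
direction `v` tangent to it, computed with any extension of `Y` off the hypersurface. -/
def ambientDeriv (Y : Π p : N, TangentSpace 𝓘(ℝ, F) p) (p : N) (v : TangentSpace 𝓘(ℝ, F) p) :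
    TangentSpace 𝓘(ℝ, E) (ι p) :=
  g.leviCivita (Classical.epsilon (IsExtensionAt (E := E) ι Y p)) (ι p)
    (mfderiv 𝓘(ℝ, F) 𝓘(ℝ, E) ι p v)

/-- The induced covariant derivative `D_v Y` on the hypersurface: the vector tangent to `N` whose
image is `∇_v Y`. -/
def inducedDeriv (Y : Π p : N, TangentSpace 𝓘(ℝ, F) p) (p : N) (v : TangentSpace 𝓘(ℝ, F) p) :
    TangentSpace 𝓘(ℝ, F) p :=
  Classical.epsilon fun w => mfderiv 𝓘(ℝ, F) 𝓘(ℝ, E) ι p w = ambientDeriv g ι Y p v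

/-- A null hypersurface: an immersed submanifold of codimension one on which the pulled back metric
is degenerate at every point. -/
structure IsNullHypersurface : Prop where
  immersion : Manifold.IsImmersion 𝓘(ℝ, F) 𝓘(ℝ, E) ∞ ι
  codim_one : Module.finrank ℝ F + 1 = Module.finrank ℝ E
  degenerate : ∀ p, ∃ v : TangentSpace 𝓘(ℝ, F) p, v ≠ 0 ∧ ∀ w, pullbackForm g ι p v w = 0

variable (l : Π p : N, TangentSpace 𝓘(ℝ, F) p)

/-- The expansion of the null field `l` vanishes: the trace of `B(u, w) = g(∇_u l, w)` over
`T_pN / ℝ l` with respect to the metric induced there is zero. The trace is computed in a family of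
vectors that projects to an orthonormal basis of that quotient. -/
def IsNonExpanding : Prop :=
  ∀ (p : N) (e : Fin (Module.finrank ℝ F - 1) → TangentSpace 𝓘(ℝ, F) p),
    (∀ i j, pullbackForm g ι p (e i) (e j) = if i = j then 1 else 0) →
    ∑ i, g.val (ι p) (ambientDeriv g ι l p (e i)) (mfderiv 𝓘(ℝ, F) 𝓘(ℝ, E) ι p (e i)) = 0

/-- `(N, [l])` is an isolated null surface: `N` is a non-expanding null hypersurface, and `l` is a
smooth nowhere vanishing null vector field tangent to it whose flow preserves the induced degenerate
metric `q` and the induced covariant derivative `D`. -/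
structure IsIsolatedNullSurface : Prop where
  null_hypersurface : IsNullHypersurface (F := F) g ι
  smooth : CMDiff ∞ (T% l)
  ne_zero : ∀ p, l p ≠ 0
  null : ∀ p w, pullbackForm g ι p (l p) w = 0
  nonexpanding : IsNonExpanding g ι l
  /-- `ℒ_l q = 0` -/
  lie_metric : ∀ (U : Set N), IsOpen U → ∀ X Y : Π p : N, TangentSpace 𝓘(ℝ, F) p,
    CMDiff[U] ∞ (T% X) → CMDiff[U] ∞ (T% Y) → ∀ p ∈ U,
    mvfderiv 𝓘(ℝ, F) (fun p' => pullbackForm g ι p' (X p') (Y p')) p (l p)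
      - pullbackForm g ι p (VectorField.mlieBracket 𝓘(ℝ, F) l X p) (Y p)
      - pullbackForm g ι p (X p) (VectorField.mlieBracket 𝓘(ℝ, F) l Y p) = 0
  /-- `[ℒ_l, D] = 0` -/
  lie_connection : ∀ (U : Set N), IsOpen U → ∀ X Y : Π p : N, TangentSpace 𝓘(ℝ, F) p,
    CMDiff[U] ∞ (T% X) → CMDiff[U] ∞ (T% Y) → ∀ p ∈ U,
    VectorField.mlieBracket 𝓘(ℝ, F) l (fun p' => inducedDeriv g ι Y p' (X p')) p
      - inducedDeriv g ι Y p (VectorField.mlieBracket 𝓘(ℝ, F) l X p)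
      - inducedDeriv g ι (fun p' => VectorField.mlieBracket 𝓘(ℝ, F) l Y p') p (X p) = 0

/-- The rotation 1-form `ω` of `l`, defined by `D_v l = ω(v) l`. -/
def rotationForm (p : N) (v : TangentSpace 𝓘(ℝ, F) p) : ℝ :=
  Classical.epsilon fun c : ℝ => inducedDeriv g ι l p v = c • l p

/-- The surface gravity `κ` of `l`, defined by `∇_l l = κ l`. -/
def surfaceGravity (p : N) : ℝ :=
  Classical.epsilon fun c : ℝ =>
    ambientDeriv g ι l p (l p) = c • mfderiv 𝓘(ℝ, F) 𝓘(ℝ, E) ι p (l p)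

/-- The isolated null surface `(N, [l])` is extremal: its surface gravity vanishes. -/
def IsExtremal : Prop := ∀ p, surfaceGravity g ι l p = 0

variable {G : Type*} [NormedAddCommGroup G] [NormedSpace ℝ G] [FiniteDimensional ℝ G]
  {S : Type*} [TopologicalSpace S] [ChartedSpace G S] [IsManifold 𝓘(ℝ, G) ∞ S]

/-- `j : S → N` is a spacelike submanifold of the null hypersurface, of codimension two in the
spacetime, transversal to the orbits of the flow of `l`. -/
structure IsSpacelikeSection (j : S → N) : Prop where
  immersion : Manifold.IsImmersion 𝓘(ℝ, G) 𝓘(ℝ, F) ∞ j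
  codim_two : Module.finrank ℝ G + 2 = Module.finrank ℝ E
  spacelike : ∀ (s : S) (v : TangentSpace 𝓘(ℝ, G) s), v ≠ 0 → 0 < pullbackForm g (ι ∘ j) s v v
  transversal : ∀ (s : S) (v : TangentSpace 𝓘(ℝ, G) s),
    mfderiv 𝓘(ℝ, G) 𝓘(ℝ, F) j s v ≠ l (j s)

variable {g ι l}

/-- The metric induced on a spacelike section. -/
def IsSpacelikeSection.metric {j : S → N} (h : IsSpacelikeSection (G := G) g ι l j)
    (hN : IsNullHypersurface (F := F) g ι) : PseudoMetric G S :=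
  pullbackMetric g (ι ∘ j) (hN.immersion.contMDiff.comp h.immersion.contMDiff) (by
    intro s v hv
    by_contra hne
    exact (h.spacelike s v hne).ne' (hv v))

variable (g ι l)

/-- The pullback `ω̃` of the rotation 1-form to a section. -/
def rotationFormOn (j : S → N) (s : S) (v : TangentSpace 𝓘(ℝ, G) s) : ℝ :=
  rotationForm g ι l (j s) (mfderiv 𝓘(ℝ, G) 𝓘(ℝ, F) j s v)

end Hypersurface

end NullGeom

end

set_option linter.unusedSectionVars false

noncomputable section

namespace NullGeom

/-! ### Covariant derivatives along maps between normed spaces -/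

section Calculus

variable {E : Type*} [NormedAddCommGroup E] [NormedSpace ℝ E]
  {P : Type*} [NormedAddCommGroup P] [NormedSpace ℝ P]
  {Q : Type*} [NormedAddCommGroup Q] [NormedSpace ℝ Q]
  {W : Type*} [NormedAddCommGroup W] [NormedSpace ℝ W]

/-! On `Δ` the direction of `ℓ` is exactly the orthogonal complement of the tangent space. The form
`K(u, w) = g(∇_u ℓ, w)` on `Δ` is symmetric, because `g(ℓ, ·) = 0` there and `∇` has no torsion; it
is skew, because the flow of `ℓ` preserves `q`. Hence `K = 0` (`covAlong_normal_perp`), so `∇_u ℓ =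
ω(u) ℓ`, and derivatives of tangent fields along `Δ` are again tangent.

Expanding `[ℒ_ℓ, D] = 0` with the torsion-free property and comparing with the definition of
curvature gives, for `u`, `w` tangent to `Δ`, `R(ℓ, u) w = -((D_u ω)(w) + ω(u) ω(w)) ℓ`
(`IsNullMap.riem_normal`).

On a spacelike section, `D_a b = D̃_a b + η ℓ` (`exists_gauss`). As `∇ℓ` is proportional to `ℓ`, the
normal part only ever produces multiples of `ℓ`, so `R(c, a) b` equals the intrinsic `R̃(c, a) b`
modulo `ℓ`, without terms quadratic in a second fundamental form (`exists_riem_eq`). Extremality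
says `ω(ℓ) = 0`, which removes `η` from `D_a ω_b`; thus `R(ℓ, a) b = -(D̃_a ω̃_b + ω̃_a ω̃_b) ℓ`
(`riem_normal_section`).

The Ricci tensor is the trace of `z ↦ R(z, a) b`, computed along the flag spanned by `ℓ`, then the
tangent space of the section, then a vector `m` with `g(m, ℓ) = 1` (`trace_of_flag`). The line of
`ℓ` contributes `-(D̃_a ω̃_b + ω̃_a ω̃_b)` and the section contributes its own Ricci tensor. The
diagonal entry at `m` is `g(R(m, a) b, ℓ) = g(R(ℓ, b) a, m)`, by the pair symmetry of `R`, so it is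
the first contribution with `a` and `b` exchanged. The sum of the three is the identity
(`trace_riemLin`).

The argument is carried out between vector spaces, with Christoffel symbols and covariant
derivatives along maps. The invariant objects are brought to this form in preferred charts, whose
derivative at the centre is the identity of the tangent space; the hypotheses on Lie derivatives are
tested on fields that are constant in the chart. -/

instance clmNormedAddCommGroup : NormedAddCommGroup (P →L[ℝ] W) :=
  ContinuousLinearMap.toNormedAddCommGroup

instance clmNormedSpace : NormedSpace ℝ (P →L[ℝ] W) := ContinuousLinearMap.toNormedSpace

instance bilinNormedAddCommGroup : NormedAddCommGroup (Q →L[ℝ] P →L[ℝ] W) :=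
  ContinuousLinearMap.toNormedAddCommGroup

instance bilinNormedSpace : NormedSpace ℝ (Q →L[ℝ] P →L[ℝ] W) := ContinuousLinearMap.toNormedSpace

theorem fderiv_bilin_apply {A : P → E →L[ℝ] E →L[ℝ] W} {a b : P → E} {p : P}
    (hA : DifferentiableAt ℝ A p) (ha : DifferentiableAt ℝ a p) (hb : DifferentiableAt ℝ b p)
    (u : P) :
    fderiv ℝ (fun q => A q (a q) (b q)) p u =
      fderiv ℝ A p u (a p) (b p) + A p (fderiv ℝ a p u) (b p) + A p (a p) (fderiv ℝ b p u) := by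
  rw [fderiv_clm_apply (hA.clm_apply ha) hb, fderiv_clm_apply hA ha]
  simp
  abel

/-- The covariant derivative along `φ : P → E` of the field `Y`, in the direction `v`, for the
connection on `E` with Christoffel symbols `Γ`. -/
def covAlong (Γ : E → E →L[ℝ] E →L[ℝ] E) (φ Y : P → E) (p v : P) : E :=
  fderiv ℝ Y p v + Γ (φ p) (fderiv ℝ φ p v) (Y p)

/-- The Riemann tensor of the connection with Christoffel symbols `Γ`. -/
def riem (Γ : E → E →L[ℝ] E →L[ℝ] E) (x u v w : E) : E :=
  fderiv ℝ Γ x u v w - fderiv ℝ Γ x v u w + Γ x u (Γ x v w) - Γ x v (Γ x u w)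

/-- `Γ` is the field of Christoffel symbols of the metric `B` on the open set `Ω`. -/
structure IsLeviCivita (Ω : Set E) (B : E → E →L[ℝ] E →L[ℝ] ℝ)
    (Γ : E → E →L[ℝ] E →L[ℝ] E) : Prop where
  isOpen : IsOpen Ω
  smooth_metric : ∀ x ∈ Ω, ContDiffAt ℝ ∞ B x
  symm_metric : ∀ x ∈ Ω, ∀ a b, B x a b = B x b a
  nondeg : ∀ x ∈ Ω, ∀ a, (∀ b, B x a b = 0) → a = 0
  smooth : ∀ x ∈ Ω, ContDiffAt ℝ ∞ Γ x
  symm : ∀ x ∈ Ω, ∀ a b, Γ x a b = Γ x b a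
  compat : ∀ x ∈ Ω, ∀ v a b, fderiv ℝ B x v a b = B x (Γ x v a) b + B x a (Γ x v b)

variable {Γ : E → E →L[ℝ] E →L[ℝ] E} {B : E → E →L[ℝ] E →L[ℝ] ℝ} {Ω : Set E}

theorem covAlong_add_field {φ Y Z : P → E} {p v : P} (hY : DifferentiableAt ℝ Y p)
    (hZ : DifferentiableAt ℝ Z p) :
    covAlong Γ φ (fun q => Y q + Z q) p v = covAlong Γ φ Y p v + covAlong Γ φ Z p v := by
  simp only [covAlong, fderiv_fun_add hY hZ]
  simp
  abel

theorem covAlong_sub_field {φ Y Z : P → E} {p v : P} (hY : DifferentiableAt ℝ Y p)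
    (hZ : DifferentiableAt ℝ Z p) :
    covAlong Γ φ (fun q => Y q - Z q) p v = covAlong Γ φ Y p v - covAlong Γ φ Z p v := by
  simp only [covAlong, fderiv_fun_sub hY hZ]
  simp
  abel

theorem covAlong_smul_field {φ Y : P → E} {f : P → ℝ} {p v : P} (hf : DifferentiableAt ℝ f p)
    (hY : DifferentiableAt ℝ Y p) :
    covAlong Γ φ (fun q => f q • Y q) p v = f p • covAlong Γ φ Y p v + fderiv ℝ f p v • Y p := by
  simp only [covAlong, fderiv_fun_smul hf hY]
  simp
  abel

theorem covAlong_add_dir {φ Y : P → E} {p v w : P} :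
    covAlong Γ φ Y p (v + w) = covAlong Γ φ Y p v + covAlong Γ φ Y p w := by
  simp [covAlong]
  abel

theorem covAlong_smul_dir {φ Y : P → E} {p v : P} {c : ℝ} :
    covAlong Γ φ Y p (c • v) = c • covAlong Γ φ Y p v := by
  simp [covAlong]

theorem covAlong_neg_dir {φ Y : P → E} {p v : P} :
    covAlong Γ φ Y p (-v) = -covAlong Γ φ Y p v := by
  simp [covAlong]
  abel

theorem covAlong_congr {φ Y Z : P → E} {p v : P} (h : Y =ᶠ[𝓝 p] Z) :
    covAlong Γ φ Y p v = covAlong Γ φ Z p v := by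
  simp only [covAlong, h.fderiv_eq, h.eq_of_nhds]

theorem covAlong_comp {φ Y : P → E} {k : Q → P} {q v : Q} (hφ : DifferentiableAt ℝ φ (k q))
    (hY : DifferentiableAt ℝ Y (k q)) (hk : DifferentiableAt ℝ k q) :
    covAlong Γ (fun r => φ (k r)) (fun r => Y (k r)) q v =
      covAlong Γ φ Y (k q) (fderiv ℝ k q v) := by
  have h1 := fderiv_comp q hφ hk
  have h2 := fderiv_comp q hY hk
  simp only [Function.comp_def] at h1 h2
  simp [covAlong, h1, h2]

theorem fderiv_comp_dir {A : E → W} {φ : P → E} {p : P} (hA : DifferentiableAt ℝ A (φ p))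
    (hφ : DifferentiableAt ℝ φ p) (v : P) :
    fderiv ℝ (fun q => A (φ q)) p v = fderiv ℝ A (φ p) (fderiv ℝ φ p v) := by
  have h := fderiv_comp p hA hφ
  rw [Function.comp_def] at h
  rw [h]
  rfl

theorem contDiffAt_fderiv_apply {f : P → W} {v : P → P} {p : P} (h : ContDiffAt ℝ ∞ f p)
    (hv : ContDiffAt ℝ ∞ v p) : ContDiffAt ℝ ∞ (fun q => fderiv ℝ f q (v q)) p :=
  (h.fderiv_right (m := ∞) (by simp)).clm_apply hv

theorem contDiffAt_covAlong {φ Y : P → E} {v : P → P} {p : P} (hΓ : ContDiffAt ℝ ∞ Γ (φ p))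
    (hφ : ContDiffAt ℝ ∞ φ p) (hY : ContDiffAt ℝ ∞ Y p) (hv : ContDiffAt ℝ ∞ v p) :
    ContDiffAt ℝ ∞ (fun q => covAlong Γ φ Y q (v q)) p :=
  (contDiffAt_fderiv_apply hY hv).add
    (((hΓ.comp p hφ).clm_apply (contDiffAt_fderiv_apply hφ hv)).clm_apply hY)

theorem two_le_infty : (2 : WithTop ℕ∞) ≤ ∞ := by
  exact WithTop.coe_le_coe.2 (le_top : (2 : ℕ∞) ≤ ⊤)

theorem fderiv_fderiv_swap {f : P → W} {p : P} (h : ContDiffAt ℝ ∞ f p) (u v : P) :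
    fderiv ℝ (fun q => fderiv ℝ f q v) p u = fderiv ℝ (fun q => fderiv ℝ f q u) p v := by
  have hd : DifferentiableAt ℝ (fderiv ℝ f) p :=
    (h.fderiv_right (m := ∞) (by simp)).differentiableAt (by simp)
  rw [fderiv_clm_apply hd (differentiableAt_const v), fderiv_clm_apply hd
    (differentiableAt_const u)]
  simpa using (h.isSymmSndFDerivAt (by simpa using two_le_infty)) u v

/-- The constant fields `u`, `v` commute, so no bracket appears; what remains is the symmetry of the
second derivative of `φ` and of `Γ`. -/
theorem covAlong_torsion (hs : ∀ x ∈ Ω, ∀ a b, Γ x a b = Γ x b a) {φ : P → E} {p : P}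
    (hp : φ p ∈ Ω) (hφ : ContDiffAt ℝ ∞ φ p) (u v : P) :
    covAlong Γ φ (fun q => fderiv ℝ φ q v) p u = covAlong Γ φ (fun q => fderiv ℝ φ q u) p v := by
  rw [covAlong, covAlong, fderiv_fderiv_swap hφ, hs _ hp]

/-- The torsion-free property for fields that need not be constant. -/
theorem covAlong_fderiv_apply {φ : P → E} {y : P → P} {p : P} (hφ : ContDiffAt ℝ ∞ φ p)
    (hy : DifferentiableAt ℝ y p) (u : P) :
    covAlong Γ φ (fun q => fderiv ℝ φ q (y q)) p u =
      covAlong Γ φ (fun q => fderiv ℝ φ q (y p)) p u + fderiv ℝ φ p (fderiv ℝ y p u) := by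
  have hd : DifferentiableAt ℝ (fderiv ℝ φ) p :=
    (hφ.fderiv_right (m := ∞) (by simp)).differentiableAt (by simp)
  simp only [covAlong, fderiv_clm_apply hd hy, fderiv_clm_apply hd (differentiableAt_const (y p))]
  simp
  abel

theorem covAlong_metric (h : IsLeviCivita Ω B Γ) {φ Y Z : P → E} {p : P} (hp : φ p ∈ Ω)
    (hφ : DifferentiableAt ℝ φ p) (hY : DifferentiableAt ℝ Y p) (hZ : DifferentiableAt ℝ Z p)
    (v : P) :
    fderiv ℝ (fun q => B (φ q) (Y q) (Z q)) p v =
      B (φ p) (covAlong Γ φ Y p v) (Z p) + B (φ p) (Y p) (covAlong Γ φ Z p v) := by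
  have hB : DifferentiableAt ℝ B (φ p) := (h.smooth_metric _ hp).differentiableAt (by simp)
  have hA : DifferentiableAt ℝ (fun q => B (φ q)) p := hB.comp p hφ
  rw [fderiv_bilin_apply hA hY hZ v, fderiv_comp_dir hB hφ, h.compat _ hp]
  simp only [covAlong]
  simp
  ring

/-- The curvature of the pulled back connection is the pullback of the curvature. The second
derivatives of `φ` and `Y` cancel in the commutator, and `u`, `v` being constant there is no bracket
term. No immersivity of `φ` is needed, so this serves the hypersurface, the section and the identity
map alike. -/
theorem covAlong_curvature {φ Y : P → E} {p : P} (hΓ : ContDiffAt ℝ ∞ Γ (φ p))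
    (hφ : ContDiffAt ℝ ∞ φ p) (hY : ContDiffAt ℝ ∞ Y p) (u v : P) :
    covAlong Γ φ (fun q => covAlong Γ φ Y q v) p u - covAlong Γ φ (fun q => covAlong Γ φ Y q u) p v
      = riem Γ (φ p) (fderiv ℝ φ p u) (fderiv ℝ φ p v) (Y p) := by
  have hΓd : DifferentiableAt ℝ Γ (φ p) := hΓ.differentiableAt (by simp)
  have hφd : DifferentiableAt ℝ φ p := hφ.differentiableAt (by simp)
  have hYd : DifferentiableAt ℝ Y p := hY.differentiableAt (by simp)
  have hY1 : ∀ v, DifferentiableAt ℝ (fun q => fderiv ℝ Y q v) p := fun v =>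
    (contDiffAt_fderiv_apply hY contDiffAt_const).differentiableAt (by simp)
  have hφ1 : ∀ v, DifferentiableAt ℝ (fun q => fderiv ℝ φ q v) p := fun v =>
    (contDiffAt_fderiv_apply hφ contDiffAt_const).differentiableAt (by simp)
  have hA : DifferentiableAt ℝ (fun q => Γ (φ q)) p := hΓd.comp p hφd
  have key : ∀ u v, fderiv ℝ (fun q => covAlong Γ φ Y q v) p u =
      fderiv ℝ (fun q => fderiv ℝ Y q v) p u +
      (fderiv ℝ Γ (φ p) (fderiv ℝ φ p u) (fderiv ℝ φ p v) (Y p) +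
        Γ (φ p) (fderiv ℝ (fun q => fderiv ℝ φ q v) p u) (Y p) +
        Γ (φ p) (fderiv ℝ φ p v) (fderiv ℝ Y p u)) := by
    intro u v
    simp only [covAlong]
    rw [fderiv_fun_add (hY1 v) ((hA.clm_apply (hφ1 v)).clm_apply hYd)]
    rw [add_apply, fderiv_bilin_apply hA (hφ1 v) hYd, fderiv_comp_dir hΓd hφd]
  have e : ∀ (Z : P → E) (v : P), covAlong Γ φ Z p v =
      fderiv ℝ Z p v + Γ (φ p) (fderiv ℝ φ p v) (Z p) := fun _ _ => rfl
  rw [e (fun q => covAlong Γ φ Y q v), key, e (fun q => covAlong Γ φ Y q u), key, fderiv_fderiv_swap hφ u v, fderiv_fderiv_swap hY u v, riem]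
  simp only [covAlong, map_add]
  abel

theorem riem_antisymm (x u v w : E) : riem Γ x u v w = -riem Γ x v u w := by
  simp only [riem]; abel

theorem riem_bianchi (h : IsLeviCivita Ω B Γ) {x : E} (hx : x ∈ Ω) (u v w : E) :
    riem Γ x u v w + riem Γ x v w u + riem Γ x w u v = 0 := by
  have hd : ∀ a b c, fderiv ℝ Γ x a b c = fderiv ℝ Γ x a c b := by
    intro a b c
    have hΓ : DifferentiableAt ℝ Γ x := (h.smooth x hx).differentiableAt (by simp)
    have h1 : fderiv ℝ (fun y => Γ y b c) x a = fderiv ℝ (fun y => Γ y c b) x a := by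
      refine congrArg (fun L : E →L[ℝ] E => L a) (Filter.EventuallyEq.fderiv_eq ?_)
      filter_upwards [h.isOpen.mem_nhds hx] with y hy using h.symm y hy b c
    rw [fderiv_bilin_apply hΓ (differentiableAt_const b) (differentiableAt_const c),
      fderiv_bilin_apply hΓ (differentiableAt_const c) (differentiableAt_const b)] at h1
    simpa using h1
  simp only [riem]
  rw [hd u v w, hd v w u, hd w u v, h.symm x hx u v, h.symm x hx v w, h.symm x hx w u]
  abel

/-- The second derivatives of the function `B(w, z)`, for constant `w` and `z`, commute. Expanding
them twice by metric compatibility, the mixed products are symmetric in `u`, `v` and cancel, leaving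
`B(R w, z) + B(w, R z) = 0`. -/
theorem riem_skew (h : IsLeviCivita Ω B Γ) {x : E} (hx : x ∈ Ω) (u v w z : E) :
    B x (riem Γ x u v w) z = -B x w (riem Γ x u v z) := by
  have hid : ContDiffAt ℝ ∞ (fun y : E => y) x := contDiffAt_id
  have hc : ∀ w : E, ContDiffAt ℝ ∞ (fun _ : E => w) x := fun w => contDiffAt_const
  have hΓ := h.smooth x hx
  have key : ∀ u v, fderiv ℝ (fun y => fderiv ℝ (fun y => B y w z) y v) x u =
      B x (covAlong Γ (fun y => y) (fun q => covAlong Γ (fun y => y) (fun _ => w) q v) x u) z +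
      B x (covAlong Γ (fun y => y) (fun _ => w) x v) (covAlong Γ (fun y => y) (fun _ => z) x u) +
      (B x (covAlong Γ (fun y => y) (fun _ => w) x u) (covAlong Γ (fun y => y) (fun _ => z) x v) +
      B x w (covAlong Γ (fun y => y) (fun q => covAlong Γ (fun y => y) (fun _ => z) q v) x u)) := by
    intro u v
    have h1 : (fun y => fderiv ℝ (fun y => B y w z) y v) =ᶠ[𝓝 x] fun y =>
        B y (covAlong Γ (fun y => y) (fun _ => w) y v) z +
        B y w (covAlong Γ (fun y => y) (fun _ => z) y v) := by
      filter_upwards [h.isOpen.mem_nhds hx] with y hy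
      exact covAlong_metric h (φ := fun y => y) hy differentiableAt_id
        (differentiableAt_const w) (differentiableAt_const z) v
    have hw := (contDiffAt_covAlong hΓ hid (hc w) (hc v)).differentiableAt (by simp)
    have hz := (contDiffAt_covAlong hΓ hid (hc z) (hc v)).differentiableAt (by simp)
    have hB : DifferentiableAt ℝ B x := (h.smooth_metric _ hx).differentiableAt (by simp)
    rw [h1.fderiv_eq, fderiv_fun_add ((hB.clm_apply hw).clm_apply (differentiableAt_const z))
      ((hB.clm_apply (differentiableAt_const w)).clm_apply hz), add_apply,
      covAlong_metric h (φ := fun y => y) hx differentiableAt_id hw (differentiableAt_const z),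
      covAlong_metric h (φ := fun y => y) hx differentiableAt_id (differentiableAt_const w) hz]
  have hBs : ContDiffAt ℝ ∞ (fun y => B y w z) x :=
    ((h.smooth_metric x hx).clm_apply (hc w)).clm_apply (hc z)
  have e := fderiv_fderiv_swap hBs u v
  rw [key, key] at e
  have r1 := covAlong_curvature (φ := fun y : E => y) hΓ hid (hc w) u v
  have r2 := covAlong_curvature (φ := fun y : E => y) hΓ hid (hc z) u v
  simp only [fderiv_fun_id, ContinuousLinearMap.id_apply] at r1 r2
  rw [← r1, ← r2]
  simp only [map_sub, sub_apply]
  linarith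

/-- The classical octahedron argument: four first Bianchi identities, one for each cyclic shift of
the arguments, combined through skewness in the first pair and in the second pair. -/
theorem riem_pair_symm (h : IsLeviCivita Ω B Γ) {x : E} (hx : x ∈ Ω) (u v w z : E) :
    B x (riem Γ x u v w) z = B x (riem Γ x w z u) v := by
  have b : ∀ u v w z, B x (riem Γ x u v w) z + B x (riem Γ x v w u) z +
      B x (riem Γ x w u v) z = 0 := by
    intro u v w z
    rw [← add_apply, ← add_apply, ← map_add, ← map_add, riem_bianchi h hx]; simp
  have s : ∀ u v w z, B x (riem Γ x u v w) z = -B x (riem Γ x u v z) w := by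
    intro u v w z
    rw [riem_skew h hx, h.symm_metric x hx]
  have a : ∀ u v w z, B x (riem Γ x u v w) z = -B x (riem Γ x v u w) z := by
    intro u v w z
    rw [riem_antisymm]; simp
  linarith [b u v w z, b v w z u, b w z u v, b z u v w, s u v w z, s u v z w, s v w u z, s w u v z,
    s v w z u, s w z v u, s z v w u, s w z u v, s z u w v, s u w z v, s z u v w, s u v z w,
    s v z u w, a u v w z, a v w u z, a w u v z, a v z u w, a z u v w, a w z u v, a u w v z,
    a u w z v, a z v w u, a v w z u]

end Calculus

/-! ### Existence of smooth Christoffel symbols for a metric on an open set -/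

section Christoffel

variable {E : Type*} [NormedAddCommGroup E] [NormedSpace ℝ E] [FiniteDimensional ℝ E]

instance trilinNormedAddCommGroup : NormedAddCommGroup (E →L[ℝ] E →L[ℝ] E →L[ℝ] ℝ) :=
  ContinuousLinearMap.toNormedAddCommGroup

instance trilinNormedSpace : NormedSpace ℝ (E →L[ℝ] E →L[ℝ] E →L[ℝ] ℝ) :=
  ContinuousLinearMap.toNormedSpace

instance dualHomNormedAddCommGroup : NormedAddCommGroup ((E →L[ℝ] ℝ) →L[ℝ] E) :=
  ContinuousLinearMap.toNormedAddCommGroup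

instance dualHomNormedSpace : NormedSpace ℝ ((E →L[ℝ] ℝ) →L[ℝ] E) :=
  ContinuousLinearMap.toNormedSpace

/-- Presents a nondegenerate form as an invertible operator, near which operator inversion is
smooth; this is what makes the Christoffel symbols smooth. -/
theorem exists_continuousLinearEquiv_of_nondeg {A : E →L[ℝ] E →L[ℝ] ℝ}
    (hA : ∀ a, (∀ b, A a b = 0) → a = 0) : ∃ e : E ≃L[ℝ] (E →L[ℝ] ℝ), (e : E →L[ℝ] E →L[ℝ] ℝ) = A := by
  have hinj : Function.Injective A.toLinearMap :=
    (injective_iff_map_eq_zero _).2 fun v hv => hA v fun w =>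
      congrArg (fun L : E →L[ℝ] ℝ => L w) hv
  have hdim : Module.finrank ℝ E = Module.finrank ℝ (E →L[ℝ] ℝ) :=
    (Subspace.dual_finrank_eq (K := ℝ) (V := E)).symm.trans
      (LinearMap.toContinuousLinearMap (𝕜 := ℝ) (E := E) (F' := ℝ)).finrank_eq
  refine ⟨(LinearEquiv.ofInjectiveOfFinrankEq A.toLinearMap hinj hdim).toContinuousLinearEquiv, ?_⟩
  ext a b
  rfl

set_option synthInstance.maxHeartbeats 400000 in
set_option maxHeartbeats 1000000 in
/-- Half of the Koszul form of the derivative `D` of a metric. -/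
def koszulForm (D : E →L[ℝ] E →L[ℝ] E →L[ℝ] ℝ) : E →L[ℝ] E →L[ℝ] E →L[ℝ] ℝ :=
  (1 / 2 : ℝ) • (D + D.flip - ((ContinuousLinearMap.flipₗᵢ ℝ E E ℝ :
    (E →L[ℝ] E →L[ℝ] ℝ) ≃ₗᵢ[ℝ] (E →L[ℝ] E →L[ℝ] ℝ)) :
      (E →L[ℝ] E →L[ℝ] ℝ) →L[ℝ] (E →L[ℝ] E →L[ℝ] ℝ)).comp D.flip)

set_option synthInstance.maxHeartbeats 400000 in
set_option maxHeartbeats 1000000 in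
theorem koszulForm_apply (D : E →L[ℝ] E →L[ℝ] E →L[ℝ] ℝ) (a b c : E) :
    koszulForm D a b c = (1 / 2 : ℝ) * (D a b c + D b a c - D c a b) := by
  simp [koszulForm]

set_option synthInstance.maxHeartbeats 400000 in
set_option maxHeartbeats 1000000 in
theorem contDiff_koszulForm : ContDiff ℝ ∞ (koszulForm (E := E)) := by
  have hf : ContDiff ℝ ∞ fun D : E →L[ℝ] E →L[ℝ] E →L[ℝ] ℝ => D.flip :=
    (ContinuousLinearMap.flipₗᵢ ℝ E E (E →L[ℝ] ℝ)).contDiff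
  unfold koszulForm
  exact ((contDiff_id.add hf).sub (contDiff_const.clm_comp hf)).const_smul (1 / 2 : ℝ)

set_option synthInstance.maxHeartbeats 400000 in
set_option maxHeartbeats 1000000 in
/-- Existence of Christoffel symbols. -/
theorem exists_isLeviCivita {Ω : Set E} {B : E → E →L[ℝ] E →L[ℝ] ℝ} (hΩ : IsOpen Ω)
    (hB : ∀ x ∈ Ω, ContDiffAt ℝ ∞ B x) (hs : ∀ x ∈ Ω, ∀ a b, B x a b = B x b a)
    (hnd : ∀ x ∈ Ω, ∀ a, (∀ b, B x a b = 0) → a = 0) : ∃ Γ, IsLeviCivita Ω B Γ := by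
  have hcomp : CompleteSpace E := FiniteDimensional.complete ℝ E
  have hDs : ∀ x ∈ Ω, ∀ v a b, fderiv ℝ B x v a b = fderiv ℝ B x v b a := by
    intro x hx v a b
    have hd : DifferentiableAt ℝ B x := (hB x hx).differentiableAt (by simp)
    have h1 : fderiv ℝ (fun y => B y a b) x v = fderiv ℝ (fun y => B y b a) x v := by
      refine congrArg (fun L : E →L[ℝ] ℝ => L v) (Filter.EventuallyEq.fderiv_eq ?_)
      filter_upwards [hΩ.mem_nhds hx] with y hy using hs y hy a b
    rw [fderiv_bilin_apply hd (differentiableAt_const a) (differentiableAt_const b),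
      fderiv_bilin_apply hd (differentiableAt_const b) (differentiableAt_const a)] at h1
    simpa using h1
  -- The symbols of the first kind with an index raised by the inverse of the metric.
  let Γ : E → E →L[ℝ] E →L[ℝ] E := fun z =>
    ((ContinuousLinearMap.compL ℝ E (E →L[ℝ] ℝ) E) (B z).inverse).comp
      (koszulForm (fderiv ℝ B z))
  have hΓ : ∀ x ∈ Ω, ∀ a b c, B x (Γ x a b) c = koszulForm (fderiv ℝ B x) a b c := by
    intro x hx a b c
    obtain ⟨e, he⟩ := exists_continuousLinearEquiv_of_nondeg (hnd x hx)
    simp only [Γ, ContinuousLinearMap.comp_apply, ContinuousLinearMap.compL_apply]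
    rw [← he, ContinuousLinearMap.inverse_equiv]
    simp
  refine ⟨Γ, hΩ, hB, hs, hnd, ?_, ?_, ?_⟩
  · intro x hx
    obtain ⟨e, he⟩ := exists_continuousLinearEquiv_of_nondeg (hnd x hx)
    have h1 : ContDiffAt ℝ ∞ (fun z => (B z).inverse) x := by
      have := contDiffAt_map_inverse (n := ∞) e
      rw [he] at this
      exact this.comp x (hB x hx)
    have h2 : ContDiffAt ℝ ∞ (fun z => koszulForm (fderiv ℝ B z)) x :=
      contDiff_koszulForm.contDiffAt.comp x ((hB x hx).fderiv_right (m := ∞) (by simp))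
    exact ((ContinuousLinearMap.compL ℝ E (E →L[ℝ] ℝ) E).contDiff.contDiffAt.comp x h1).clm_comp h2
  · intro x hx a b
    have : Γ x a b - Γ x b a = 0 := by
      refine hnd x hx _ fun c => ?_
      rw [map_sub, sub_apply, hΓ x hx, hΓ x hx, koszulForm_apply, koszulForm_apply, hDs x hx c a b]
      ring
    exact sub_eq_zero.1 this
  · intro x hx v a b
    rw [hΓ x hx, hs x hx a, hΓ x hx, koszulForm_apply, koszulForm_apply, hDs x hx v b a,
      hDs x hx b v a, hDs x hx a v b]
    ring_nf

end Christoffel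

/-! ### Null hyperplanes of a nondegenerate form -/

section LinearAlgebra

variable {E : Type*} [NormedAddCommGroup E] [NormedSpace ℝ E] [FiniteDimensional ℝ E]
  {F : Type*} [NormedAddCommGroup F] [NormedSpace ℝ F] [FiniteDimensional ℝ F]

/-- The range of `A` lies in the kernel of `B (A l)`, and both are hyperplanes: the kernel because
`A l` is nonzero and `B` is nondegenerate. So they coincide. -/
theorem mem_range_of_null {A : F →L[ℝ] E} (hA : Function.Injective A)
    (hdim : Module.finrank ℝ F + 1 = Module.finrank ℝ E) {B : E →L[ℝ] E →L[ℝ] ℝ}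
    (hs : ∀ a b, B a b = B b a) (hnd : ∀ a, (∀ b, B a b = 0) → a = 0) {l : F} (hl : l ≠ 0)
    (hnull : ∀ w, B (A l) (A w) = 0) {x : E} (hx : B x (A l) = 0) : ∃ w, A w = x := by
  have hAl : B (A l) ≠ 0 := fun h => hl (hA (by
    rw [map_zero]; exact hnd _ fun b => by rw [h]; rfl))
  have hle : LinearMap.range A.toLinearMap ≤ LinearMap.ker (B (A l)).toLinearMap := by
    rintro _ ⟨w, rfl⟩
    exact hnull w
  have h1 : Module.finrank ℝ (LinearMap.range A.toLinearMap) = Module.finrank ℝ F :=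
    LinearMap.finrank_range_of_inj hA
  have h2 := LinearMap.finrank_range_add_finrank_ker (B (A l)).toLinearMap
  have h3 : Module.finrank ℝ (LinearMap.range (B (A l)).toLinearMap) = 1 := by
    have : LinearMap.range (B (A l)).toLinearMap = ⊤ := by
      refine LinearMap.range_eq_top.2 (LinearMap.surjective_of_ne_zero fun h => hAl ?_)
      exact ContinuousLinearMap.coe_injective h
    rw [this]; simp
  have heq := Submodule.eq_of_le_of_finrank_eq hle (by omega)
  have : x ∈ LinearMap.range A.toLinearMap := by
    rw [heq]
    exact (hs _ _).trans hx
  exact this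

/-- With `k` normalised by `B (A l) k = 1`, the space is the range of `A` plus the line of `k`. The
vector `x - B x k • A l` is orthogonal to both, hence zero. -/
theorem eq_smul_of_perp_range {A : F →L[ℝ] E} (hA : Function.Injective A)
    (hdim : Module.finrank ℝ F + 1 = Module.finrank ℝ E) {B : E →L[ℝ] E →L[ℝ] ℝ}
    (hs : ∀ a b, B a b = B b a) (hnd : ∀ a, (∀ b, B a b = 0) → a = 0) {l : F} (hl : l ≠ 0)
    (hnull : ∀ w, B (A l) (A w) = 0) {x : E} (hx : ∀ w, B x (A w) = 0) : ∃ c : ℝ, x = c • A l := by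
  have hAl : A l ≠ 0 := fun h => hl (hA (by rw [h, map_zero]))
  obtain ⟨k₀, hk₀⟩ : ∃ k, B (A l) k ≠ 0 := by
    by_contra! h
    exact hAl (hnd _ h)
  obtain ⟨k, hk1⟩ : ∃ k, B (A l) k = 1 :=
    ⟨(B (A l) k₀)⁻¹ • k₀, by rw [map_smul, smul_eq_mul, inv_mul_cancel₀ hk₀]⟩
  refine ⟨B x k, ?_⟩
  rw [← sub_eq_zero]
  refine hnd _ fun y => ?_
  obtain ⟨w, hw⟩ := mem_range_of_null hA hdim hs hnd hl hnull (x := y - B y (A l) • k) (by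
    simp [hs k, hk1])
  have hy : y = A w + B y (A l) • k := by rw [hw]; abel
  have e1 : B (x - B x k • A l) (A w) = 0 := by simp [hx, hnull]
  have e2 : B (x - B x k • A l) k = 0 := by simp [hk1]
  rw [hy, map_add, map_smul, e1, e2]
  simp

end LinearAlgebra

/-! ### Smoothness of coefficients defined implicitly -/

section Smoothness

variable {E : Type*} [NormedAddCommGroup E] [NormedSpace ℝ E] [FiniteDimensional ℝ E]
  {F : Type*} [NormedAddCommGroup F] [NormedSpace ℝ F] [FiniteDimensional ℝ F]
  {P : Type*} [NormedAddCommGroup P] [NormedSpace ℝ P]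

/-- With a functional `ψ` that does not vanish at `n p`, the coefficient is the quotient `ψ(X) /
ψ(n)` near `p`. -/
theorem contDiffAt_of_smul_eq {X n : P → E} {c : P → ℝ} {p : P} (hX : ContDiffAt ℝ ∞ X p)
    (hn : ContDiffAt ℝ ∞ n p) (h0 : n p ≠ 0) (h : ∀ᶠ q in 𝓝 p, X q = c q • n q) :
    ContDiffAt ℝ ∞ c p := by
  obtain ⟨ψ, hψ⟩ := SeparatingDual.exists_eq_one (R := ℝ) h0
  have hψn : ContDiffAt ℝ ∞ (fun q => ψ (n q)) p := ψ.contDiff.contDiffAt.comp p hn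
  have hψX : ContDiffAt ℝ ∞ (fun q => ψ (X q)) p := ψ.contDiff.contDiffAt.comp p hX
  have hne : ψ (n p) ≠ 0 := by simp [hψ]
  refine (hψX.div hψn hne).congr_of_eventuallyEq ?_
  filter_upwards [h, hψn.continuousAt.eventually_ne hne] with q hq hq0
  rw [Pi.div_apply, hq, map_smul, smul_eq_mul, mul_div_assoc, div_self hq0, mul_one]

/-- If `R` is a left inverse of `A p`, then `R ∘ A q` is still invertible for `q` near `p`, and `δ =
(R ∘ A)⁻¹ (R X)` there. -/
theorem contDiffAt_of_clm_apply_eq {A : P → F →L[ℝ] E} {X : P → E} {δ : P → F} {p : P}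
    (hA : ContDiffAt ℝ ∞ A p) (hX : ContDiffAt ℝ ∞ X p) (hinj : Function.Injective (A p))
    (h : ∀ᶠ q in 𝓝 p, A q (δ q) = X q) : ContDiffAt ℝ ∞ δ p := by
  have hcomp : CompleteSpace F := FiniteDimensional.complete ℝ F
  obtain ⟨R, hR⟩ : ∃ R : E →L[ℝ] F, R.comp (A p) = ContinuousLinearMap.id ℝ F := by
    obtain ⟨R, hR⟩ := (A p).toLinearMap.exists_leftInverse_of_injective (LinearMap.ker_eq_bot.2 hinj)
    exact ⟨LinearMap.toContinuousLinearMap R, by ext w; exact LinearMap.congr_fun hR w⟩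
  have hT : ContDiffAt ℝ ∞ (fun q => R.comp (A q)) p := contDiffAt_const.clm_comp hA
  have hinv : ContDiffAt ℝ ∞ (fun q => (R.comp (A q)).inverse) p := by
    have := contDiffAt_map_inverse (n := ∞) (ContinuousLinearEquiv.refl ℝ F)
    have h0 : ((ContinuousLinearEquiv.refl ℝ F : F ≃L[ℝ] F) : F →L[ℝ] F) = R.comp (A p) := by
      rw [hR]; rfl
    rw [h0] at this
    exact this.comp p hT
  have hnear : ∀ᶠ q in 𝓝 p, (R.comp (A q)).IsInvertible := by
    have := (ContinuousLinearEquiv.nhds (ContinuousLinearEquiv.refl ℝ F))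
    have h0 : ((ContinuousLinearEquiv.refl ℝ F : F ≃L[ℝ] F) : F →L[ℝ] F) = R.comp (A p) := by
      rw [hR]; rfl
    rw [h0] at this
    filter_upwards [hT.continuousAt.eventually this] with q hq using hq
  have hRX : ContDiffAt ℝ ∞ (fun q => R (X q)) p := R.contDiff.contDiffAt.comp p hX
  refine (hinv.clm_apply hRX).congr_of_eventuallyEq ?_
  filter_upwards [h, hnear] with q hq hi
  rw [← hq]
  obtain ⟨e, he⟩ := hi
  have : R (A q (δ q)) = e (δ q) := by
    rw [← ContinuousLinearMap.comp_apply, ← he]; rfl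
  rw [this, ← he, ContinuousLinearMap.inverse_equiv]
  simp

end Smoothness

/-! ### Null hypersurfaces in coordinates: rotation form and curvature along the null normal -/

section NullMap

variable {E : Type*} [NormedAddCommGroup E] [NormedSpace ℝ E] [FiniteDimensional ℝ E]
  {F : Type*} [NormedAddCommGroup F] [NormedSpace ℝ F] [FiniteDimensional ℝ F]
  {Γ : E → E →L[ℝ] E →L[ℝ] E} {B : E → E →L[ℝ] E →L[ℝ] ℝ} {Ω : Set E}

/-- The curvature formula uses constant directions, whereas the null field `L` varies; this gives
the correction for freezing `L` at `z`. -/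
theorem covAlong_apply_dir {φ Y : F → E} {L : F → F} {z : F} (hΓ : ContDiffAt ℝ ∞ Γ (φ z))
    (hφ : ContDiffAt ℝ ∞ φ z) (hY : ContDiffAt ℝ ∞ Y z) (hL : ContDiffAt ℝ ∞ L z) (u : F) :
    covAlong Γ φ (fun q => covAlong Γ φ Y q (L q)) z u =
      covAlong Γ φ (fun q => covAlong Γ φ Y q (L z)) z u + covAlong Γ φ Y z (fderiv ℝ L z u) := by
  have hΓd : DifferentiableAt ℝ Γ (φ z) := hΓ.differentiableAt (by simp)
  have hφd : DifferentiableAt ℝ φ z := hφ.differentiableAt (by simp)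
  have hYd : DifferentiableAt ℝ Y z := hY.differentiableAt (by simp)
  have hLd : DifferentiableAt ℝ L z := hL.differentiableAt (by simp)
  have hA : DifferentiableAt ℝ (fun q => Γ (φ q)) z := hΓd.comp z hφd
  have hY' : DifferentiableAt ℝ (fderiv ℝ Y) z :=
    (hY.fderiv_right (m := ∞) (by simp)).differentiableAt (by simp)
  have hφ' : DifferentiableAt ℝ (fderiv ℝ φ) z :=
    (hφ.fderiv_right (m := ∞) (by simp)).differentiableAt (by simp)
  have key : ∀ v : F → F, DifferentiableAt ℝ v z →
      fderiv ℝ (fun q => covAlong Γ φ Y q (v q)) z u =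
      (fderiv ℝ (fderiv ℝ Y) z u (v z) + fderiv ℝ Y z (fderiv ℝ v z u)) +
      (fderiv ℝ Γ (φ z) (fderiv ℝ φ z u) (fderiv ℝ φ z (v z)) (Y z) +
        Γ (φ z) (fderiv ℝ (fderiv ℝ φ) z u (v z) + fderiv ℝ φ z (fderiv ℝ v z u)) (Y z) +
        Γ (φ z) (fderiv ℝ φ z (v z)) (fderiv ℝ Y z u)) := by
    intro v hv
    have e : ∀ {g : F → E}, DifferentiableAt ℝ (fderiv ℝ g) z →
        fderiv ℝ (fun q => fderiv ℝ g q (v q)) z u =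
        fderiv ℝ (fderiv ℝ g) z u (v z) + fderiv ℝ g z (fderiv ℝ v z u) := by
      intro g hg
      rw [fderiv_clm_apply hg hv]
      simp [add_comm]
    simp only [covAlong]
    rw [fderiv_fun_add (hY'.clm_apply hv) ((hA.clm_apply (hφ'.clm_apply hv)).clm_apply hYd)]
    rw [add_apply, fderiv_bilin_apply hA (hφ'.clm_apply hv) hYd, fderiv_comp_dir hΓd hφd, e hY',
      e hφ']
  have d : ∀ (Z : F → E) (v : F), covAlong Γ φ Z z v =
      fderiv ℝ Z z v + Γ (φ z) (fderiv ℝ φ z v) (Z z) := fun _ _ => rfl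
  rw [d (fun q => covAlong Γ φ Y q (L q)), key L hLd, d (fun q => covAlong Γ φ Y q (L z)),
    key (fun _ => L z) (differentiableAt_const _)]
  simp only [covAlong]
  simp
  abel

/-- A codimension-one immersion `φ` of the open set `V`, null for the metric `B` on `Ω`, with a
nowhere vanishing null field `L` whose flow preserves the pulled back metric. -/
structure IsNullMap (Ω : Set E) (B : E → E →L[ℝ] E →L[ℝ] ℝ) (V : Set F) (φ : F → E)
    (L : F → F) : Prop where
  isOpen : IsOpen V
  smooth : ∀ z ∈ V, ContDiffAt ℝ ∞ φ z
  maps : ∀ z ∈ V, φ z ∈ Ω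
  inj : ∀ z ∈ V, Function.Injective (fderiv ℝ φ z)
  codim : Module.finrank ℝ F + 1 = Module.finrank ℝ E
  smooth_field : ∀ z ∈ V, ContDiffAt ℝ ∞ L z
  ne_zero : ∀ z ∈ V, L z ≠ 0
  null : ∀ z ∈ V, ∀ w, B (φ z) (fderiv ℝ φ z (L z)) (fderiv ℝ φ z w) = 0
  lie_metric : ∀ z ∈ V, ∀ u w,
    fderiv ℝ (fun y => B (φ y) (fderiv ℝ φ y u) (fderiv ℝ φ y w)) z (L z) +
      B (φ z) (fderiv ℝ φ z (fderiv ℝ L z u)) (fderiv ℝ φ z w) +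
      B (φ z) (fderiv ℝ φ z u) (fderiv ℝ φ z (fderiv ℝ L z w)) = 0

namespace IsNullMap

variable {V : Set F} {φ : F → E} {L : F → F}

theorem smooth_normal (h : IsNullMap Ω B V φ L) {z : F} (hz : z ∈ V) :
    ContDiffAt ℝ ∞ (fun y => fderiv ℝ φ y (L y)) z :=
  contDiffAt_fderiv_apply (h.smooth z hz) (h.smooth_field z hz)

theorem normal_ne_zero (h : IsNullMap Ω B V φ L) {z : F} (hz : z ∈ V) :
    fderiv ℝ φ z (L z) ≠ 0 := fun h0 =>
  h.ne_zero z hz (h.inj z hz (by rw [h0, map_zero]))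

/-- The form `B(∇_u n, w)` with `n = dφ(L)` is skew by invariance of the induced metric (`e1`).
Differentiating `B(n, w) = 0` shows that it equals `-B(n, ∇_u w)` (`e2`), which is symmetric by
vanishing torsion. A form both symmetric and skew is zero. -/
theorem covAlong_normal_perp (h : IsNullMap Ω B V φ L) (hB : IsLeviCivita Ω B Γ) {z : F}
    (hz : z ∈ V) (u w : F) :
    B (φ z) (covAlong Γ φ (fun y => fderiv ℝ φ y (L y)) z u) (fderiv ℝ φ z w) = 0 := by
  have hΩ := h.maps z hz
  have hφ := h.smooth z hz
  have hL := h.smooth_field z hz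
  have hc : ∀ v : F, ContDiffAt ℝ ∞ (fun y => fderiv ℝ φ y v) z := fun v =>
    contDiffAt_fderiv_apply hφ contDiffAt_const
  have dφ : DifferentiableAt ℝ φ z := hφ.differentiableAt (by simp)
  have dc : ∀ v : F, DifferentiableAt ℝ (fun y => fderiv ℝ φ y v) z := fun v =>
    (hc v).differentiableAt (by simp)
  have dn := (h.smooth_normal hz).differentiableAt (by simp)
  have dL : DifferentiableAt ℝ L z := hL.differentiableAt (by simp)
  have e1 : ∀ u w, B (φ z) (covAlong Γ φ (fun y => fderiv ℝ φ y (L y)) z u) (fderiv ℝ φ z w) +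
      B (φ z) (covAlong Γ φ (fun y => fderiv ℝ φ y (L y)) z w) (fderiv ℝ φ z u) = 0 := by
    intro u w
    have e := h.lie_metric z hz u w
    rw [covAlong_metric hB hΩ dφ (dc u) (dc w), covAlong_torsion hB.symm hΩ hφ (L z) u,
      covAlong_torsion hB.symm hΩ hφ (L z) w] at e
    rw [covAlong_fderiv_apply hφ dL, covAlong_fderiv_apply hφ dL,
      hB.symm_metric _ hΩ _ (fderiv ℝ φ z u)]
    simp only [map_add, add_apply]
    linarith
  have e2 : ∀ u w, B (φ z) (covAlong Γ φ (fun y => fderiv ℝ φ y (L y)) z u) (fderiv ℝ φ z w) +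
      B (φ z) (fderiv ℝ φ z (L z)) (covAlong Γ φ (fun y => fderiv ℝ φ y w) z u) = 0 := by
    intro u w
    rw [← covAlong_metric hB hΩ dφ dn (dc w)]
    have : (fun y => B (φ y) (fderiv ℝ φ y (L y)) (fderiv ℝ φ y w)) =ᶠ[𝓝 z] fun _ => 0 := by
      filter_upwards [h.isOpen.mem_nhds hz] with y hy using h.null y hy w
    rw [this.fderiv_eq]
    simp
  have a := e1 u w
  have b := e2 u w
  have c := e2 w u
  rw [covAlong_torsion hB.symm hΩ hφ] at b
  linarith

theorem exists_covAlong_normal (h : IsNullMap Ω B V φ L) (hB : IsLeviCivita Ω B Γ) {z : F}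
    (hz : z ∈ V) (u : F) : ∃ c : ℝ,
    covAlong Γ φ (fun y => fderiv ℝ φ y (L y)) z u = c • fderiv ℝ φ z (L z) :=
  eq_smul_of_perp_range (h.inj z hz) h.codim (hB.symm_metric _ (h.maps z hz))
    (hB.nondeg _ (h.maps z hz)) (h.ne_zero z hz) (h.null z hz)
    (h.covAlong_normal_perp hB hz u)

/-- Differentiating `B(n, Y) = 0` and using that `∇_u n` is orthogonal to the hypersurface gives
`B(n, ∇_u Y) = 0`, so `∇_u Y` is tangent. This is why the induced connection exists. -/
theorem exists_fderiv_eq_covAlong (h : IsNullMap Ω B V φ L) (hB : IsLeviCivita Ω B Γ) {z : F}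
    (hz : z ∈ V) {y : F → F} (hy : DifferentiableAt ℝ y z) (u : F) : ∃ w,
    fderiv ℝ φ z w = covAlong Γ φ (fun q => fderiv ℝ φ q (y q)) z u := by
  have hΩ := h.maps z hz
  have hφ := h.smooth z hz
  have dφ : DifferentiableAt ℝ φ z := hφ.differentiableAt (by simp)
  have dn := (h.smooth_normal hz).differentiableAt (by simp)
  have dy : DifferentiableAt ℝ (fun q => fderiv ℝ φ q (y q)) z :=
    ((hφ.fderiv_right (m := ∞) (by simp)).differentiableAt (by simp)).clm_apply hy
  refine mem_range_of_null (h.inj z hz) h.codim (hB.symm_metric _ hΩ)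
    (hB.nondeg _ hΩ) (h.ne_zero z hz) (h.null z hz) ?_
  have : (fun q => B (φ q) (fderiv ℝ φ q (L q)) (fderiv ℝ φ q (y q))) =ᶠ[𝓝 z] fun _ => 0 := by
    filter_upwards [h.isOpen.mem_nhds hz] with q hq using h.null q hq _
  have e := covAlong_metric hB hΩ dφ dn dy u
  rw [this.fderiv_eq, h.covAlong_normal_perp hB hz] at e
  rw [hB.symm_metric _ hΩ]
  simpa using e.symm

end IsNullMap

variable (Γ) in
/-- The rotation form of the null field `L` along `φ`. -/
def rot (φ : F → E) (L : F → F) (z u : F) : ℝ :=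
  Classical.epsilon fun c : ℝ =>
    covAlong Γ φ (fun y => fderiv ℝ φ y (L y)) z u = c • fderiv ℝ φ z (L z)

namespace IsNullMap

variable {V : Set F} {φ : F → E} {L : F → F}

theorem covAlong_normal (h : IsNullMap Ω B V φ L) (hB : IsLeviCivita Ω B Γ) {z : F}
    (hz : z ∈ V) (u : F) :
    covAlong Γ φ (fun y => fderiv ℝ φ y (L y)) z u = rot Γ φ L z u • fderiv ℝ φ z (L z) :=
  Classical.epsilon_spec (h.exists_covAlong_normal hB hz u)

theorem rot_eq (h : IsNullMap Ω B V φ L) (hB : IsLeviCivita Ω B Γ) {z : F} (hz : z ∈ V) {u : F}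
    {c : ℝ} (hc : covAlong Γ φ (fun y => fderiv ℝ φ y (L y)) z u = c • fderiv ℝ φ z (L z)) :
    rot Γ φ L z u = c :=
  smul_left_injective ℝ (h.normal_ne_zero hz) ((h.covAlong_normal hB hz u).symm.trans hc)

theorem rot_add (h : IsNullMap Ω B V φ L) (hB : IsLeviCivita Ω B Γ) {z : F} (hz : z ∈ V)
    (u v : F) : rot Γ φ L z (u + v) = rot Γ φ L z u + rot Γ φ L z v := by
  refine h.rot_eq hB hz ?_
  rw [covAlong_add_dir, h.covAlong_normal hB hz, h.covAlong_normal hB hz, add_smul]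

theorem rot_smul (h : IsNullMap Ω B V φ L) (hB : IsLeviCivita Ω B Γ) {z : F} (hz : z ∈ V)
    (c : ℝ) (u : F) : rot Γ φ L z (c • u) = c * rot Γ φ L z u := by
  refine h.rot_eq hB hz ?_
  rw [covAlong_smul_dir, h.covAlong_normal hB hz, mul_smul]

theorem smooth_rot (h : IsNullMap Ω B V φ L) (hB : IsLeviCivita Ω B Γ) {z : F} (hz : z ∈ V)
    {y : F → F} (hy : ContDiffAt ℝ ∞ y z) : ContDiffAt ℝ ∞ (fun q => rot Γ φ L q (y q)) z := by
  refine contDiffAt_of_smul_eq (contDiffAt_covAlong (hB.smooth _ (h.maps z hz)) (h.smooth z hz)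
    (h.smooth_normal hz) hy) (h.smooth_normal hz) (h.normal_ne_zero hz) ?_
  filter_upwards [h.isOpen.mem_nhds hz] with q hq using h.covAlong_normal hB hq (y q)

/-- The rotation form is linear, so it has a smooth representative with values in the dual. -/
theorem exists_rot_clm (h : IsNullMap Ω B V φ L) (hB : IsLeviCivita Ω B Γ) {z : F} (hz : z ∈ V) :
    ∃ ρ : F → F →L[ℝ] ℝ, DifferentiableAt ℝ ρ z ∧ ∀ q ∈ V, ∀ u, ρ q u = rot Γ φ L q u := by
  classical
  let b := Module.finBasis ℝ F
  let ρ : F → F →L[ℝ] ℝ := fun q => ∑ i, rot Γ φ L q (b i) • LinearMap.toContinuousLinearMap (b.coord i)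
  refine ⟨ρ, ?_, fun q hq u => ?_⟩
  · refine DifferentiableAt.fun_sum fun i _ => DifferentiableAt.smul_const ?_ _
    exact (h.smooth_rot hB hz contDiffAt_const).differentiableAt (by simp)
  · let r : F →ₗ[ℝ] ℝ :=
      { toFun := rot Γ φ L q
        map_add' := h.rot_add hB hq
        map_smul' := h.rot_smul hB hq }
    have hr : r u = ∑ i, b.repr u i * r (b i) := by
      conv_lhs => rw [← b.sum_repr u, map_sum]
      simp
    change ρ q u = r u
    rw [hr]
    simp only [ρ, sum_apply, smul_apply, smul_eq_mul]
    exact Finset.sum_congr rfl fun i _ => mul_comm _ _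

/-- The curvature of the ambient connection contracted with the null normal, when the flow of the
null field preserves the induced connection. -/
theorem riem_normal (h : IsNullMap Ω B V φ L) (hB : IsLeviCivita Ω B Γ)
    (hconn : ∀ (u w : F) (δ : F → F), (∀ z ∈ V, fderiv ℝ φ z (δ z) =
        covAlong Γ φ (fun y => fderiv ℝ φ y w) z u) → ∀ z ∈ V,
      fderiv ℝ φ z (fderiv ℝ δ z (L z) - fderiv ℝ L z (δ z)) +
        covAlong Γ φ (fun y => fderiv ℝ φ y w) z (fderiv ℝ L z u) +
        covAlong Γ φ (fun y => fderiv ℝ φ y (fderiv ℝ L y w)) z u = 0)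
    {z : F} (hz : z ∈ V) {u w d : F}
    (hd : fderiv ℝ φ z d = covAlong Γ φ (fun y => fderiv ℝ φ y w) z u) :
    riem Γ (φ z) (fderiv ℝ φ z (L z)) (fderiv ℝ φ z u) (fderiv ℝ φ z w) =
      -((fderiv ℝ (fun q => rot Γ φ L q w) z u - rot Γ φ L z d +
        rot Γ φ L z u * rot Γ φ L z w) • fderiv ℝ φ z (L z)) := by
  have hΩ := h.maps z hz
  have hΓ := hB.smooth _ hΩ
  have hφ := h.smooth z hz
  have hL := h.smooth_field z hz
  have hn := h.smooth_normal hz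
  have hc : ∀ v : F, ContDiffAt ℝ ∞ (fun y => fderiv ℝ φ y v) z := fun v =>
    contDiffAt_fderiv_apply hφ contDiffAt_const
  have dL : DifferentiableAt ℝ L z := hL.differentiableAt (by simp)
  have hX : ContDiffAt ℝ ∞ (fun q => covAlong Γ φ (fun y => fderiv ℝ φ y w) q u) z :=
    contDiffAt_covAlong hΓ hφ (hc w) contDiffAt_const
  -- `δ` is the coordinate expression of `D_u w`; outside `V` its value is arbitrary.
  have hex : ∀ q, ∃ δ, q ∈ V →
      fderiv ℝ φ q δ = covAlong Γ φ (fun y => fderiv ℝ φ y w) q u := by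
    intro q
    by_cases hq : q ∈ V
    · obtain ⟨δ, hδ⟩ := h.exists_fderiv_eq_covAlong hB hq (differentiableAt_const w) u
      exact ⟨δ, fun _ => hδ⟩
    · exact ⟨0, fun h => absurd h hq⟩
  choose δ hδ using hex
  have hδe : ∀ᶠ q in 𝓝 z, fderiv ℝ φ q (δ q) =
      covAlong Γ φ (fun y => fderiv ℝ φ y w) q u := by
    filter_upwards [h.isOpen.mem_nhds hz] with q hq using hδ q hq
  have hδs : ContDiffAt ℝ ∞ δ z :=
    contDiffAt_of_clm_apply_eq (hφ.fderiv_right (m := ∞) (by simp)) hX (h.inj z hz) hδe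
  have dδ : DifferentiableAt ℝ δ z := hδs.differentiableAt (by simp)
  have hdd : d = δ z := h.inj z hz (hd.trans (hδ z hz).symm)
  have key := hconn u w δ hδ z hz
  -- The three terms of the commutator identity are rewritten through iterated derivatives: `t1`
  -- gives `dφ(∂_L δ)` from `∇_L ∇_u w`, `t2` gives `dφ(∂_δ L)` from `∇_δ n = ω(δ) n`, and `t3`
  -- gives `dφ(∂_w L) = ω(w) n - ∇_L w`, valid near `z` so that it may be differentiated along `u`.
  have t1 := covAlong_fderiv_apply (Γ := Γ) hφ dδ (L z)
  rw [covAlong_congr hδe, covAlong_torsion hB.symm hΩ hφ] at t1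
  have t2 := covAlong_fderiv_apply (Γ := Γ) hφ dL (δ z)
  rw [h.covAlong_normal hB hz] at t2
  have t3 : (fun y => fderiv ℝ φ y (fderiv ℝ L y w)) =ᶠ[𝓝 z] fun y =>
      rot Γ φ L y w • fderiv ℝ φ y (L y) -
        covAlong Γ φ (fun y => fderiv ℝ φ y w) y (L y) := by
    filter_upwards [h.isOpen.mem_nhds hz] with y hy
    rw [← h.covAlong_normal hB hy, covAlong_fderiv_apply (h.smooth y hy)
      ((h.smooth_field y hy).differentiableAt (by simp)),
      covAlong_torsion hB.symm (h.maps y hy) (h.smooth y hy)]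
    abel
  have hrw : ContDiffAt ℝ ∞ (fun q => rot Γ φ L q w) z := h.smooth_rot hB hz contDiffAt_const
  have dXL : DifferentiableAt ℝ (fun y => covAlong Γ φ (fun y => fderiv ℝ φ y w) y (L y)) z :=
    (contDiffAt_covAlong hΓ hφ (hc w) hL).differentiableAt (by simp)
  have drn : DifferentiableAt ℝ (fun q => rot Γ φ L q w • fderiv ℝ φ q (L q)) z :=
    (hrw.smul hn).differentiableAt (by simp)
  rw [covAlong_congr t3, covAlong_sub_field drn dXL,
    covAlong_smul_field (hrw.differentiableAt (by simp)) (hn.differentiableAt (by simp)),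
    h.covAlong_normal hB hz, covAlong_apply_dir hΓ hφ (hc w) hL] at key
  have c1 := covAlong_curvature hΓ hφ (hc w) (L z) u
  rw [← c1, hdd]
  rw [map_sub] at key
  have t1' : fderiv ℝ φ z (fderiv ℝ δ z (L z)) =
      covAlong Γ φ (fun q => covAlong Γ φ (fun y => fderiv ℝ φ y w) q u) z (L z) -
        covAlong Γ φ (fun q => fderiv ℝ φ q (L z)) z (δ z) := by rw [t1]; abel
  have t2' : fderiv ℝ φ z (fderiv ℝ L z (δ z)) = rot Γ φ L z (δ z) • fderiv ℝ φ z (L z) -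
      covAlong Γ φ (fun q => fderiv ℝ φ q (L z)) z (δ z) := by rw [t2]; abel
  rw [t1', t2'] at key
  -- The terms containing `∂_u L` and those containing `∇_δ dφ(L)`, with `L` frozen at `z`, cancel
  -- in pairs; what is left is the curvature commutator plus the stated multiple of `n`.
  rw [← sub_eq_zero, ← key]
  module

end IsNullMap

end NullMap

/-! ### The trace of an endomorphism along a flag -/

section TraceLemma

variable {E : Type*} [NormedAddCommGroup E] [NormedSpace ℝ E] [FiniteDimensional ℝ E]
  {H : Type*} [NormedAddCommGroup H] [NormedSpace ℝ H] [FiniteDimensional ℝ H]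

/-- `A` is block triangular for the flag formed by the line of `n`, this line plus the range of `J`,
and the whole space; only the diagonal blocks `α`, `A'`, `β` matter. Independence and the dimension
count make `J`, `n`, `k` a splitting of `E`. -/
theorem trace_of_flag (A : E →ₗ[ℝ] E) (A' : H →ₗ[ℝ] H) (J : H →ₗ[ℝ] E) (n k : E) (α β : ℝ)
    (hdim : Module.finrank ℝ H + 2 = Module.finrank ℝ E)
    (hind : ∀ (v : H) (c d : ℝ), J v + c • n + d • k = 0 → v = 0 ∧ c = 0 ∧ d = 0)
    (hJ : ∀ v, ∃ μ : ℝ, A (J v) = J (A' v) + μ • n) (hn : A n = α • n)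
    (hk : ∃ (v : H) (c : ℝ), A k = β • k + (J v + c • n)) :
    LinearMap.trace ℝ E A = LinearMap.trace ℝ H A' + α + β := by
  classical
  let Φ₀ : (H × ℝ) × ℝ →ₗ[ℝ] E :=
    (J.coprod (LinearMap.toSpanSingleton ℝ E n)).coprod (LinearMap.toSpanSingleton ℝ E k)
  have hΦ₀ : ∀ v c d, Φ₀ ((v, c), d) = J v + c • n + d • k := fun v c d => by
    simp [Φ₀]
  have hinj : Function.Injective Φ₀ := by
    rw [injective_iff_map_eq_zero]
    rintro ⟨⟨v, c⟩, d⟩ h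
    rw [hΦ₀] at h
    obtain ⟨rfl, rfl, rfl⟩ := hind v c d h
    rfl
  let Φ := LinearEquiv.ofInjectiveOfFinrankEq Φ₀ hinj (by simp [← hdim])
  have hΦ : ∀ v c d, Φ ((v, c), d) = J v + c • n + d • k := hΦ₀
  let bH := Module.finBasis ℝ H
  let b' := (bH.prod (Module.Basis.singleton Unit ℝ)).prod (Module.Basis.singleton Unit ℝ)
  let b := b'.map Φ
  have hrepr : ∀ v c d, b.repr (J v + c • n + d • k) = b'.repr ((v, c), d) := by
    intro v c d
    rw [← hΦ]
    simp [b]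
  rw [LinearMap.trace_eq_matrix_trace ℝ b, LinearMap.trace_eq_matrix_trace ℝ bH]
  simp only [Matrix.trace, Matrix.diag, LinearMap.toMatrix_apply]
  rw [Fintype.sum_sum_type, Fintype.sum_sum_type]
  have e1 : ∀ i, b (Sum.inl (Sum.inl i)) = J (bH i) := by
    intro i
    have : b (Sum.inl (Sum.inl i)) = Φ ((bH i, 0), 0) := by simp [b, b']
    rw [this, hΦ]; simp
  have e2 : b (Sum.inl (Sum.inr ())) = n := by
    have : b (Sum.inl (Sum.inr ())) = Φ ((0, 1), 0) := by simp [b, b']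
    rw [this, hΦ]; simp
  have e3 : b (Sum.inr ()) = k := by
    have : b (Sum.inr ()) = Φ ((0, 0), 1) := by simp [b, b']; rfl
    rw [this, hΦ]; simp
  obtain ⟨v, c, hvc⟩ := hk
  congr 1
  · congr 1
    · refine Finset.sum_congr rfl fun i _ => ?_
      obtain ⟨μ, hμ⟩ := hJ (bH i)
      rw [e1, hμ, show J (A' (bH i)) + μ • n = J (A' (bH i)) + μ • n + (0 : ℝ) • k by simp, hrepr]
      simp [b']
    · simp only [Finset.univ_unique, PUnit.default_eq_unit, Finset.sum_singleton]
      rw [e2, hn, show α • n = J 0 + α • n + (0 : ℝ) • k by simp, hrepr]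
      simp [b']
  · simp only [Finset.univ_unique, PUnit.default_eq_unit, Finset.sum_singleton]
    rw [e3, hvc, show β • k + (J v + c • n) = J v + c • n + β • k by abel, hrepr]
    simp [b']

end TraceLemma

/-! ### Spacelike sections in coordinates: Gauss equation and the Ricci trace -/

section Section

variable {E : Type*} [NormedAddCommGroup E] [NormedSpace ℝ E] [FiniteDimensional ℝ E]
  {F : Type*} [NormedAddCommGroup F] [NormedSpace ℝ F] [FiniteDimensional ℝ F]
  {H : Type*} [NormedAddCommGroup H] [NormedSpace ℝ H] [FiniteDimensional ℝ H]
  {Γ : E → E →L[ℝ] E →L[ℝ] E} {B : E → E →L[ℝ] E →L[ℝ] ℝ} {Ω : Set E}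
  {Γ' : H → H →L[ℝ] H →L[ℝ] H} {B' : H → H →L[ℝ] H →L[ℝ] ℝ} {W : Set H}

variable (Γ) in
/-- The curvature endomorphism `z ↦ R(z, v) w`, whose trace is the Ricci tensor. -/
def riemLin (x v w : E) : E →ₗ[ℝ] E where
  toFun z := riem Γ x z v w
  map_add' a b := by simp only [riem, map_add, add_apply]; abel
  map_smul' c a := by
    simp only [riem, map_smul, smul_apply, RingHom.id_apply, smul_sub, smul_add]

theorem riemLin_apply (x v w z : E) : riemLin Γ x v w z = riem Γ x z v w := rfl

/-- A spacelike codimension-one immersion `k` into the domain of the null map `φ`. -/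
structure IsSpacelikeMap (B : E → E →L[ℝ] E →L[ℝ] ℝ) (V : Set F) (φ : F → E)
    (B' : H → H →L[ℝ] H →L[ℝ] ℝ) (W : Set H) (k : H → F) : Prop where
  smooth : ∀ h ∈ W, ContDiffAt ℝ ∞ k h
  maps : ∀ h ∈ W, k h ∈ V
  codim : Module.finrank ℝ H + 1 = Module.finrank ℝ F
  metric : ∀ h ∈ W, ∀ a b, B' h a b =
    B (φ (k h)) (fderiv ℝ φ (k h) (fderiv ℝ k h a)) (fderiv ℝ φ (k h) (fderiv ℝ k h b))
  pos : ∀ h ∈ W, ∀ a, a ≠ 0 → 0 < B' h a a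

theorem covAlong_comp_fderiv_apply {φ : F → E} {k : H → F} {y : H → F} {h : H}
    (hφ : ContDiffAt ℝ ∞ φ (k h)) (hk : DifferentiableAt ℝ k h)
    (hy : DifferentiableAt ℝ y h) (a : H) :
    covAlong Γ (fun r => φ (k r)) (fun r => fderiv ℝ φ (k r) (y r)) h a =
      covAlong Γ φ (fun q => fderiv ℝ φ q (y h)) (k h) (fderiv ℝ k h a) +
        fderiv ℝ φ (k h) (fderiv ℝ y h a) := by
  have hd : DifferentiableAt ℝ (fderiv ℝ φ) (k h) :=
    (hφ.fderiv_right (m := ∞) (by simp)).differentiableAt (by simp)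
  have hφd : DifferentiableAt ℝ φ (k h) := hφ.differentiableAt (by simp)
  have hdk : DifferentiableAt ℝ (fun r => fderiv ℝ φ (k r)) h := hd.comp h hk
  simp only [covAlong]
  rw [fderiv_clm_apply hdk hy, fderiv_clm_apply hd (differentiableAt_const (y h)),
    fderiv_comp_dir hφd hk]
  simp [fderiv_comp_dir hd hk]
  abel

namespace IsSpacelikeMap

variable {V : Set F} {φ : F → E} {L : F → F} {k : H → F}

theorem fderiv_comp_eq (hN : IsNullMap Ω B V φ L) (hS : IsSpacelikeMap B V φ B' W k) {h : H}
    (hh : h ∈ W) (a : H) : fderiv ℝ (fun r => φ (k r)) h a =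
      fderiv ℝ φ (k h) (fderiv ℝ k h a) :=
  fderiv_comp_dir ((hN.smooth _ (hS.maps h hh)).differentiableAt (by simp))
    ((hS.smooth h hh).differentiableAt (by simp)) a

/-- A tangent vector of the section that is a multiple of `L` would be null, while the section is
spacelike. -/
theorem independent (hN : IsNullMap Ω B V φ L)
    (hS : IsSpacelikeMap B V φ B' W k) {h : H} (hh : h ∈ W) {v : H} {c : ℝ}
    (e : fderiv ℝ k h v + c • L (k h) = 0) : v = 0 ∧ c = 0 := by
  have hz := hS.maps h hh
  have hv : v = 0 := by
    by_contra hv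
    have := hS.pos h hh v hv
    rw [hS.metric h hh, eq_neg_of_add_eq_zero_left e, map_neg, map_smul] at this
    simp [hN.null _ hz (L (k h))] at this
  refine ⟨hv, ?_⟩
  rw [hv, map_zero, zero_add, smul_eq_zero] at e
  exact e.resolve_right (hN.ne_zero _ hz)

theorem exists_decomposition (hN : IsNullMap Ω B V φ L)
    (hS : IsSpacelikeMap B V φ B' W k) {h : H} (hh : h ∈ W) (w : F) :
    ∃ (v : H) (c : ℝ), fderiv ℝ k h v + c • L (k h) = w := by
  let T : H × ℝ →ₗ[ℝ] F :=
    (fderiv ℝ k h).toLinearMap.coprod (LinearMap.toSpanSingleton ℝ F (L (k h)))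
  have hT : ∀ v c, T (v, c) = fderiv ℝ k h v + c • L (k h) := fun v c => by simp [T]
  have hinj : Function.Injective T := by
    rw [injective_iff_map_eq_zero]
    rintro ⟨v, c⟩ e
    rw [hT] at e
    obtain ⟨rfl, rfl⟩ := independent hN hS hh e
    rfl
  have hsurj := (LinearMap.injective_iff_surjective_of_finrank_eq_finrank
    (by simp [← hS.codim])).1 hinj
  obtain ⟨⟨v, c⟩, hvc⟩ := hsurj w
  exact ⟨v, c, (hT v c).symm.trans hvc⟩

theorem smooth_comp (hN : IsNullMap Ω B V φ L) (hS : IsSpacelikeMap B V φ B' W k) {h : H}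
    (hh : h ∈ W) : ContDiffAt ℝ ∞ (fun r => φ (k r)) h :=
  (hN.smooth _ (hS.maps h hh)).comp h (hS.smooth h hh)

theorem smooth_normal_comp (hN : IsNullMap Ω B V φ L) (hS : IsSpacelikeMap B V φ B' W k) {h : H}
    (hh : h ∈ W) : ContDiffAt ℝ ∞ (fun r => fderiv ℝ φ (k r) (L (k r))) h :=
  (hN.smooth_normal (hS.maps h hh)).comp h (hS.smooth h hh)

theorem covAlong_normal_comp (hN : IsNullMap Ω B V φ L) (hB : IsLeviCivita Ω B Γ)
    (hS : IsSpacelikeMap B V φ B' W k) {h : H} (hh : h ∈ W) (a : H) :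
    covAlong Γ (fun r => φ (k r)) (fun r => fderiv ℝ φ (k r) (L (k r))) h a =
      rot Γ φ L (k h) (fderiv ℝ k h a) • fderiv ℝ φ (k h) (L (k h)) := by
  have hz := hS.maps h hh
  rw [← hN.covAlong_normal hB hz]
  exact covAlong_comp ((hN.smooth _ hz).differentiableAt (by simp))
    ((hN.smooth_normal hz).differentiableAt (by simp)) ((hS.smooth h hh).differentiableAt (by simp))

/-- The Gauss formula. -/
theorem exists_gauss (hN : IsNullMap Ω B V φ L) (hB : IsLeviCivita Ω B Γ)
    (hS : IsSpacelikeMap B V φ B' W k) (hB' : IsLeviCivita W B' Γ') {h : H} (hh : h ∈ W)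
    (a b : H) : ∃ η : ℝ,
    covAlong Γ (fun r => φ (k r)) (fun r => fderiv ℝ (fun r => φ (k r)) r b) h a -
      fderiv ℝ (fun r => φ (k r)) h (Γ' h a b) = η • fderiv ℝ φ (k h) (L (k h)) := by
  have hz := hS.maps h hh
  have hΩ := hN.maps _ hz
  have hχ := smooth_comp hN hS hh
  have dχ : DifferentiableAt ℝ (fun r => φ (k r)) h := hχ.differentiableAt (by simp)
  have dc : ∀ b, DifferentiableAt ℝ (fun r => fderiv ℝ (fun r => φ (k r)) r b) h := fun b =>
    (contDiffAt_fderiv_apply hχ contDiffAt_const).differentiableAt (by simp)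
  have dB' : DifferentiableAt ℝ B' h := (hB'.smooth_metric h hh).differentiableAt (by simp)
  have hmet : ∀ r ∈ W, ∀ a b, B' r a b = B (φ (k r)) (fderiv ℝ (fun r => φ (k r)) r a)
      (fderiv ℝ (fun r => φ (k r)) r b) := fun r hr a b => by
    rw [hS.metric r hr, fderiv_comp_eq hN hS hr, fderiv_comp_eq hN hS hr]
  refine eq_smul_of_perp_range (hN.inj _ hz) hN.codim (hB.symm_metric _ hΩ) (hB.nondeg _ hΩ)
    (hN.ne_zero _ hz) (hN.null _ hz) fun w => ?_
  -- `hT` and `hT'` say that the ambient derivative, paired with tangent vectors of the section, and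
  -- `Γ'` are both symmetric and compatible with `B'`. Such symbols are unique, by the permutation
  -- trick of the Koszul formula, whence `e1`.
  have hT : ∀ a b c, fderiv ℝ B' h a b c =
      B (φ (k h)) (covAlong Γ (fun r => φ (k r))
        (fun r => fderiv ℝ (fun r => φ (k r)) r b) h a) (fderiv ℝ (fun r => φ (k r)) h c) +
      B (φ (k h)) (covAlong Γ (fun r => φ (k r))
        (fun r => fderiv ℝ (fun r => φ (k r)) r c) h a) (fderiv ℝ (fun r => φ (k r)) h b) := by
    intro a b c
    have e := covAlong_metric hB (φ := fun r => φ (k r)) hΩ dχ (dc b) (dc c) a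
    have e2 : (fun q => B (φ (k q)) (fderiv ℝ (fun r => φ (k r)) q b)
        (fderiv ℝ (fun r => φ (k r)) q c)) =ᶠ[𝓝 h] fun r => B' r b c := by
      filter_upwards [hB'.isOpen.mem_nhds hh] with r hr using (hmet r hr b c).symm
    rw [e2.fderiv_eq, fderiv_bilin_apply dB' (differentiableAt_const b)
      (differentiableAt_const c)] at e
    simp only [fderiv_fun_const, Pi.zero_apply, zero_apply, map_zero, add_zero] at e
    rw [e, hB.symm_metric _ hΩ (fderiv ℝ (fun r => φ (k r)) h b)]
  have hT' : ∀ a b c, fderiv ℝ B' h a b c =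
      B (φ (k h)) (fderiv ℝ (fun r => φ (k r)) h (Γ' h a b)) (fderiv ℝ (fun r => φ (k r)) h c) +
      B (φ (k h)) (fderiv ℝ (fun r => φ (k r)) h (Γ' h a c))
        (fderiv ℝ (fun r => φ (k r)) h b) := by
    intro a b c
    rw [hB'.compat h hh, hmet h hh, hmet h hh, hB.symm_metric _ hΩ
      (fderiv ℝ (fun r => φ (k r)) h b)]
  have hSym : ∀ a b, covAlong Γ (fun r => φ (k r))
        (fun r => fderiv ℝ (fun r => φ (k r)) r b) h a = covAlong Γ (fun r => φ (k r))
        (fun r => fderiv ℝ (fun r => φ (k r)) r a) h b := fun a b =>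
    covAlong_torsion hB.symm (φ := fun r => φ (k r)) hΩ hχ a b
  obtain ⟨v, c, rfl⟩ := exists_decomposition hN hS hh w
  have e1 : B (φ (k h)) (covAlong Γ (fun r => φ (k r))
        (fun r => fderiv ℝ (fun r => φ (k r)) r b) h a -
      fderiv ℝ (fun r => φ (k r)) h (Γ' h a b)) (fderiv ℝ (fun r => φ (k r)) h v) = 0 := by
    have s : ∀ a b c, B (φ (k h)) (covAlong Γ (fun r => φ (k r))
        (fun r => fderiv ℝ (fun r => φ (k r)) r b) h a) (fderiv ℝ (fun r => φ (k r)) h c) =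
        B (φ (k h)) (covAlong Γ (fun r => φ (k r))
        (fun r => fderiv ℝ (fun r => φ (k r)) r a) h b) (fderiv ℝ (fun r => φ (k r)) h c) :=
      fun a b c => by rw [hSym]
    have s' : ∀ a b c, B (φ (k h)) (fderiv ℝ (fun r => φ (k r)) h (Γ' h a b))
        (fderiv ℝ (fun r => φ (k r)) h c) =
        B (φ (k h)) (fderiv ℝ (fun r => φ (k r)) h (Γ' h b a))
        (fderiv ℝ (fun r => φ (k r)) h c) := fun a b c => by rw [hB'.symm h hh]
    rw [map_sub, sub_apply]
    linarith [hT a b v, hT' a b v, hT b a v, hT' b a v, hT v a b, hT' v a b, s a b v, s b v a,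
      s v a b, s' a b v, s' b v a, s' v a b]
  -- Orthogonality to the null normal: differentiate `B(∂_b, n) = 0` and use that `∇n` is
  -- proportional to `n`.
  have e2 : B (φ (k h)) (covAlong Γ (fun r => φ (k r))
        (fun r => fderiv ℝ (fun r => φ (k r)) r b) h a -
      fderiv ℝ (fun r => φ (k r)) h (Γ' h a b)) (fderiv ℝ φ (k h) (L (k h))) = 0 := by
    have hperp : ∀ r ∈ W, ∀ b, B (φ (k r)) (fderiv ℝ (fun r => φ (k r)) r b)
        (fderiv ℝ φ (k r) (L (k r))) = 0 := fun r hr b => by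
      rw [hB.symm_metric _ (hN.maps _ (hS.maps r hr)), fderiv_comp_eq hN hS hr,
        hN.null _ (hS.maps r hr)]
    have e := covAlong_metric hB (φ := fun r => φ (k r)) hΩ dχ (dc b)
      ((smooth_normal_comp hN hS hh).differentiableAt (by simp)) a
    have e3 : (fun q => B (φ (k q)) (fderiv ℝ (fun r => φ (k r)) q b)
        (fderiv ℝ φ (k q) (L (k q)))) =ᶠ[𝓝 h] fun _ => 0 := by
      filter_upwards [hB'.isOpen.mem_nhds hh] with r hr using hperp r hr b
    rw [e3.fderiv_eq, covAlong_normal_comp hN hB hS hh, map_smul, hperp h hh] at e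
    rw [map_sub, sub_apply, hperp h hh, sub_zero]
    simpa using e.symm
  rw [map_add, map_smul, map_add, map_smul, e2, ← fderiv_comp_eq hN hS hh, e1]
  simp

/-- The Gauss equation. -/
theorem exists_riem_eq (hN : IsNullMap Ω B V φ L) (hB : IsLeviCivita Ω B Γ)
    (hS : IsSpacelikeMap B V φ B' W k) (hB' : IsLeviCivita W B' Γ') {h : H} (hh : h ∈ W)
    (c a b : H) : ∃ μ : ℝ,
    riem Γ (φ (k h)) (fderiv ℝ (fun r => φ (k r)) h c) (fderiv ℝ (fun r => φ (k r)) h a)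
        (fderiv ℝ (fun r => φ (k r)) h b) =
      fderiv ℝ (fun r => φ (k r)) h (riem Γ' h c a b) + μ • fderiv ℝ φ (k h) (L (k h)) := by
  have hz := hS.maps h hh
  have hΩ := hN.maps _ hz
  have hΓ := hB.smooth _ hΩ
  have hΓ' := hB'.smooth h hh
  have hχ := smooth_comp hN hS hh
  have hn := smooth_normal_comp hN hS hh
  have hc : ∀ b, ContDiffAt ℝ ∞ (fun r => fderiv ℝ (fun r => φ (k r)) r b) h := fun b =>
    contDiffAt_fderiv_apply hχ contDiffAt_const
  have hΓab : ∀ a b, ContDiffAt ℝ ∞ (fun r => Γ' r a b) h := fun a b =>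
    (hΓ'.clm_apply contDiffAt_const).clm_apply contDiffAt_const
  -- Differentiate the Gauss formula once more. The term `η n` yields only multiples of `n`, because
  -- `∇_c n = ω(c) n`; everything else is intrinsic. Antisymmetrising in `c`, `a` then gives both
  -- curvatures.
  have key : ∀ c a, ∃ μ : ℝ, covAlong Γ (fun r => φ (k r)) (fun q => covAlong Γ (fun r => φ (k r))
      (fun r => fderiv ℝ (fun r => φ (k r)) r b) q a) h c =
      fderiv ℝ (fun r => φ (k r)) h (fderiv ℝ Γ' h c a b + Γ' h c (Γ' h a b)) +
        μ • fderiv ℝ φ (k h) (L (k h)) := by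
    intro c a
    have hη : ∀ q, ∃ η : ℝ, q ∈ W → covAlong Γ (fun r => φ (k r))
        (fun r => fderiv ℝ (fun r => φ (k r)) r b) q a -
        fderiv ℝ (fun r => φ (k r)) q (Γ' q a b) = η • fderiv ℝ φ (k q) (L (k q)) := by
      intro q
      by_cases hq : q ∈ W
      · obtain ⟨η, e⟩ := exists_gauss hN hB hS hB' hq a b
        exact ⟨η, fun _ => e⟩
      · exact ⟨0, fun h => absurd h hq⟩
    choose η hη using hη
    have hX : ContDiffAt ℝ ∞ (fun q => covAlong Γ (fun r => φ (k r))
        (fun r => fderiv ℝ (fun r => φ (k r)) r b) q a -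
        fderiv ℝ (fun r => φ (k r)) q (Γ' q a b)) h :=
      (contDiffAt_covAlong (φ := fun r => φ (k r)) hΓ hχ (hc b) contDiffAt_const).sub
        (contDiffAt_fderiv_apply (f := fun r => φ (k r)) hχ (hΓab a b))
    have hηs : ContDiffAt ℝ ∞ η h := by
      refine contDiffAt_of_smul_eq hX hn (hN.normal_ne_zero hz) ?_
      filter_upwards [hB'.isOpen.mem_nhds hh] with q hq using hη q hq
    have e1 : (fun q => covAlong Γ (fun r => φ (k r))
        (fun r => fderiv ℝ (fun r => φ (k r)) r b) q a) =ᶠ[𝓝 h] fun q =>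
        fderiv ℝ (fun r => φ (k r)) q (Γ' q a b) + η q • fderiv ℝ φ (k q) (L (k q)) := by
      filter_upwards [hB'.isOpen.mem_nhds hh] with q hq
      rw [← hη q hq]; abel
    obtain ⟨η', hη'⟩ := exists_gauss hN hB hS hB' hh c (Γ' h a b)
    have d1 : DifferentiableAt ℝ (fun q => fderiv ℝ (fun r => φ (k r)) q (Γ' q a b)) h :=
      (contDiffAt_fderiv_apply hχ (hΓab a b)).differentiableAt (by simp)
    have d2 : DifferentiableAt ℝ (fun q => η q • fderiv ℝ φ (k q) (L (k q))) h :=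
      (hηs.smul hn).differentiableAt (by simp)
    have e2 : fderiv ℝ (fun r => Γ' r a b) h c = fderiv ℝ Γ' h c a b := by
      rw [fderiv_bilin_apply (hΓ'.differentiableAt (by simp)) (differentiableAt_const a)
        (differentiableAt_const b)]
      simp
    refine ⟨η' + η h * rot Γ φ L (k h) (fderiv ℝ k h c) + fderiv ℝ η h c, ?_⟩
    rw [covAlong_congr e1, covAlong_add_field d1 d2, covAlong_smul_field
      (hηs.differentiableAt (by simp)) (hn.differentiableAt (by simp)),
      covAlong_normal_comp hN hB hS hh, covAlong_fderiv_apply hχ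
      ((hΓab a b).differentiableAt (by simp)), sub_eq_iff_eq_add.1 hη', e2, map_add]
    module
  obtain ⟨μ₁, h₁⟩ := key c a
  obtain ⟨μ₂, h₂⟩ := key a c
  refine ⟨μ₁ - μ₂, ?_⟩
  rw [← covAlong_curvature (φ := fun r => φ (k r)) hΓ hχ (hc b), h₁, h₂, riem]
  simp only [map_add, map_sub]
  module

/-- The curvature contracted with the null normal and two vectors tangent to the section. -/
theorem riem_normal_section (hN : IsNullMap Ω B V φ L) (hB : IsLeviCivita Ω B Γ)
    (hconn : ∀ (u w : F) (δ : F → F), (∀ z ∈ V, fderiv ℝ φ z (δ z) =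
        covAlong Γ φ (fun y => fderiv ℝ φ y w) z u) → ∀ z ∈ V,
      fderiv ℝ φ z (fderiv ℝ δ z (L z) - fderiv ℝ L z (δ z)) +
        covAlong Γ φ (fun y => fderiv ℝ φ y w) z (fderiv ℝ L z u) +
        covAlong Γ φ (fun y => fderiv ℝ φ y (fderiv ℝ L y w)) z u = 0)
    (hext : ∀ z ∈ V, covAlong Γ φ (fun y => fderiv ℝ φ y (L y)) z (L z) = 0)
    (hS : IsSpacelikeMap B V φ B' W k) (hB' : IsLeviCivita W B' Γ') {h : H} (hh : h ∈ W)
    (a b : H) :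
    riem Γ (φ (k h)) (fderiv ℝ φ (k h) (L (k h))) (fderiv ℝ (fun r => φ (k r)) h a)
        (fderiv ℝ (fun r => φ (k r)) h b) =
      -((fderiv ℝ (fun r => rot Γ φ L (k r) (fderiv ℝ k r b)) h a -
        rot Γ φ L (k h) (fderiv ℝ k h (Γ' h a b)) +
        rot Γ φ L (k h) (fderiv ℝ k h a) * rot Γ φ L (k h) (fderiv ℝ k h b)) •
          fderiv ℝ φ (k h) (L (k h))) := by
  have hz := hS.maps h hh
  have hk := hS.smooth h hh
  have dk : DifferentiableAt ℝ k h := hk.differentiableAt (by simp)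
  have dkb : DifferentiableAt ℝ (fun r => fderiv ℝ k r b) h :=
    (contDiffAt_fderiv_apply hk contDiffAt_const).differentiableAt (by simp)
  obtain ⟨η, hη⟩ := exists_gauss hN hB hS hB' hh a b
  have e1 : (fun r => fderiv ℝ (fun r => φ (k r)) r b) =ᶠ[𝓝 h]
      fun r => fderiv ℝ φ (k r) (fderiv ℝ k r b) := by
    filter_upwards [hB'.isOpen.mem_nhds hh] with r hr using fderiv_comp_eq hN hS hr b
  rw [covAlong_congr e1, covAlong_comp_fderiv_apply (hN.smooth _ hz) dk dkb,
    fderiv_comp_eq hN hS hh] at hη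
  -- The vector playing the role of `D_u w` for the frozen, constant fields `u = dk a`, `w = dk b`.
  -- The Gauss formula gives the first two terms; the last subtracts the variation of `dk b` along
  -- `a`.
  have hd : fderiv ℝ φ (k h) (fderiv ℝ k h (Γ' h a b) + η • L (k h) +
      (-1 : ℝ) • fderiv ℝ (fun r => fderiv ℝ k r b) h a) =
      covAlong Γ φ (fun y => fderiv ℝ φ y (fderiv ℝ k h b)) (k h) (fderiv ℝ k h a) := by
    rw [map_add, map_add, map_smul, map_smul, ← hη]
    module
  rw [fderiv_comp_eq hN hS hh, fderiv_comp_eq hN hS hh, hN.riem_normal hB hconn hz hd]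
  -- Extremality enters here: it removes the unknown coefficient `η`.
  have hrL : rot Γ φ L (k h) (L (k h)) = 0 := hN.rot_eq hB hz (by rw [hext _ hz, zero_smul])
  rw [hN.rot_add hB hz, hN.rot_add hB hz, hN.rot_smul hB hz, hN.rot_smul hB hz, hrL]
  obtain ⟨ρ, dρ, hρ⟩ := hN.exists_rot_clm hB hz
  have e2 : (fun q => rot Γ φ L q (fderiv ℝ k h b)) =ᶠ[𝓝 (k h)] fun q => ρ q (fderiv ℝ k h b) := by
    filter_upwards [hN.isOpen.mem_nhds hz] with q hq using (hρ q hq _).symm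
  have e3 : (fun r => rot Γ φ L (k r) (fderiv ℝ k r b)) =ᶠ[𝓝 h]
      fun r => ρ (k r) (fderiv ℝ k r b) := by
    filter_upwards [hB'.isOpen.mem_nhds hh] with r hr using (hρ _ (hS.maps r hr) _).symm
  have dρk : DifferentiableAt ℝ (fun r => ρ (k r)) h := dρ.comp h dk
  -- The product rule for `ω(dk b)`; its second term is exactly the one produced by the last summand
  -- in `hd`.
  have e4 : fderiv ℝ (fun r => ρ (k r) (fderiv ℝ k r b)) h a =
      fderiv ℝ (fun q => ρ q (fderiv ℝ k h b)) (k h) (fderiv ℝ k h a) +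
        ρ (k h) (fderiv ℝ (fun r => fderiv ℝ k r b) h a) := by
    rw [fderiv_clm_apply dρk dkb, fderiv_clm_apply dρ (differentiableAt_const _)]
    simp [fderiv_comp_dir dρ dk]
    ring
  rw [e2.fderiv_eq, e3.fderiv_eq, e4, hρ _ hz]
  congr 2
  ring

/-- The identity satisfied by the rotation form on a section, in local coordinates. -/
theorem trace_riemLin (hN : IsNullMap Ω B V φ L) (hB : IsLeviCivita Ω B Γ)
    (hconn : ∀ (u w : F) (δ : F → F), (∀ z ∈ V, fderiv ℝ φ z (δ z) =
        covAlong Γ φ (fun y => fderiv ℝ φ y w) z u) → ∀ z ∈ V,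
      fderiv ℝ φ z (fderiv ℝ δ z (L z) - fderiv ℝ L z (δ z)) +
        covAlong Γ φ (fun y => fderiv ℝ φ y w) z (fderiv ℝ L z u) +
        covAlong Γ φ (fun y => fderiv ℝ φ y (fderiv ℝ L y w)) z u = 0)
    (hext : ∀ z ∈ V, covAlong Γ φ (fun y => fderiv ℝ φ y (L y)) z (L z) = 0)
    (hS : IsSpacelikeMap B V φ B' W k) (hB' : IsLeviCivita W B' Γ') {h : H} (hh : h ∈ W)
    (a b : H) :
    LinearMap.trace ℝ E (riemLin Γ (φ (k h)) (fderiv ℝ (fun r => φ (k r)) h a)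
        (fderiv ℝ (fun r => φ (k r)) h b)) =
      LinearMap.trace ℝ H (riemLin Γ' h a b) -
      (fderiv ℝ (fun r => rot Γ φ L (k r) (fderiv ℝ k r b)) h a -
        rot Γ φ L (k h) (fderiv ℝ k h (Γ' h a b)) +
        rot Γ φ L (k h) (fderiv ℝ k h a) * rot Γ φ L (k h) (fderiv ℝ k h b)) -
      (fderiv ℝ (fun r => rot Γ φ L (k r) (fderiv ℝ k r a)) h b -
        rot Γ φ L (k h) (fderiv ℝ k h (Γ' h b a)) +
        rot Γ φ L (k h) (fderiv ℝ k h b) * rot Γ φ L (k h) (fderiv ℝ k h a)) := by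
  have hz := hS.maps h hh
  have hΩ := hN.maps _ hz
  have hab := riem_normal_section hN hB hconn hext hS hB' hh a b
  have hba := riem_normal_section hN hB hconn hext hS hB' hh b a
  set κ₁ := fderiv ℝ (fun r => rot Γ φ L (k r) (fderiv ℝ k r b)) h a -
        rot Γ φ L (k h) (fderiv ℝ k h (Γ' h a b)) +
        rot Γ φ L (k h) (fderiv ℝ k h a) * rot Γ φ L (k h) (fderiv ℝ k h b)
  set κ₂ := fderiv ℝ (fun r => rot Γ φ L (k r) (fderiv ℝ k r a)) h b -
        rot Γ φ L (k h) (fderiv ℝ k h (Γ' h b a)) +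
        rot Γ φ L (k h) (fderiv ℝ k h b) * rot Γ φ L (k h) (fderiv ℝ k h a)
  set n := fderiv ℝ φ (k h) (L (k h)) with hn
  -- A transversal vector completing the flag. Pairing with `n` reads off the coefficient of `m`,
  -- since `n` is orthogonal to the whole hypersurface.
  obtain ⟨m, hm⟩ : ∃ m, B (φ (k h)) n m = 1 := by
    obtain ⟨m, hm⟩ : ∃ m, B (φ (k h)) n m ≠ 0 := by
      by_contra! h0
      exact hN.normal_ne_zero hz (hB.nondeg _ hΩ _ h0)
    exact ⟨(B (φ (k h)) n m)⁻¹ • m, by rw [map_smul, smul_eq_mul, inv_mul_cancel₀ hm]⟩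
  have hm' : B (φ (k h)) m n = 1 := (hB.symm_metric _ hΩ _ _).trans hm
  have hnull : ∀ w, B (φ (k h)) n (fderiv ℝ φ (k h) w) = 0 := hN.null _ hz
  rw [trace_of_flag (riemLin Γ (φ (k h)) (fderiv ℝ (fun r => φ (k r)) h a)
        (fderiv ℝ (fun r => φ (k r)) h b)) (riemLin Γ' h a b)
        (fderiv ℝ (fun r => φ (k r)) h).toLinearMap n m (-κ₁) (-κ₂)]
  · ring
  · have := hS.codim; have := hN.codim; omega
  · intro v c d e
    have hd : d = 0 := by
      have := congrArg (B (φ (k h)) n) e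
      rw [map_add, map_add, map_smul, map_smul, hm, hn, hnull (L (k h))] at this
      rw [ContinuousLinearMap.coe_coe, fderiv_comp_eq hN hS hh, ← hn, hnull] at this
      simpa using this
    rw [hd, zero_smul, add_zero, ContinuousLinearMap.coe_coe, fderiv_comp_eq hN hS hh, hn,
      ← map_smul, ← map_add] at e
    obtain ⟨h1, h2⟩ := independent hN hS hh (hN.inj _ hz (e.trans (map_zero _).symm))
    exact ⟨h1, h2, hd⟩
  · intro v
    exact exists_riem_eq hN hB hS hB' hh v a b
  · rw [riemLin_apply, hab, neg_smul]
  · have hβ : B (φ (k h)) (riem Γ (φ (k h)) m (fderiv ℝ (fun r => φ (k r)) h a)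
        (fderiv ℝ (fun r => φ (k r)) h b)) n = -κ₂ := by
      rw [riem_pair_symm hB hΩ, riem_antisymm, map_neg, neg_apply, riem_skew hB hΩ, neg_neg, hba,
        map_neg, map_smul, hm', smul_eq_mul, mul_one]
    -- Once its `m`-component is removed, `R(m, a) b` is orthogonal to `n`, hence tangent to the
    -- hypersurface.
    obtain ⟨w, hw⟩ := mem_range_of_null (hN.inj _ hz) hN.codim (hB.symm_metric _ hΩ)
      (hB.nondeg _ hΩ) (hN.ne_zero _ hz) (hN.null _ hz)
      (x := riem Γ (φ (k h)) m (fderiv ℝ (fun r => φ (k r)) h a)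
        (fderiv ℝ (fun r => φ (k r)) h b) - (-κ₂) • m) (by
        rw [map_sub, map_smul, sub_apply, smul_apply, ← hn, hβ, hm']; simp)
    obtain ⟨v, c, rfl⟩ := exists_decomposition hN hS hh w
    refine ⟨v, c, ?_⟩
    rw [riemLin_apply, ← sub_eq_iff_eq_add', ← hw, ContinuousLinearMap.coe_coe,
      fderiv_comp_eq hN hS hh, map_add, map_smul]

end IsSpacelikeMap

end Section

/-! ### Coordinates -/

section Coordinates

variable {E : Type*} [NormedAddCommGroup E] [NormedSpace ℝ E] [FiniteDimensional ℝ E]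
  {M : Type*} [TopologicalSpace M] [ChartedSpace E M] [IsManifold 𝓘(ℝ, E) ∞ M]

variable (E) in
/-- The domain of the preferred chart parametrization at `x₀`. -/
def chartDom (x₀ : M) : Set E := (extChartAt 𝓘(ℝ, E) x₀).target

variable (E) in
/-- The parametrization of a neighbourhood of `x₀` by the preferred chart. -/
def param (x₀ : M) (z : E) : M := (extChartAt 𝓘(ℝ, E) x₀).symm z

variable (E) in
/-- The derivative of the parametrization. -/
def dparam (x₀ : M) (z : E) : E →L[ℝ] TangentSpace 𝓘(ℝ, E) (param E x₀ z) :=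
  mfderiv 𝓘(ℝ, E) 𝓘(ℝ, E) (param E x₀) z

/-- The coordinate expression of a vector field. -/
def coordField (x₀ : M) (X : Π x : M, TangentSpace 𝓘(ℝ, E) x) (z : E) : E :=
  (dparam E x₀ z).inverse (X (param E x₀ z))

/-- The vector field with a given coordinate expression. -/
def liftField (x₀ : M) (Y : E → E) (y : M) : TangentSpace 𝓘(ℝ, E) y :=
  (mfderiv 𝓘(ℝ, E) 𝓘(ℝ, E) (extChartAt 𝓘(ℝ, E) x₀) y).inverse (Y (extChartAt 𝓘(ℝ, E) x₀ y))

theorem isOpen_chartDom (x₀ : M) : IsOpen (chartDom E x₀) := isOpen_extChartAt_target x₀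

theorem center_mem (x₀ : M) : extChartAt 𝓘(ℝ, E) x₀ x₀ ∈ chartDom E x₀ :=
  mem_extChartAt_target x₀

theorem param_center (x₀ : M) : param E x₀ (extChartAt 𝓘(ℝ, E) x₀ x₀) = x₀ :=
  extChartAt_to_inv x₀

theorem param_mem_source {x₀ : M} {z : E} (hz : z ∈ chartDom E x₀) :
    param E x₀ z ∈ (extChartAt 𝓘(ℝ, E) x₀).source :=
  (extChartAt 𝓘(ℝ, E) x₀).map_target hz

theorem chart_param {x₀ : M} {z : E} (hz : z ∈ chartDom E x₀) :
    extChartAt 𝓘(ℝ, E) x₀ (param E x₀ z) = z :=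
  (extChartAt 𝓘(ℝ, E) x₀).right_inv hz

theorem param_chart {x₀ y : M} (hy : y ∈ (extChartAt 𝓘(ℝ, E) x₀).source) :
    param E x₀ (extChartAt 𝓘(ℝ, E) x₀ y) = y :=
  (extChartAt 𝓘(ℝ, E) x₀).left_inv hy

theorem contMDiffAt_param {x₀ : M} {z : E} (hz : z ∈ chartDom E x₀) :
    ContMDiffAt 𝓘(ℝ, E) 𝓘(ℝ, E) ∞ (param E x₀) z :=
  (contMDiffOn_extChartAt_symm x₀).contMDiffAt ((isOpen_chartDom x₀).mem_nhds hz)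

theorem contMDiffAt_chart {x₀ y : M} (hy : y ∈ (extChartAt 𝓘(ℝ, E) x₀).source) :
    ContMDiffAt 𝓘(ℝ, E) 𝓘(ℝ, E) ∞ (extChartAt 𝓘(ℝ, E) x₀) y :=
  contMDiffAt_extChartAt' (by simpa using hy)

theorem mdifferentiableAt_param {x₀ : M} {z : E} (hz : z ∈ chartDom E x₀) :
    MDifferentiableAt 𝓘(ℝ, E) 𝓘(ℝ, E) (param E x₀) z :=
  (contMDiffAt_param hz).mdifferentiableAt (by simp)

theorem isInvertible_dparam {x₀ : M} {z : E} (hz : z ∈ chartDom E x₀) :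
    (dparam E x₀ z).IsInvertible := by
  have h := isInvertible_mfderivWithin_extChartAt_symm (I := 𝓘(ℝ, E)) (x := x₀) hz
  rw [ModelWithCorners.range_eq_univ, mfderivWithin_univ] at h
  exact h

theorem isInvertible_chart {x₀ y : M} (hy : y ∈ (extChartAt 𝓘(ℝ, E) x₀).source) :
    (mfderiv 𝓘(ℝ, E) 𝓘(ℝ, E) (extChartAt 𝓘(ℝ, E) x₀) y).IsInvertible :=
  isInvertible_mfderiv_extChartAt hy

theorem dparam_injective {x₀ : M} {z : E} (hz : z ∈ chartDom E x₀) :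
    Function.Injective (dparam E x₀ z) := by
  obtain ⟨e, he⟩ := isInvertible_dparam hz
  rw [← he]
  exact e.injective

theorem dparam_surjective {x₀ : M} {z : E} (hz : z ∈ chartDom E x₀) :
    Function.Surjective (dparam E x₀ z) := by
  obtain ⟨e, he⟩ := isInvertible_dparam hz
  rw [← he]
  exact e.surjective

theorem dparam_coordField {x₀ : M} {z : E} (hz : z ∈ chartDom E x₀)
    (X : Π x : M, TangentSpace 𝓘(ℝ, E) x) :
    dparam E x₀ z (coordField x₀ X z) = X (param E x₀ z) := by
  obtain ⟨e, he⟩ := isInvertible_dparam hz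
  rw [coordField, ← he, ContinuousLinearMap.inverse_equiv]
  exact e.apply_symm_apply _

theorem chart_dparam {x₀ : M} {z : E} (hz : z ∈ chartDom E x₀) (v : E) :
    mfderiv 𝓘(ℝ, E) 𝓘(ℝ, E) (extChartAt 𝓘(ℝ, E) x₀) (param E x₀ z) (dparam E x₀ z v) = v := by
  have h := mfderiv_extChartAt_comp_mfderivWithin_extChartAt_symm (I := 𝓘(ℝ, E)) (x := x₀) hz
  rw [ModelWithCorners.range_eq_univ, mfderivWithin_univ] at h
  exact congrArg (fun A : E →L[ℝ] E => A v) h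

theorem inverse_apply_of_eq {x : M} {A : TangentSpace 𝓘(ℝ, E) x →L[ℝ] E} (hA : A.IsInvertible)
    {u : TangentSpace 𝓘(ℝ, E) x} {w : E} (h : A u = w) : A.inverse w = u := by
  obtain ⟨e, rfl⟩ := hA
  rw [ContinuousLinearMap.inverse_equiv, ← h]
  exact e.symm_apply_apply u

theorem liftField_param {x₀ : M} {z : E} (hz : z ∈ chartDom E x₀) (Y : E → E) :
    liftField x₀ Y (param E x₀ z) = dparam E x₀ z (Y z) := by
  have h := chart_dparam hz (Y z)
  rw [liftField, chart_param hz]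
  exact inverse_apply_of_eq (E := E) (isInvertible_chart (param_mem_source hz)) h

theorem coordField_liftField {x₀ : M} {z : E} (hz : z ∈ chartDom E x₀) (Y : E → E) :
    coordField x₀ (liftField x₀ Y) z = Y z :=
  dparam_injective hz ((dparam_coordField hz _).trans (liftField_param hz Y))

theorem contMDiffAt_vectorSpace_iff {Y : E → E} {z : E} :
    ContMDiffAt 𝓘(ℝ, E) (𝓘(ℝ, E).prod 𝓘(ℝ, E)) ∞ (fun y => (⟨y, Y y⟩ : TangentBundle 𝓘(ℝ, E) E)) z
      ↔ ContDiffAt ℝ ∞ Y z :=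
  contMDiffAt_vectorSpace_iff_contDiffAt

theorem mdifferentiableAt_vectorSpace_iff {Y : E → E} {z : E} :
    MDifferentiableAt 𝓘(ℝ, E) (𝓘(ℝ, E).prod 𝓘(ℝ, E))
      (fun y => (⟨y, Y y⟩ : TangentBundle 𝓘(ℝ, E) E)) z ↔ DifferentiableAt ℝ Y z := by
  refine ⟨fun h => ?_, fun h => ?_⟩
  · exact ((contMDiff_snd_tangentBundle_modelSpace E 𝓘(ℝ, E) (n := 1)).contMDiffAt.mdifferentiableAt
      one_ne_zero |>.comp z h).differentiableAt
  · refine (mdifferentiableAt_totalSpace _ _).2 ⟨mdifferentiableAt_id, ?_⟩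
    convert! h.mdifferentiableAt with y
    simp

theorem differentiableAt_coordField {x₀ : M} {z : E} (hz : z ∈ chartDom E x₀)
    {X : Π x : M, TangentSpace 𝓘(ℝ, E) x} (hX : MDiffAt (T% X) (param E x₀ z)) :
    DifferentiableAt ℝ (coordField x₀ X) z := by
  have : CompleteSpace E := FiniteDimensional.complete ℝ E
  have h : MDiffAt (T% (VectorField.mpullback 𝓘(ℝ, E) 𝓘(ℝ, E) (param E x₀) X)) z :=
    hX.mpullback_vectorField (contMDiffAt_param hz) (isInvertible_dparam (E := E) hz) two_le_infty
  exact (mdifferentiableAt_vectorSpace_iff (Y := coordField x₀ X)).1 h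

theorem contDiffAt_coordField {x₀ : M} {z : E} (hz : z ∈ chartDom E x₀)
    {X : Π x : M, TangentSpace 𝓘(ℝ, E) x} (hX : CMDiffAt ∞ (T% X) (param E x₀ z)) :
    ContDiffAt ℝ ∞ (coordField x₀ X) z := by
  have : CompleteSpace E := FiniteDimensional.complete ℝ E
  have h : CMDiffAt ∞ (T% (VectorField.mpullback 𝓘(ℝ, E) 𝓘(ℝ, E) (param E x₀) X)) z :=
    hX.mpullback_vectorField_preimage (contMDiffAt_param hz) (isInvertible_dparam (E := E) hz) (by simp)
  exact (contMDiffAt_vectorSpace_iff (Y := coordField x₀ X)).1 h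

theorem mdifferentiableAt_liftField {x₀ : M} {z : E} (hz : z ∈ chartDom E x₀) {Y : E → E}
    (hY : DifferentiableAt ℝ Y z) : MDiffAt (T% (liftField x₀ Y)) (param E x₀ z) := by
  have : CompleteSpace E := FiniteDimensional.complete ℝ E
  have hs := param_mem_source hz
  rw [← chart_param hz] at hY
  exact (mdifferentiableAt_vectorSpace_iff.2 hY).mpullback_vectorField (contMDiffAt_chart hs)
    (isInvertible_chart hs) two_le_infty

theorem contMDiffAt_liftField {x₀ : M} {z : E} (hz : z ∈ chartDom E x₀) {Y : E → E}
    (hY : ContDiffAt ℝ ∞ Y z) : CMDiffAt ∞ (T% (liftField x₀ Y)) (param E x₀ z) := by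
  have : CompleteSpace E := FiniteDimensional.complete ℝ E
  have hs := param_mem_source hz
  rw [← chart_param hz] at hY
  exact (contMDiffAt_vectorSpace_iff.2 hY).mpullback_vectorField_preimage (contMDiffAt_chart hs)
    (isInvertible_chart hs) (by simp)

theorem mvfderiv_dparam {x₀ : M} {z : E} (hz : z ∈ chartDom E x₀) {f : M → ℝ}
    (hf : MDiffAt f (param E x₀ z)) (v : E) :
    mvfderiv 𝓘(ℝ, E) f (param E x₀ z) (dparam E x₀ z v) =
      fderiv ℝ (fun y => f (param E x₀ y)) z v := by
  have h := mfderiv_comp z hf (mdifferentiableAt_param hz)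
  rw [mfderiv_eq_fderiv] at h
  exact (congrArg (fun A : E →L[ℝ] ℝ => A v) h).symm

theorem mlieBracket_eq_lieBracket (X Y : Π z : E, TangentSpace 𝓘(ℝ, E) z) :
    VectorField.mlieBracket 𝓘(ℝ, E) X Y = VectorField.lieBracket ℝ X Y := by
  rw [← VectorField.mlieBracketWithin_univ, VectorField.mlieBracketWithin_eq_lieBracketWithin]
  exact VectorField.lieBracketWithin_univ (V := X) (W := Y)

/-- `coordField` is the pullback of a vector field by the parametrization, and pullback commutes
with Lie brackets. -/
theorem coordField_mlieBracket {x₀ : M} {z : E} (hz : z ∈ chartDom E x₀)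
    {X Y : Π x : M, TangentSpace 𝓘(ℝ, E) x} (hX : MDiffAt (T% X) (param E x₀ z))
    (hY : MDiffAt (T% Y) (param E x₀ z)) :
    coordField x₀ (VectorField.mlieBracket 𝓘(ℝ, E) X Y) z =
      fderiv ℝ (coordField x₀ Y) z (coordField x₀ X z) -
        fderiv ℝ (coordField x₀ X) z (coordField x₀ Y z) := by
  have : CompleteSpace E := FiniteDimensional.complete ℝ E
  have : IsManifold 𝓘(ℝ, E) (minSmoothness ℝ 2) M :=
    IsManifold.of_le (n := ∞) (by simpa using two_le_infty)
  have h := VectorField.mpullback_mlieBracket hX hY (contMDiffAt_param hz)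
    (by simpa using two_le_infty)
  exact h.trans (congrFun (mlieBracket_eq_lieBracket _ _) z)

theorem mlieBracket_param {x₀ : M} {z : E} (hz : z ∈ chartDom E x₀)
    {X Y : Π x : M, TangentSpace 𝓘(ℝ, E) x} (hX : MDiffAt (T% X) (param E x₀ z))
    (hY : MDiffAt (T% Y) (param E x₀ z)) :
    VectorField.mlieBracket 𝓘(ℝ, E) X Y (param E x₀ z) =
      dparam E x₀ z (fderiv ℝ (coordField x₀ Y) z (coordField x₀ X z) -
        fderiv ℝ (coordField x₀ X) z (coordField x₀ Y z)) := by
  rw [← coordField_mlieBracket hz hX hY, dparam_coordField hz]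

variable (g : PseudoMetric E M)

/-- The coordinate expression of a metric. -/
def coordMetric (x₀ : M) (z : E) : E →L[ℝ] E →L[ℝ] ℝ :=
  pullbackForm g (param E x₀) z

theorem coordMetric_apply (x₀ : M) (z a b : E) : coordMetric g x₀ z a b =
    g.val (param E x₀ z) (dparam E x₀ z a) (dparam E x₀ z b) := rfl

theorem contMDiffAt_pair {X Y : Π x : M, TangentSpace 𝓘(ℝ, E) x} {x : M}
    (hX : CMDiffAt ∞ (T% X) x) (hY : CMDiffAt ∞ (T% Y) x) :
    ContMDiffAt 𝓘(ℝ, E) 𝓘(ℝ) ∞ (g.pair X Y) x := by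
  have h : ContMDiffAt 𝓘(ℝ, E) (𝓘(ℝ, E).prod 𝓘(ℝ)) ∞
      (fun m ↦ Bundle.TotalSpace.mk' ℝ (E := Bundle.Trivial M ℝ) m (g.pair X Y m)) x := by
    apply ContMDiffAt.clm_bundle_apply₂ (F₁ := E) (F₂ := E)
    · exact g.contMDiff x
    · exact hX
    · exact hY
  simp only [Bundle.contMDiffAt_totalSpace] at h
  exact h.2

theorem contDiffAt_coordMetric {x₀ : M} {z : E} (hz : z ∈ chartDom E x₀) :
    ContDiffAt ℝ ∞ (coordMetric g x₀) z := by
  rw [← contMDiffAt_iff_contDiffAt]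
  refine contMDiffAt_of_apply fun a b => ?_
  have h := (contMDiffAt_pair g (contMDiffAt_liftField hz (contDiffAt_const (c := a)))
    (contMDiffAt_liftField hz (contDiffAt_const (c := b)))).comp z (contMDiffAt_param hz)
  refine h.congr_of_eventuallyEq ?_
  filter_upwards [(isOpen_chartDom x₀).mem_nhds hz] with y hy
  rw [coordMetric_apply, ← liftField_param hy (fun _ => a), ← liftField_param hy (fun _ => b)]
  rfl

theorem exists_christoffel (x₀ : M) : ∃ Γ, IsLeviCivita (chartDom E x₀) (coordMetric g x₀) Γ := by
  refine exists_isLeviCivita (isOpen_chartDom x₀) (fun z hz => contDiffAt_coordMetric g hz)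
    (fun z _ a b => g.symm _ _ _) fun z hz a ha => ?_
  refine dparam_injective hz ?_
  rw [map_zero]
  refine g.nondeg _ _ fun w => ?_
  obtain ⟨b, rfl⟩ := dparam_surjective hz w
  exact ha b

/-- The Christoffel symbols of a metric in the preferred chart at a point. -/
def christoffel (x₀ : M) : E → E →L[ℝ] E →L[ℝ] E := Classical.choose (exists_christoffel g x₀)

theorem christoffel_spec (x₀ : M) :
    IsLeviCivita (chartDom E x₀) (coordMetric g x₀) (christoffel g x₀) :=
  Classical.choose_spec (exists_christoffel g x₀)

theorem pair_param {x₀ : M} {z : E} (hz : z ∈ chartDom E x₀)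
    (X Y : Π x : M, TangentSpace 𝓘(ℝ, E) x) : g.pair X Y (param E x₀ z) =
      coordMetric g x₀ z (coordField x₀ X z) (coordField x₀ Y z) := by
  rw [coordMetric_apply, dparam_coordField hz, dparam_coordField hz]
  rfl

/-- Both sides are tested against constant coordinate fields. In the Koszul formula the bracket of
two such fields vanishes, and compatibility of the Christoffel symbols with the coordinate metric
eliminates the derivatives of the metric. -/
theorem leviCivita_param {x₀ : M} {z : E} (hz : z ∈ chartDom E x₀)
    {Z : Π x : M, TangentSpace 𝓘(ℝ, E) x} (hZ : MDiffAt (T% Z) (param E x₀ z)) (v : E) :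
    g.leviCivita Z (param E x₀ z) (dparam E x₀ z v) =
      dparam E x₀ z (fderiv ℝ (coordField x₀ Z) z v +
        christoffel g x₀ z v (coordField x₀ Z z)) := by
  have hΓ := christoffel_spec g x₀
  refine PseudoMetric.eq_of_forall_val (g := g) fun w' => ?_
  obtain ⟨w, rfl⟩ := dparam_surjective hz w'
  have hc : ∀ a : E, MDiffAt (T% (liftField x₀ fun _ => a)) (param E x₀ z) := fun a =>
    mdifferentiableAt_liftField hz (differentiableAt_const a)
  have hcf : ∀ a : E, coordField x₀ (liftField (M := M) x₀ fun _ => a) =ᶠ[𝓝 z] fun _ => a := by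
    intro a
    filter_upwards [(isOpen_chartDom x₀).mem_nhds hz] with y hy using coordField_liftField hy _
  have hcd : ∀ a : E, fderiv ℝ (coordField x₀ (liftField (M := M) x₀ fun _ => a)) z = 0 :=
    fun a => by rw [(hcf a).fderiv_eq]; simp
  have hG : DifferentiableAt ℝ (coordMetric g x₀) z :=
    (hΓ.smooth_metric z hz).differentiableAt (by simp)
  have hZc := differentiableAt_coordField hz hZ
  have key := PseudoMetric.two_mul_nabla (g := g) (hc v) hZ (hc w)
  have hp : ∀ {X Y : Π x : M, TangentSpace 𝓘(ℝ, E) x} (_ : MDiffAt (T% X) (param E x₀ z))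
      (_ : MDiffAt (T% Y) (param E x₀ z)) (u : E),
      mvfderiv 𝓘(ℝ, E) (g.pair X Y) (param E x₀ z) (dparam E x₀ z u) =
      fderiv ℝ (coordMetric g x₀) z u (coordField x₀ X z) (coordField x₀ Y z) +
      coordMetric g x₀ z (fderiv ℝ (coordField x₀ X) z u) (coordField x₀ Y z) +
      coordMetric g x₀ z (coordField x₀ X z) (fderiv ℝ (coordField x₀ Y) z u) := by
    intro X Y hX hY u
    rw [mvfderiv_dparam hz (g.mdiff_pair hX hY), ← fderiv_bilin_apply hG
      (differentiableAt_coordField hz hX) (differentiableAt_coordField hz hY)]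
    refine congrArg (fun A : E →L[ℝ] ℝ => A u) (Filter.EventuallyEq.fderiv_eq ?_)
    filter_upwards [(isOpen_chartDom x₀).mem_nhds hz] with y hy using pair_param g hy X Y
  simp only [PseudoMetric.koszul] at key
  rw [mlieBracket_param hz (hc v) hZ, mlieBracket_param hz (hc v) (hc w),
    mlieBracket_param hz hZ (hc w)] at key
  rw [← dparam_coordField hz Z, liftField_param hz, liftField_param hz, hp hZ (hc w),
    hp (hc v) (hc w), hp (hc v) hZ] at key
  simp only [hcd, coordField_liftField hz, ← coordMetric_apply] at key
  have hL : ∀ x, coordMetric g x₀ z x w = coordMetric g x₀ z w x := fun x =>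
    hΓ.symm_metric z hz _ _
  have c1 := hΓ.compat z hz v (coordField x₀ Z z) w
  have c2 := hΓ.compat z hz (coordField x₀ Z z) v w
  have c3 := hΓ.compat z hz w v (coordField x₀ Z z)
  change g.val _ (g.nabla Z (param E x₀ z) (dparam E x₀ z v)) (dparam E x₀ z w) = _
  rw [← coordMetric_apply]
  simp only [zero_apply, map_zero, sub_zero, zero_sub, add_zero, map_add, add_apply, map_neg,
    neg_apply] at key ⊢
  rw [c1, c2, c3] at key
  have s1 := hΓ.symm z hz (coordField x₀ Z z) v
  have s2 := hΓ.symm z hz w v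
  have s3 := hΓ.symm z hz w (coordField x₀ Z z)
  rw [s1, s2, s3] at key
  have m1 := hΓ.symm_metric z hz v (fderiv ℝ (coordField x₀ Z) z w)
  have m2 := hΓ.symm_metric z hz v (christoffel g x₀ z (coordField x₀ Z z) w)
  have m3 := hΓ.symm_metric z hz (coordField x₀ Z z) (christoffel g x₀ z v w)
  linarith

end Coordinates

/-! ### Curvature and covariant derivatives at the centre of a preferred chart -/

section Center

variable {E : Type*} [NormedAddCommGroup E] [NormedSpace ℝ E] [FiniteDimensional ℝ E]
  {M : Type*} [TopologicalSpace M] [ChartedSpace E M] [IsManifold 𝓘(ℝ, E) ∞ M]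

/-- The tangent space at `x₀` is identified with the model space by the preferred chart at `x₀`
itself. So tensors at `x₀` agree with their coordinate expressions at the centre without any change
of frame. -/
theorem dparam_center (x₀ : M) (v : E) : dparam E x₀ (extChartAt 𝓘(ℝ, E) x₀ x₀) v = v := by
  have h := chart_dparam (center_mem x₀) v
  -- The image of the centre is `x₀` only up to a propositional equality, so the claim is
  -- transported along an arbitrary equality `y = x₀`; the device recurs below.
  have h1 : ∀ y, y = x₀ → ∀ w : E,
      (mfderiv 𝓘(ℝ, E) 𝓘(ℝ, E) (extChartAt 𝓘(ℝ, E) x₀) y : E →L[ℝ] E) w = w := by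
    rintro y rfl w
    exact congrArg (fun A : E →L[ℝ] E => A w) (mfderiv_extChartAt_self (I := 𝓘(ℝ, E)) (x := y))
  exact (h1 _ (param_center (E := E) x₀) _).symm.trans h

/-- The extension of a tangent vector used in the definition of the Riemann tensor. -/
def extendVector (x₀ : M) (v : E) : Π y : M, TangentSpace 𝓘(ℝ, E) y :=
  let v' : TangentSpace 𝓘(ℝ, E) x₀ := v
  FiberBundle.extend E v'

theorem mdifferentiableAt_extendVector (x₀ : M) (v : E) : MDiffAt (T% (extendVector x₀ v)) x₀ :=
  let v' : TangentSpace 𝓘(ℝ, E) x₀ := v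
  FiberBundle.mdifferentiableAt_extend 𝓘(ℝ, E) E v'

/-- The extension is constant in the preferred trivialization at `x₀`, which is the one induced by
the chart; hence it is a constant coordinate field. -/
theorem extend_param (x₀ : M) (v : E) {z : E} (hz : z ∈ chartDom E x₀) :
    (extendVector x₀ v) (param E x₀ z) =
      dparam E x₀ z v := by
  have hs : param E x₀ z ∈ (chartAt E x₀).source := by simpa using param_mem_source hz
  have h1 : (trivializationAt E (TangentSpace 𝓘(ℝ, E)) x₀ ⟨x₀, v⟩).2 = v := by
    rw [TangentBundle.trivializationAt_apply]
    exact (tangentBundleCore 𝓘(ℝ, E) M).coordChange_self (achart E x₀) x₀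
      (mem_chart_source E x₀) v
  have h2 := TangentBundle.symmL_trivializationAt (I := 𝓘(ℝ, E)) hs
  rw [ModelWithCorners.range_eq_univ, mfderivWithin_univ, chart_param hz] at h2
  have hb : param E x₀ z ∈ (trivializationAt E (TangentSpace 𝓘(ℝ, E)) x₀).baseSet := by
    simpa using hs
  have h3 : extendVector x₀ v (param E x₀ z) =
      (trivializationAt E (TangentSpace 𝓘(ℝ, E)) x₀).symm (param E x₀ z)
        (trivializationAt E (TangentSpace 𝓘(ℝ, E)) x₀ ⟨x₀, v⟩).2 := rfl
  rw [h3, h1]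
  have h4 := Bundle.Trivialization.symmL_apply (R := ℝ)
    (trivializationAt E (TangentSpace 𝓘(ℝ, E) (M := M)) x₀) hb v
  exact h4.symm.trans (congrArg (fun A : E →L[ℝ] E => A v) h2)

theorem extend_eq_liftField (x₀ : M) (v : E) {y : M}
    (hy : y ∈ (extChartAt 𝓘(ℝ, E) x₀).source) :
    (extendVector x₀ v) y =
      liftField x₀ (fun _ => v) y := by
  have hz : extChartAt 𝓘(ℝ, E) x₀ y ∈ chartDom E x₀ := (extChartAt 𝓘(ℝ, E) x₀).map_source hy
  have h1 := extend_param x₀ v hz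
  have h2 := liftField_param hz (fun _ => v)
  rw [param_chart hy] at h1 h2
  exact h1.trans h2.symm

theorem source_mem_nhds {x₀ y : M} (hy : y ∈ (extChartAt 𝓘(ℝ, E) x₀).source) :
    (extChartAt 𝓘(ℝ, E) x₀).source ∈ 𝓝 y :=
  (isOpen_extChartAt_source x₀).mem_nhds hy

theorem extend_eventuallyEq (x₀ : M) (v : E) {y : M}
    (hy : y ∈ (extChartAt 𝓘(ℝ, E) x₀).source) :
    (extendVector x₀ v) =ᶠ[𝓝 y]
      liftField x₀ (fun _ => v) := by
  filter_upwards [source_mem_nhds hy] with y' hy' using extend_eq_liftField x₀ v hy'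

theorem MDiffAt.congr_field {X Y : Π x : M, TangentSpace 𝓘(ℝ, E) x} {y : M}
    (hY : MDiffAt (T% Y) y) (h : X =ᶠ[𝓝 y] Y) : MDiffAt (T% X) y := by
  refine hY.congr_of_eventuallyEq ?_
  filter_upwards [h] with x hx
  rw [hx]

theorem coordField_eventuallyEq {x₀ : M} {z : E} (hz : z ∈ chartDom E x₀)
    {X : Π x : M, TangentSpace 𝓘(ℝ, E) x} {Y : E → E}
    (h : ∀ y ∈ (extChartAt 𝓘(ℝ, E) x₀).source, X y = liftField x₀ Y y) :
    coordField x₀ X =ᶠ[𝓝 z] Y := by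
  filter_upwards [(isOpen_chartDom x₀).mem_nhds hz] with z' hz'
  rw [← coordField_liftField hz' Y, coordField, coordField, h _ (param_mem_source hz')]

variable (g : PseudoMetric E M)

theorem leviCivita_center (x₀ : M) {Z : Π x : M, TangentSpace 𝓘(ℝ, E) x}
    (hZ : MDiffAt (T% Z) x₀) (v : E) :
    g.leviCivita Z x₀ v = fderiv ℝ (coordField x₀ Z) (extChartAt 𝓘(ℝ, E) x₀ x₀) v +
      christoffel g x₀ (extChartAt 𝓘(ℝ, E) x₀ x₀) v
        (coordField x₀ Z (extChartAt 𝓘(ℝ, E) x₀ x₀)) := by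
  have h1 : ∀ y, y = x₀ → ∀ w : E, MDiffAt (T% Z) y ∧
      (g.leviCivita Z y : E →L[ℝ] E) w = (g.leviCivita Z x₀ : E →L[ℝ] E) w := by
    rintro y rfl w
    exact ⟨hZ, rfl⟩
  obtain ⟨h2, h3⟩ := h1 _ (param_center (E := E) x₀) v
  have h4 := leviCivita_param g (center_mem x₀) h2 v
  rw [dparam_center] at h4
  refine h3.symm.trans (Eq.trans ?_ (h4.trans (dparam_center x₀ _)))
  exact congrArg (fun w : E => (g.leviCivita Z (param E x₀ (extChartAt 𝓘(ℝ, E) x₀ x₀)) : E →L[ℝ] E) w)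
    rfl

theorem leviCivita_extend (x₀ : M) (v w : E) {y : M}
    (hy : y ∈ (extChartAt 𝓘(ℝ, E) x₀).source) :
    g.leviCivita (extendVector x₀ w) y
        ((extendVector x₀ v) y) =
      liftField x₀ (fun z => christoffel g x₀ z v w) y := by
  have hz : extChartAt 𝓘(ℝ, E) x₀ y ∈ chartDom E x₀ := (extChartAt 𝓘(ℝ, E) x₀).map_source hy
  obtain ⟨z, hzd, rfl⟩ : ∃ z ∈ chartDom E x₀, param E x₀ z = y := ⟨_, hz, param_chart hy⟩
  have hd : MDiffAt (T% (extendVector x₀ w))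
      (param E x₀ z) :=
    MDiffAt.congr_field (mdifferentiableAt_liftField hzd (differentiableAt_const _))
      (extend_eventuallyEq x₀ w hy)
  have hc := coordField_eventuallyEq hzd fun y hy => extend_eq_liftField x₀ w hy
  rw [extend_param x₀ v hzd, leviCivita_param g hzd hd, liftField_param hzd, hc.fderiv_eq,
    hc.eq_of_nhds]
  simp

/-- The extended fields are constant in the chart, so their bracket vanishes and `∇_V W` has
coordinate expression `Γ(v, w)` on the whole chart domain; one more derivative produces `riem`. -/
theorem riemann_center (x₀ : M) (u v w : E) :
    g.riemann x₀ u v w = riem (christoffel g x₀) (extChartAt 𝓘(ℝ, E) x₀ x₀) u v w := by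
  have hs : x₀ ∈ (extChartAt 𝓘(ℝ, E) x₀).source := mem_extChartAt_source x₀
  have hz := center_mem (E := E) x₀
  have hΓ := christoffel_spec g x₀
  have hΓd : DifferentiableAt ℝ (christoffel g x₀) (extChartAt 𝓘(ℝ, E) x₀ x₀) :=
    (hΓ.smooth _ hz).differentiableAt (by simp)
  have key : ∀ u v : E,
      g.leviCivita (fun y => g.leviCivita (extendVector x₀ w) y
        ((extendVector x₀ v) y)) x₀ u =
      fderiv ℝ (christoffel g x₀) (extChartAt 𝓘(ℝ, E) x₀ x₀) u v w +
        christoffel g x₀ (extChartAt 𝓘(ℝ, E) x₀ x₀) u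
          (christoffel g x₀ (extChartAt 𝓘(ℝ, E) x₀ x₀) v w) := by
    intro u v
    have hd' : DifferentiableAt ℝ (fun z => christoffel g x₀ z v w)
        (extChartAt 𝓘(ℝ, E) x₀ x₀) := (hΓd.clm_apply (differentiableAt_const _)).clm_apply
          (differentiableAt_const _)
    have hl := mdifferentiableAt_liftField (M := M) hz hd'
    rw [param_center] at hl
    have he : (fun y => g.leviCivita (extendVector x₀ w) y
        ((extendVector x₀ v) y)) =ᶠ[𝓝 x₀]
        liftField x₀ (fun z => christoffel g x₀ z v w) := by
      filter_upwards [source_mem_nhds hs] with y hy using leviCivita_extend g x₀ v w hy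
    have hc := coordField_eventuallyEq hz fun y hy => leviCivita_extend g x₀ v w hy
    rw [leviCivita_center g x₀ (MDiffAt.congr_field hl he), hc.fderiv_eq, hc.eq_of_nhds]
    congr 1
    have := fderiv_bilin_apply hΓd (differentiableAt_const (c := (v : E)))
      (differentiableAt_const (c := (w : E))) u
    simpa using this
  have hbr : VectorField.mlieBracket 𝓘(ℝ, E)
      (extendVector x₀ u)
      (extendVector x₀ v) x₀ = 0 := by
    have hm : ∀ u : E, MDiffAt
        (T% (extendVector x₀ u)) x₀ := fun u =>
      mdifferentiableAt_extendVector x₀ u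
    have h1 : ∀ y, y = x₀ → ∀ u : E, MDiffAt
        (T% (extendVector x₀ u)) y := by
      rintro y rfl u
      exact hm u
    have h2 := mlieBracket_param hz (h1 _ (param_center (E := E) x₀) u) (h1 _ (param_center (E := E) x₀) v)
    have hc : ∀ u : E, coordField x₀
        (extendVector x₀ u) =ᶠ[𝓝 (extChartAt 𝓘(ℝ, E) x₀ x₀)]
        fun _ => u := fun u => coordField_eventuallyEq hz fun y hy => extend_eq_liftField x₀ u hy
    rw [(hc u).fderiv_eq, (hc v).fderiv_eq] at h2
    simp only [fderiv_fun_const, Pi.zero_apply, zero_apply, sub_zero, map_zero] at h2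
    have h3 : ∀ y, y = x₀ → VectorField.mlieBracket 𝓘(ℝ, E)
      (extendVector x₀ u)
      (extendVector x₀ v) y = 0 →
      VectorField.mlieBracket 𝓘(ℝ, E)
      (extendVector x₀ u)
      (extendVector x₀ v) x₀ = 0 := by
      rintro y rfl h; exact h
    exact h3 _ (param_center x₀) h2
  change g.leviCivita (fun y => g.leviCivita (extendVector x₀ w) y (extendVector x₀ v y)) x₀ u
    - g.leviCivita (fun y => g.leviCivita (extendVector x₀ w) y (extendVector x₀ u y)) x₀ v
    - g.leviCivita (extendVector x₀ w) x₀
      (VectorField.mlieBracket 𝓘(ℝ, E) (extendVector x₀ u) (extendVector x₀ v) x₀) = _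
  rw [hbr, key, key, map_zero, sub_zero]
  unfold riem
  abel

theorem ricci_center (x₀ : M) (v w : E) :
    g.ricci x₀ v w = LinearMap.trace ℝ E
      (riemLin (christoffel g x₀) (extChartAt 𝓘(ℝ, E) x₀ x₀) v w) := by
  rw [LinearMap.trace_eq_matrix_trace ℝ (Module.finBasis ℝ E), Matrix.trace]
  refine Finset.sum_congr rfl fun i _ => ?_
  rw [Matrix.diag, LinearMap.toMatrix_apply, riemLin_apply, ← riemann_center]
  rfl

theorem covDerivOneForm_center (x₀ : M) (α : Π y : M, TangentSpace 𝓘(ℝ, E) y → ℝ)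
    (u w : E)
    (hα : DifferentiableAt ℝ (fun z => α (param E x₀ z) (dparam E x₀ z w))
      (extChartAt 𝓘(ℝ, E) x₀ x₀)) :
    g.covDerivOneForm α x₀ u w =
      fderiv ℝ (fun z => α (param E x₀ z) (dparam E x₀ z w)) (extChartAt 𝓘(ℝ, E) x₀ x₀) u -
        α x₀ (christoffel g x₀ (extChartAt 𝓘(ℝ, E) x₀ x₀) u w) := by
  have hs : x₀ ∈ (extChartAt 𝓘(ℝ, E) x₀).source := mem_extChartAt_source x₀
  have hz := center_mem (E := E) x₀
  let f : M → ℝ := fun y => α y ((extendVector x₀ w) y)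
  have hfp : (fun z => f (param E x₀ z)) =ᶠ[𝓝 (extChartAt 𝓘(ℝ, E) x₀ x₀)]
      fun z => α (param E x₀ z) (dparam E x₀ z w) := by
    filter_upwards [(isOpen_chartDom x₀).mem_nhds hz] with z hz
    simp only [f]
    rw [extend_param x₀ w hz]
  have hf : MDiffAt f x₀ := by
    have h1 : MDiffAt ((fun z => f (param E x₀ z)) ∘ extChartAt 𝓘(ℝ, E) x₀) x₀ :=
      MDifferentiableAt.comp x₀ (hα.congr_of_eventuallyEq hfp).mdifferentiableAt
        ((contMDiffAt_chart hs).mdifferentiableAt (by simp))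
    refine h1.congr_of_eventuallyEq ?_
    filter_upwards [source_mem_nhds hs] with y hy
    simp only [Function.comp_apply, param_chart hy]
  have h1 : ∀ y, y = x₀ → ∀ u : E, MDiffAt f y ∧
      (mvfderiv 𝓘(ℝ, E) f y : E →L[ℝ] ℝ) u = (mvfderiv 𝓘(ℝ, E) f x₀ : E →L[ℝ] ℝ) u := by
    rintro y rfl u
    exact ⟨hf, rfl⟩
  obtain ⟨h2, h3⟩ := h1 _ (param_center (E := E) x₀) u
  have h4 := mvfderiv_dparam hz h2 u
  rw [hfp.fderiv_eq] at h4
  have h5 : (mvfderiv 𝓘(ℝ, E) f (param E x₀ (extChartAt 𝓘(ℝ, E) x₀ x₀)) : E →L[ℝ] ℝ)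
      (dparam E x₀ (extChartAt 𝓘(ℝ, E) x₀ x₀) u) =
      (mvfderiv 𝓘(ℝ, E) f (param E x₀ (extChartAt 𝓘(ℝ, E) x₀ x₀)) : E →L[ℝ] ℝ) u :=
    congrArg _ (dparam_center x₀ u)
  have hc : coordField x₀ (extendVector x₀ w)
      =ᶠ[𝓝 (extChartAt 𝓘(ℝ, E) x₀ x₀)] fun _ => w :=
    coordField_eventuallyEq hz fun y hy => extend_eq_liftField x₀ w hy
  have h6 : g.leviCivita (extendVector x₀ w) x₀ u =
      christoffel g x₀ (extChartAt 𝓘(ℝ, E) x₀ x₀) u w := by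
    rw [leviCivita_center g x₀ (mdifferentiableAt_extendVector x₀ w), hc.fderiv_eq,
      hc.eq_of_nhds]
    exact (congrArg (· + _) (congrArg (fun A : E →L[ℝ] E => A u) (congrFun (fderiv_fun_const (𝕜 := ℝ) (E := E) w) _))).trans (zero_add _)
  change mvfderiv 𝓘(ℝ, E) f x₀ u - α x₀ (g.leviCivita (extendVector x₀ w) x₀ u) = _
  rw [h6]
  congr 1
  exact h3.symm.trans (h5.symm.trans h4)

end Center

/-! ### Immersions and maps in preferred charts -/

section LocalMap

variable {E : Type*} [NormedAddCommGroup E] [NormedSpace ℝ E] [FiniteDimensional ℝ E]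
  {M : Type*} [TopologicalSpace M] [ChartedSpace E M] [IsManifold 𝓘(ℝ, E) ∞ M]
  {F : Type*} [NormedAddCommGroup F] [NormedSpace ℝ F] [FiniteDimensional ℝ F]
  {N : Type*} [TopologicalSpace N] [ChartedSpace F N] [IsManifold 𝓘(ℝ, F) ∞ N]

/-- An immersion has smooth local left inverses. -/
theorem exists_leftInverse_of_isImmersion {f : N → M}
    (hf : Manifold.IsImmersion 𝓘(ℝ, F) 𝓘(ℝ, E) ∞ f) (p : N) :
    ∃ r : M → N, ContMDiffAt 𝓘(ℝ, E) 𝓘(ℝ, F) ∞ r (f p) ∧ ∀ᶠ p' in 𝓝 p, r (f p') = p' := by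
  have h := hf.isImmersionAt p
  let d := h.domChart.extend 𝓘(ℝ, F)
  let c := h.codChart.extend 𝓘(ℝ, E)
  -- In adapted charts an immersion is the inclusion of a factor, so the projection to that factor
  -- is a left inverse.
  have hcd : ∀ p' ∈ h.domChart.source, c (f p') = h.equiv (d p', 0) := by
    intro p' hp'
    have hs : p' ∈ d.source := by simpa [d] using hp'
    have h1 : c (f (d.symm (d p'))) = h.equiv (d p', 0) := h.writtenInCharts (d.map_source hs)
    rwa [d.left_inv hs] at h1
  have key : ∀ p' ∈ h.domChart.source, (h.equiv.symm (c (f p'))).1 = d p' := by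
    intro p' hp'
    rw [hcd p' hp', ContinuousLinearEquiv.symm_apply_apply]
  refine ⟨fun x => d.symm (h.equiv.symm (c x)).1, ?_, ?_⟩
  · have hc : ContMDiffAt 𝓘(ℝ, E) 𝓘(ℝ, E) ∞ c (f p) :=
      h.codChart.contMDiffAt_extend h.codChart_mem_maximalAtlas h.mem_codChart_source
    have he : ContMDiffAt 𝓘(ℝ, E) 𝓘(ℝ, F) ∞ (fun v => (h.equiv.symm v).1) (c (f p)) :=
      (contDiff_fst.comp h.equiv.symm.contDiff).contMDiff.contMDiffAt
    have hp : d p ∈ d.target := d.map_source (by simpa [d] using h.mem_domChart_source)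
    have hd : ContMDiffAt 𝓘(ℝ, F) 𝓘(ℝ, F) ∞ d.symm ((h.equiv.symm (c (f p))).1) := by
      rw [key p h.mem_domChart_source]
      refine (contMDiffOn_extend_symm h.domChart_mem_maximalAtlas).contMDiffAt ?_
      have : IsOpen d.target := h.domChart.isOpen_extend_target
      simpa [d] using this.mem_nhds hp
    exact hd.comp (f p) (he.comp (f p) hc)
  · filter_upwards [h.domChart.open_source.mem_nhds h.mem_domChart_source] with p' hp'
    rw [key p' hp']
    exact d.left_inv (by simpa [d] using hp')

theorem mfderiv_injective_of_isImmersion {f : N → M}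
    (hf : Manifold.IsImmersion 𝓘(ℝ, F) 𝓘(ℝ, E) ∞ f) (p : N) :
    Function.Injective (mfderiv 𝓘(ℝ, F) 𝓘(ℝ, E) f p) := by
  obtain ⟨r, hr, hrf⟩ := exists_leftInverse_of_isImmersion hf p
  have h1 := mfderiv_comp p (hr.mdifferentiableAt (by simp))
    ((hf.contMDiff p).mdifferentiableAt (by simp))
  have h2 : r ∘ f =ᶠ[𝓝 p] id := hrf
  have h3 : ∀ v : F, (mfderiv 𝓘(ℝ, E) 𝓘(ℝ, F) r (f p) : E →L[ℝ] F)
      ((mfderiv 𝓘(ℝ, F) 𝓘(ℝ, E) f p : F →L[ℝ] E) v) = v := by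
    intro v
    have h4 : (mfderiv 𝓘(ℝ, F) 𝓘(ℝ, F) (r ∘ f) p : F →L[ℝ] F) v = v := by
      have h5 : mfderiv 𝓘(ℝ, F) 𝓘(ℝ, F) (r ∘ f) p = mfderiv 𝓘(ℝ, F) 𝓘(ℝ, F) (id : N → N) p :=
        h2.mfderiv_eq
      exact (congrArg (fun A : F →L[ℝ] F => A v) h5).trans
        (congrArg (fun A : F →L[ℝ] F => A v) mfderiv_id)
    exact (congrArg (fun A : F →L[ℝ] F => A v) h1).symm.trans h4
  intro v w hvw
  exact (h3 v).symm.trans ((congrArg _ hvw).trans (h3 w))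

/-- The expression of a map in the preferred charts at `p₀` and at its image. -/
def localMap (f : N → M) (p₀ : N) (z : F) : E := extChartAt 𝓘(ℝ, E) (f p₀) (f (param F p₀ z))

variable (E F) in
/-- The domain on which a map is expressed in the preferred charts at `p₀` and at its image. -/
def localDom (f : N → M) (p₀ : N) : Set F :=
  chartDom F p₀ ∩ (fun z => f (param F p₀ z)) ⁻¹' (extChartAt 𝓘(ℝ, E) (f p₀)).source

variable {f : N → M} {p₀ : N} {z : F}

theorem isOpen_localDom (hf : ContMDiff 𝓘(ℝ, F) 𝓘(ℝ, E) ∞ f) : IsOpen (localDom E F f p₀) := by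
  refine ContinuousOn.isOpen_inter_preimage (fun z hz => ?_) (isOpen_chartDom p₀)
    (isOpen_extChartAt_source (f p₀))
  exact (hf.continuous.continuousAt.comp (contMDiffAt_param hz).continuousAt).continuousWithinAt

theorem center_mem_localDom : extChartAt 𝓘(ℝ, F) p₀ p₀ ∈ localDom E F f p₀ := by
  refine ⟨center_mem p₀, ?_⟩
  rw [Set.mem_preimage, param_center]
  exact mem_extChartAt_source _

theorem localMap_center : localMap (E := E) (F := F) f p₀ (extChartAt 𝓘(ℝ, F) p₀ p₀) =
    extChartAt 𝓘(ℝ, E) (f p₀) (f p₀) := by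
  rw [localMap, param_center]

theorem localMap_mem (hz : z ∈ localDom E F f p₀) : localMap f p₀ z ∈ chartDom E (f p₀) :=
  (extChartAt 𝓘(ℝ, E) (f p₀)).map_source hz.2

theorem param_localMap (hz : z ∈ localDom E F f p₀) :
    param E (f p₀) (localMap f p₀ z) = f (param F p₀ z) :=
  param_chart hz.2

theorem contDiffAt_localMap (hf : ContMDiff 𝓘(ℝ, F) 𝓘(ℝ, E) ∞ f) (hz : z ∈ localDom E F f p₀) :
    ContDiffAt ℝ ∞ (localMap (E := E) f p₀) z := by
  rw [← contMDiffAt_iff_contDiffAt]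
  exact (contMDiffAt_chart hz.2).comp z (hf.contMDiffAt.comp z (contMDiffAt_param hz.1))

/-- The chain rule for the two sides of `param ∘ localMap = f ∘ param`; it is the dictionary between
manifold and coordinate derivatives. -/
theorem dparam_fderiv_localMap (hf : ContMDiff 𝓘(ℝ, F) 𝓘(ℝ, E) ∞ f)
    (hz : z ∈ localDom E F f p₀) (v : F) :
    (dparam E (f p₀) (localMap f p₀ z) : E →L[ℝ] E) (fderiv ℝ (localMap f p₀) z v) =
      (mfderiv 𝓘(ℝ, F) 𝓘(ℝ, E) f (param F p₀ z) : F →L[ℝ] E)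
        ((dparam F p₀ z : F →L[ℝ] F) v) := by
  have h1 := mfderiv_comp z (mdifferentiableAt_param (localMap_mem hz))
    ((contDiffAt_localMap hf hz).contMDiffAt.mdifferentiableAt (by simp))
  have h2 := mfderiv_comp z (hf.contMDiffAt.mdifferentiableAt (by simp))
    (mdifferentiableAt_param hz.1)
  have h3 : param E (f p₀) ∘ localMap f p₀ =ᶠ[𝓝 z] f ∘ param F p₀ := by
    filter_upwards [(isOpen_localDom hf).mem_nhds hz] with y hy using param_localMap hy
  rw [mfderiv_eq_fderiv] at h1
  exact (congrArg (fun A : F →L[ℝ] E => A v) h1).symm.trans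
    ((congrArg (fun A : F →L[ℝ] E => A v) h3.mfderiv_eq).trans
      (congrArg (fun A : F →L[ℝ] E => A v) h2))

theorem fderiv_localMap_injective (hf : Manifold.IsImmersion 𝓘(ℝ, F) 𝓘(ℝ, E) ∞ f)
    (hz : z ∈ localDom E F f p₀) :
    Function.Injective (fderiv ℝ (localMap (E := E) f p₀) z) := by
  intro v w hvw
  have h := dparam_fderiv_localMap hf.contMDiff hz
  refine dparam_injective hz.1 (mfderiv_injective_of_isImmersion hf _ ?_)
  exact (h v).symm.trans ((congrArg _ hvw).trans (h w))

theorem PseudoMetric.val_congr (g : PseudoMetric E M) {x y : M} (h : x = y) (u v : E) :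
    (g.val x : E →L[ℝ] E →L[ℝ] ℝ) u v = (g.val y : E →L[ℝ] E →L[ℝ] ℝ) u v := by
  subst h; rfl

theorem coordMetric_localMap (g : PseudoMetric E M) (hf : ContMDiff 𝓘(ℝ, F) 𝓘(ℝ, E) ∞ f)
    (hz : z ∈ localDom E F f p₀) (u v : F) :
    coordMetric g (f p₀) (localMap f p₀ z) (fderiv ℝ (localMap f p₀) z u)
      (fderiv ℝ (localMap f p₀) z v) =
    pullbackForm g f (param F p₀ z) (dparam F p₀ z u) (dparam F p₀ z v) := by
  have hu := dparam_fderiv_localMap hf hz u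
  have hv := dparam_fderiv_localMap hf hz v
  have h1 := g.val_congr (param_localMap hz)
    ((dparam E (f p₀) (localMap f p₀ z) : E →L[ℝ] E) (fderiv ℝ (localMap f p₀) z u))
    ((dparam E (f p₀) (localMap f p₀ z) : E →L[ℝ] E) (fderiv ℝ (localMap f p₀) z v))
  refine Eq.trans h1 ?_
  rw [hu, hv]
  rfl

theorem mdifferentiableAt_of_param {x₀ : M} {z : E} (hz : z ∈ chartDom E x₀) {f : M → ℝ}
    (hf : DifferentiableAt ℝ (fun y => f (param E x₀ y)) z) : MDiffAt f (param E x₀ z) := by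
  have hs := param_mem_source hz
  rw [← chart_param hz] at hf
  have h1 : MDiffAt ((fun z => f (param E x₀ z)) ∘ extChartAt 𝓘(ℝ, E) x₀) (param E x₀ z) :=
    MDifferentiableAt.comp _ hf.mdifferentiableAt
      ((contMDiffAt_chart hs).mdifferentiableAt (by simp))
  refine h1.congr_of_eventuallyEq ?_
  filter_upwards [source_mem_nhds hs] with y hy
  simp only [Function.comp_apply, param_chart hy]

theorem eventually_nhds_param {x₀ : M} {z : E} (hz : z ∈ chartDom E x₀) {P : M → Prop} :
    (∀ᶠ y in 𝓝 (param E x₀ z), P y) ↔ ∀ᶠ y in 𝓝 z, P (param E x₀ y) := by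
  refine ⟨fun h => (contMDiffAt_param hz).continuousAt.eventually h, fun h => ?_⟩
  have hs := param_mem_source hz
  rw [← chart_param hz] at h
  filter_upwards [(contMDiffAt_chart hs).continuousAt.eventually h, source_mem_nhds hs]
    with y hy hys
  rwa [param_chart hys] at hy

end LocalMap

/-! ### The induced derivative and the invariance of the metric in coordinates -/

section HypersurfaceCoordinates

variable {E : Type*} [NormedAddCommGroup E] [NormedSpace ℝ E] [FiniteDimensional ℝ E]
  {M : Type*} [TopologicalSpace M] [ChartedSpace E M] [IsManifold 𝓘(ℝ, E) ∞ M]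
  {F : Type*} [NormedAddCommGroup F] [NormedSpace ℝ F] [FiniteDimensional ℝ F]
  {N : Type*} [TopologicalSpace N] [ChartedSpace F N] [IsManifold 𝓘(ℝ, F) ∞ N]
  {g : PseudoMetric E M} {ι : N → M} {p₀ : N} {z : F}

/-- Guarantees that the extension selected in `ambientDeriv` is a genuine one. In coordinates,
`dφ(y)` is composed with a local left inverse `ρ` of the immersion. -/
theorem exists_isExtensionAt (hι : Manifold.IsImmersion 𝓘(ℝ, F) 𝓘(ℝ, E) ∞ ι)
    (hz : z ∈ localDom E F ι p₀) {Y : Π p : N, TangentSpace 𝓘(ℝ, F) p} {y : F → F}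
    (hy : DifferentiableAt ℝ y z)
    (hY : ∀ᶠ q in 𝓝 z, Y (param F p₀ q) = dparam F p₀ q (y q)) :
    ∃ Z, IsExtensionAt (E := E) ι Y (param F p₀ z) Z := by
  obtain ⟨r, hr, hrι⟩ := exists_leftInverse_of_isImmersion hι (param F p₀ z)
  have hφ := contDiffAt_localMap hι.contMDiff hz
  have hx := localMap_mem hz
  let ρ : E → F := fun x => extChartAt 𝓘(ℝ, F) p₀ (r (param E (ι p₀) x))
  have hρφ : ∀ᶠ q in 𝓝 z, ρ (localMap ι p₀ q) = q := by
    filter_upwards [(isOpen_localDom hι.contMDiff).mem_nhds hz,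
      (eventually_nhds_param hz.1).1 hrι] with q hq hrq
    simp only [ρ]
    rw [param_localMap hq, hrq, chart_param hq.1]
  have hρz : ρ (localMap ι p₀ z) = z := hρφ.self_of_nhds
  have hρ : DifferentiableAt ℝ ρ (localMap ι p₀ z) := by
    have h1 : ContMDiffAt 𝓘(ℝ, E) 𝓘(ℝ, F) ∞ r (param E (ι p₀) (localMap ι p₀ z)) := by
      rw [param_localMap hz]
      exact hr
    have h2 : r (param E (ι p₀) (localMap ι p₀ z)) ∈ (extChartAt 𝓘(ℝ, F) p₀).source := by
      rw [param_localMap hz, hrι.self_of_nhds]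
      exact param_mem_source hz.1
    have h3 : ContMDiffAt 𝓘(ℝ, E) 𝓘(ℝ, F) ∞ ρ (localMap ι p₀ z) :=
      (contMDiffAt_chart h2).comp (localMap ι p₀ z) (h1.comp (localMap ι p₀ z)
        (contMDiffAt_param hx))
    exact (contMDiffAt_iff_contDiffAt.1 h3).differentiableAt (by simp)
  let ζ : E → E := fun x => fderiv ℝ (localMap ι p₀) (ρ x) (y (ρ x))
  have hζ : DifferentiableAt ℝ ζ (localMap ι p₀ z) := by
    have h1 : DifferentiableAt ℝ (fun q => fderiv ℝ (localMap (E := E) ι p₀) q (y q)) z :=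
      ((hφ.fderiv_right (m := ∞) (by simp)).differentiableAt (by simp)).clm_apply hy
    rw [← hρz] at h1
    exact h1.comp (localMap ι p₀ z) hρ
  refine ⟨liftField (ι p₀) ζ, ?_, ?_⟩
  · rw [← param_localMap hz]
    exact mdifferentiableAt_liftField hx hζ
  · rw [eventually_nhds_param hz.1]
    filter_upwards [(isOpen_localDom hι.contMDiff).mem_nhds hz, hρφ, hY] with q hq hρq hYq
    rw [hYq]
    have h1 := liftField_param (localMap_mem hq) ζ
    rw [param_localMap hq] at h1
    refine Eq.trans h1 ?_
    simp only [ζ, hρq]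
    exact dparam_fderiv_localMap hι.contMDiff hq _

/-- By the chain rule, the derivative in a tangent direction sees only the values of the extension
along the hypersurface, so the choice of extension is immaterial. -/
theorem ambientDeriv_param (hι : Manifold.IsImmersion 𝓘(ℝ, F) 𝓘(ℝ, E) ∞ ι)
    (hz : z ∈ localDom E F ι p₀) {Y : Π p : N, TangentSpace 𝓘(ℝ, F) p} {y : F → F}
    (hy : DifferentiableAt ℝ y z)
    (hY : ∀ᶠ q in 𝓝 z, Y (param F p₀ q) = dparam F p₀ q (y q)) (v : F) :
    (ambientDeriv g ι Y (param F p₀ z) (dparam F p₀ z v) : E) =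
      (dparam E (ι p₀) (localMap ι p₀ z) : E →L[ℝ] E)
        (covAlong (christoffel g (ι p₀)) (localMap ι p₀)
          (fun q => fderiv ℝ (localMap ι p₀) q (y q)) z v) := by
  have hZ := Classical.epsilon_spec (exists_isExtensionAt (E := E) hι hz hy hY)
  have hdef : ambientDeriv g ι Y (param F p₀ z) (dparam F p₀ z v) =
      g.leviCivita (Classical.epsilon (IsExtensionAt (E := E) ι Y (param F p₀ z)))
        (ι (param F p₀ z)) (mfderiv 𝓘(ℝ, F) 𝓘(ℝ, E) ι (param F p₀ z) (dparam F p₀ z v)) := rfl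
  rw [hdef]
  set Z := Classical.epsilon (IsExtensionAt (E := E) ι Y (param F p₀ z)) with hZdef
  clear_value Z
  obtain ⟨hZ1, hZ2⟩ := hZ
  have hx := localMap_mem hz
  have hφ := (contDiffAt_localMap (E := E) hι.contMDiff hz).differentiableAt (by simp)
  have h1 : ∀ x, x = ι (param F p₀ z) → ∀ w : E, MDiffAt (T% Z) x ∧
      (g.leviCivita Z x : E →L[ℝ] E) w = (g.leviCivita Z (ι (param F p₀ z)) : E →L[ℝ] E) w := by
    rintro x rfl w
    exact ⟨hZ1, rfl⟩
  obtain ⟨h2, h3⟩ := h1 _ (param_localMap hz)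
    (mfderiv 𝓘(ℝ, F) 𝓘(ℝ, E) ι (param F p₀ z) (dparam F p₀ z v))
  have h4 := leviCivita_param g hx h2 (fderiv ℝ (localMap ι p₀) z v)
  have h5 : (g.leviCivita Z (param E (ι p₀) (localMap ι p₀ z)) : E →L[ℝ] E)
      ((dparam E (ι p₀) (localMap ι p₀ z) : E →L[ℝ] E) (fderiv ℝ (localMap ι p₀) z v)) =
      (g.leviCivita Z (param E (ι p₀) (localMap ι p₀ z)) : E →L[ℝ] E)
        ((mfderiv 𝓘(ℝ, F) 𝓘(ℝ, E) ι (param F p₀ z) : F →L[ℝ] E) (dparam F p₀ z v)) :=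
    congrArg _ (dparam_fderiv_localMap hι.contMDiff hz v)
  refine h3.symm.trans (h5.symm.trans (h4.trans (congrArg _ ?_)))
  have hc : (fun q => coordField (ι p₀) Z (localMap ι p₀ q)) =ᶠ[𝓝 z]
      fun q => fderiv ℝ (localMap ι p₀) q (y q) := by
    filter_upwards [(isOpen_localDom hι.contMDiff).mem_nhds hz, hY,
      (eventually_nhds_param hz.1).1 hZ2] with q hq hYq hZq
    refine dparam_injective (localMap_mem hq) ?_
    refine (dparam_coordField (localMap_mem hq) Z).trans ?_
    have h6 : ∀ x, x = ι (param F p₀ q) → (Z x : E) = Z (ι (param F p₀ q)) := by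
      rintro x rfl; rfl
    refine (h6 _ (param_localMap hq)).trans (Eq.trans hZq ?_)
    rw [hYq]
    exact (dparam_fderiv_localMap hι.contMDiff hq (y q)).symm
  have h7 := fderiv_comp z (differentiableAt_coordField hx h2) hφ
  have h8 : coordField (ι p₀) Z ∘ localMap (E := E) (F := F) ι p₀ =
      fun q => coordField (ι p₀) Z (localMap ι p₀ q) := rfl
  rw [h8, hc.fderiv_eq] at h7
  rw [covAlong, h7, hc.eq_of_nhds.symm]
  rfl

theorem inducedDeriv_param (hι : Manifold.IsImmersion 𝓘(ℝ, F) 𝓘(ℝ, E) ∞ ι)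
    (hz : z ∈ localDom E F ι p₀) {Y : Π p : N, TangentSpace 𝓘(ℝ, F) p} {y : F → F}
    (hy : DifferentiableAt ℝ y z)
    (hY : ∀ᶠ q in 𝓝 z, Y (param F p₀ q) = dparam F p₀ q (y q)) {v w : F}
    (hw : fderiv ℝ (localMap ι p₀) z w = covAlong (christoffel g (ι p₀)) (localMap ι p₀)
      (fun q => fderiv ℝ (localMap ι p₀) q (y q)) z v) :
    inducedDeriv g ι Y (param F p₀ z) (dparam F p₀ z v) = dparam F p₀ z w := by
  have h1 : mfderiv 𝓘(ℝ, F) 𝓘(ℝ, E) ι (param F p₀ z) (dparam F p₀ z w) =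
      ambientDeriv g ι Y (param F p₀ z) (dparam F p₀ z v) :=
    (dparam_fderiv_localMap hι.contMDiff hz w).symm.trans
      ((congrArg _ hw).trans (ambientDeriv_param hι hz hy hY v).symm)
  have h2 := Classical.epsilon_spec (p := fun w' =>
    mfderiv 𝓘(ℝ, F) 𝓘(ℝ, E) ι (param F p₀ z) w' =
      ambientDeriv g ι Y (param F p₀ z) (dparam F p₀ z v)) ⟨_, h1⟩
  exact mfderiv_injective_of_isImmersion hι _ (h2.trans h1.symm)

variable {l : Π p : N, TangentSpace 𝓘(ℝ, F) p}

theorem contMDiffOn_liftField_const (u : F) :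
    CMDiff[(extChartAt 𝓘(ℝ, F) p₀).source] ∞ (T% (liftField p₀ fun _ => u)) := by
  intro p hp
  obtain ⟨q, hq, rfl⟩ : ∃ q ∈ chartDom F p₀, param F p₀ q = p :=
    ⟨_, (extChartAt 𝓘(ℝ, F) p₀).map_source hp, param_chart hp⟩
  exact (contMDiffAt_liftField hq contDiffAt_const).contMDiffWithinAt

theorem mlieBracket_liftField_const {p₀ : N} (hz : z ∈ chartDom F p₀)
    (hl : MDiffAt (T% l) (param F p₀ z)) (u : F) :
    VectorField.mlieBracket 𝓘(ℝ, F) l (liftField p₀ fun _ => u) (param F p₀ z) =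
      dparam F p₀ z (-fderiv ℝ (coordField p₀ l) z u) := by
  have hc : coordField p₀ (liftField (M := N) p₀ fun _ => u) =ᶠ[𝓝 z] fun _ => u := by
    filter_upwards [(isOpen_chartDom p₀).mem_nhds hz] with q hq using coordField_liftField hq _
  rw [mlieBracket_param hz hl (mdifferentiableAt_liftField hz (differentiableAt_const u)),
    hc.fderiv_eq, hc.eq_of_nhds]
  simp

/-- The invariance of `q` is tested on constant coordinate fields `u`; their bracket with `l` is
`-∂_u L`, which accounts for the plus signs in `IsNullMap.lie_metric`. -/
theorem IsIsolatedNullSurface.isNullMap (hN : IsIsolatedNullSurface g ι l) (p₀ : N) :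
    IsNullMap (chartDom E (ι p₀)) (coordMetric g (ι p₀)) (localDom E F ι p₀)
      (localMap ι p₀) (coordField p₀ l) := by
  have hι := hN.null_hypersurface.immersion
  refine ⟨isOpen_localDom hι.contMDiff, fun z hz => contDiffAt_localMap hι.contMDiff hz,
    fun z hz => localMap_mem hz, fun z hz => fderiv_localMap_injective hι hz,
    hN.null_hypersurface.codim_one, fun z hz => contDiffAt_coordField hz.1 (hN.smooth _),
    fun z hz h0 => ?_, fun z hz w => ?_, fun z hz u w => ?_⟩
  · refine hN.ne_zero (param F p₀ z) ?_
    rw [← dparam_coordField hz.1 l, h0, map_zero]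
  · rw [coordMetric_localMap g hι.contMDiff hz, dparam_coordField hz.1]
    exact hN.null _ _
  · have hl : MDiffAt (T% l) (param F p₀ z) := (hN.smooth _).mdifferentiableAt (by simp)
    have key := hN.lie_metric _ (isOpen_extChartAt_source p₀) _ _ (contMDiffOn_liftField_const u)
      (contMDiffOn_liftField_const w) _ (param_mem_source hz.1)
    have hf : (fun q => pullbackForm g ι (param F p₀ q) (liftField p₀ (fun _ => u) (param F p₀ q))
        (liftField p₀ (fun _ => w) (param F p₀ q))) =ᶠ[𝓝 z]
        fun q => coordMetric g (ι p₀) (localMap ι p₀ q) (fderiv ℝ (localMap ι p₀) q u)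
          (fderiv ℝ (localMap ι p₀) q w) := by
      filter_upwards [(isOpen_localDom hι.contMDiff).mem_nhds hz] with q hq
      rw [coordMetric_localMap g hι.contMDiff hq, liftField_param hq.1, liftField_param hq.1]
    have hd : DifferentiableAt ℝ (fun q => coordMetric g (ι p₀) (localMap ι p₀ q)
        (fderiv ℝ (localMap ι p₀) q u) (fderiv ℝ (localMap ι p₀) q w)) z := by
      have hφ := contDiffAt_localMap (E := E) hι.contMDiff hz
      have h1 : ∀ u, DifferentiableAt ℝ (fun q => fderiv ℝ (localMap (E := E) ι p₀) q u) z :=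
        fun u => (contDiffAt_fderiv_apply hφ contDiffAt_const).differentiableAt (by simp)
      have h2 : DifferentiableAt ℝ (fun q => coordMetric g (ι p₀) (localMap ι p₀ q)) z :=
        ((contDiffAt_coordMetric g (localMap_mem hz)).differentiableAt (by simp)).comp z
          (hφ.differentiableAt (by simp))
      exact (h2.clm_apply (h1 u)).clm_apply (h1 w)
    have hfm := mdifferentiableAt_of_param (f := fun p => pullbackForm g ι p
      (liftField p₀ (fun _ => u) p) (liftField p₀ (fun _ => w) p)) hz.1
      (hd.congr_of_eventuallyEq hf)
    rw [mlieBracket_liftField_const hz.1 hl, mlieBracket_liftField_const hz.1 hl, liftField_param hz.1, liftField_param hz.1, ← dparam_coordField hz.1 l,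
      mvfderiv_dparam hz.1 hfm, hf.fderiv_eq, ← coordMetric_localMap g hι.contMDiff hz,
      ← coordMetric_localMap g hι.contMDiff hz] at key
    simp only [map_neg, neg_apply, sub_neg_eq_add] at key
    exact key

end HypersurfaceCoordinates

/-! ### Rotation form, invariance of the connection, and the identity on the manifold -/

section HypersurfaceCoordinates

variable {E : Type*} [NormedAddCommGroup E] [NormedSpace ℝ E] [FiniteDimensional ℝ E]
  {M : Type*} [TopologicalSpace M] [ChartedSpace E M] [IsManifold 𝓘(ℝ, E) ∞ M]
  {F : Type*} [NormedAddCommGroup F] [NormedSpace ℝ F] [FiniteDimensional ℝ F]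
  {N : Type*} [TopologicalSpace N] [ChartedSpace F N] [IsManifold 𝓘(ℝ, F) ∞ N]
  {g : PseudoMetric E M} {ι : N → M} {p₀ : N} {z : F}
  {l : Π p : N, TangentSpace 𝓘(ℝ, F) p}

theorem covAlong_neg_field {Γ : E → E →L[ℝ] E →L[ℝ] E} {φ Y : F → E} {p : F} (v : F) :
    covAlong Γ φ (fun q => -Y q) p v = -covAlong Γ φ Y p v := by
  rw [covAlong, covAlong, fderiv_fun_neg, map_neg, neg_apply, neg_add]

theorem eventually_dparam_coordField (hz : z ∈ localDom E F ι p₀)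
    (X : Π p : N, TangentSpace 𝓘(ℝ, F) p) :
    ∀ᶠ q in 𝓝 z, X (param F p₀ q) = dparam F p₀ q (coordField p₀ X q) := by
  filter_upwards [(isOpen_chartDom p₀).mem_nhds hz.1] with q hq
  exact (dparam_coordField hq X).symm

/-- Both sides are chosen coefficients of the same relation; the coefficient exists by the
coordinate computation and is unique because `l` does not vanish. -/
theorem IsIsolatedNullSurface.rotationForm_param (hN : IsIsolatedNullSurface g ι l)
    (hz : z ∈ localDom E F ι p₀) (v : F) :
    rotationForm g ι l (param F p₀ z) (dparam F p₀ z v) =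
      rot (christoffel g (ι p₀)) (localMap ι p₀) (coordField p₀ l) z v := by
  have hM := hN.isNullMap p₀
  have hB := christoffel_spec g (ι p₀)
  set c := rot (christoffel g (ι p₀)) (localMap ι p₀) (coordField p₀ l) z v
  have h1 : fderiv ℝ (localMap ι p₀) z (c • coordField p₀ l z) =
      covAlong (christoffel g (ι p₀)) (localMap ι p₀)
        (fun q => fderiv ℝ (localMap ι p₀) q (coordField p₀ l q)) z v := by
    rw [map_smul, hM.covAlong_normal hB hz]
  have h2 : inducedDeriv g ι l (param F p₀ z) (dparam F p₀ z v) = c • l (param F p₀ z) := by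
    rw [inducedDeriv_param hN.null_hypersurface.immersion hz
      ((hM.smooth_field z hz).differentiableAt (by simp)) (eventually_dparam_coordField hz l) h1,
      map_smul, dparam_coordField hz.1]
  have h3 := Classical.epsilon_spec (p := fun c : ℝ =>
    inducedDeriv g ι l (param F p₀ z) (dparam F p₀ z v) = c • l (param F p₀ z)) ⟨c, h2⟩
  exact smul_left_injective ℝ (hN.ne_zero (param F p₀ z)) (h3.symm.trans h2)

theorem IsIsolatedNullSurface.covAlong_normal_self (hN : IsIsolatedNullSurface g ι l)
    (hext : IsExtremal g ι l) (hz : z ∈ localDom E F ι p₀) :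
    covAlong (christoffel g (ι p₀)) (localMap ι p₀)
      (fun q => fderiv ℝ (localMap ι p₀) q (coordField p₀ l q)) z (coordField p₀ l z) = 0 := by
  have hM := hN.isNullMap p₀
  have hB := christoffel_spec g (ι p₀)
  have hι := hN.null_hypersurface.immersion
  have h1 := ambientDeriv_param (g := g) hι hz ((hM.smooth_field z hz).differentiableAt (by simp))
    (eventually_dparam_coordField hz l) (coordField p₀ l z)
  rw [dparam_coordField hz.1] at h1
  have h2 := dparam_fderiv_localMap hι.contMDiff hz (coordField p₀ l z)
  obtain ⟨c, hc⟩ := hM.exists_covAlong_normal hB hz (coordField p₀ l z)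
  have h4 : (dparam F p₀ z : F →L[ℝ] F) (coordField p₀ l z) = l (param F p₀ z) :=
    dparam_coordField hz.1 l
  rw [h4] at h2
  have h3 : ambientDeriv g ι l (param F p₀ z) (l (param F p₀ z)) =
      c • mfderiv 𝓘(ℝ, F) 𝓘(ℝ, E) ι (param F p₀ z) (l (param F p₀ z)) := by
    refine Eq.trans h1 ?_
    rw [hc, map_smul]
    exact congrArg (fun w : E => c • w) h2
  have h5 := Classical.epsilon_spec (p := fun c : ℝ =>
    ambientDeriv g ι l (param F p₀ z) (l (param F p₀ z)) =
      c • mfderiv 𝓘(ℝ, F) 𝓘(ℝ, E) ι (param F p₀ z) (l (param F p₀ z))) ⟨c, h3⟩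
  have h6 : surfaceGravity g ι l (param F p₀ z) = 0 := hext _
  rw [surfaceGravity] at h6
  rw [h6, zero_smul] at h5
  refine dparam_injective (localMap_mem hz) ?_
  exact (h1.symm.trans h5).trans (map_zero (dparam E (ι p₀) (localMap ι p₀ z))).symm

theorem IsIsolatedNullSurface.lie_connection_coord (hN : IsIsolatedNullSurface g ι l) {u w : F}
    {δ : F → F} (hδ : ∀ z ∈ localDom E F ι p₀, fderiv ℝ (localMap ι p₀) z (δ z) =
      covAlong (christoffel g (ι p₀)) (localMap ι p₀)
        (fun y => fderiv ℝ (localMap ι p₀) y w) z u) (hz : z ∈ localDom E F ι p₀) :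
    fderiv ℝ (localMap ι p₀) z (fderiv ℝ δ z (coordField p₀ l z) -
        fderiv ℝ (coordField p₀ l) z (δ z)) +
      covAlong (christoffel g (ι p₀)) (localMap ι p₀)
        (fun y => fderiv ℝ (localMap ι p₀) y w) z (fderiv ℝ (coordField p₀ l) z u) +
      covAlong (christoffel g (ι p₀)) (localMap ι p₀)
        (fun y => fderiv ℝ (localMap ι p₀) y (fderiv ℝ (coordField p₀ l) y w)) z u = 0 := by
  have hM := hN.isNullMap p₀
  have hB := christoffel_spec g (ι p₀)
  have hι := hN.null_hypersurface.immersion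
  have hl : ∀ p, MDiffAt (T% l) p := fun p => (hN.smooth p).mdifferentiableAt (by simp)
  have hφ := hM.smooth z hz
  have hc : ∀ {v : F → F}, ContDiffAt ℝ ∞ v z →
      ContDiffAt ℝ ∞ (fun y => fderiv ℝ (localMap (E := E) ι p₀) y (v y)) z := fun hv =>
    contDiffAt_fderiv_apply hφ hv
  have hδs : ContDiffAt ℝ ∞ δ z := by
    refine contDiffAt_of_clm_apply_eq (hφ.fderiv_right (m := ∞) (by simp))
      (contDiffAt_covAlong (hB.smooth _ (hM.maps z hz)) hφ (hc (contDiffAt_const (c := w)))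
        (contDiffAt_const (c := u))) (hM.inj z hz) ?_
    filter_upwards [hM.isOpen.mem_nhds hz] with q hq using hδ q hq
  have hfield : ∀ v : F, ∀ q ∈ localDom E F ι p₀,
      liftField p₀ (fun _ => v) (param F p₀ q) = dparam F p₀ q v := fun v q hq =>
    liftField_param hq.1 _
  have hfield' : ∀ v : F, ∀ q ∈ localDom E F ι p₀, ∀ᶠ q' in 𝓝 q,
      liftField p₀ (fun _ => v) (param F p₀ q') = dparam F p₀ q' v := fun v q hq => by
    filter_upwards [hM.isOpen.mem_nhds hq] with q' hq' using hfield v q' hq'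
  have hD : ∀ q ∈ localDom E F ι p₀,
      inducedDeriv g ι (liftField p₀ fun _ => w) (param F p₀ q)
        (liftField p₀ (fun _ => u) (param F p₀ q)) = dparam F p₀ q (δ q) := by
    intro q hq
    rw [hfield u q hq]
    exact inducedDeriv_param hι hq (differentiableAt_const w) (hfield' w q hq) (hδ q hq)
  have hDc : coordField p₀ (fun p => inducedDeriv g ι (liftField p₀ fun _ => w) p
      (liftField p₀ (fun _ => u) p)) =ᶠ[𝓝 z] δ := by
    filter_upwards [hM.isOpen.mem_nhds hz] with q hq
    refine dparam_injective hq.1 ?_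
    rw [dparam_coordField hq.1]
    exact hD q hq
  have hDm : MDiffAt (T% (fun p => inducedDeriv g ι (liftField p₀ fun _ => w) p
      (liftField p₀ (fun _ => u) p))) (param F p₀ z) := by
    refine MDiffAt.congr_field (mdifferentiableAt_liftField hz.1
      (hδs.differentiableAt (by simp))) ?_
    refine (eventually_nhds_param hz.1).2 ?_
    filter_upwards [hM.isOpen.mem_nhds hz] with q hq
    exact (hD q hq).trans (liftField_param hq.1 δ).symm
  have hfL : ContDiffAt ℝ ∞ (fun y => fderiv ℝ (coordField p₀ l) y w) z :=
    contDiffAt_fderiv_apply (hM.smooth_field z hz) contDiffAt_const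
  -- `d₁` and `d₂` represent `D_{[l, u]} w` and `D_u [l, w]`, for constant coordinate fields `u`,
  -- `w`; such vectors exist because these ambient derivatives are tangent.
  obtain ⟨d₁, hd₁⟩ := hM.exists_fderiv_eq_covAlong hB hz (differentiableAt_const (c := w))
    (-fderiv ℝ (coordField p₀ l) z u)
  obtain ⟨d₂, hd₂⟩ := hM.exists_fderiv_eq_covAlong hB hz
    (y := fun y => -fderiv ℝ (coordField p₀ l) y w) (hfL.differentiableAt (by simp)).neg u
  have hbr : ∀ᶠ q in 𝓝 z, VectorField.mlieBracket 𝓘(ℝ, F) l (liftField p₀ fun _ => w)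
      (param F p₀ q) = dparam F p₀ q (-fderiv ℝ (coordField p₀ l) q w) := by
    filter_upwards [hM.isOpen.mem_nhds hz] with q hq using
      mlieBracket_liftField_const hq.1 (hl _) w
  have key := hN.lie_connection _ (isOpen_extChartAt_source p₀) _ _
    (contMDiffOn_liftField_const u) (contMDiffOn_liftField_const w) _ (param_mem_source hz.1)
  rw [mlieBracket_liftField_const hz.1 (hl _) u, hfield u z hz,
    mlieBracket_param hz.1 (hl _) hDm, hDc.fderiv_eq, hDc.eq_of_nhds,
    inducedDeriv_param hι hz (differentiableAt_const w) (hfield' w z hz) hd₁,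
    inducedDeriv_param hι hz (hfL.differentiableAt (by simp)).neg hbr hd₂,
    ← map_sub, ← map_sub] at key
  have h0 := dparam_injective hz.1 (key.trans (map_zero (dparam F p₀ z)).symm)
  have h1 := congrArg (fderiv ℝ (localMap (E := E) ι p₀) z) h0
  rw [map_sub, map_sub, hd₁, hd₂, map_zero, covAlong_neg_dir] at h1
  have h2 : covAlong (christoffel g (ι p₀)) (localMap ι p₀)
      (fun y => fderiv ℝ (localMap ι p₀) y (-fderiv ℝ (coordField p₀ l) y w)) z u =
      -covAlong (christoffel g (ι p₀)) (localMap ι p₀)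
        (fun y => fderiv ℝ (localMap ι p₀) y (fderiv ℝ (coordField p₀ l) y w)) z u := by
    simp only [map_neg]
    exact covAlong_neg_field _
  rw [h2, sub_neg_eq_add, sub_neg_eq_add] at h1
  exact h1

theorem fderiv_localMap_center {f : N → M} (hf : ContMDiff 𝓘(ℝ, F) 𝓘(ℝ, E) ∞ f) (p₀ : N) (v : F) :
    fderiv ℝ (localMap (E := E) f p₀) (extChartAt 𝓘(ℝ, F) p₀ p₀) v =
      (mfderiv 𝓘(ℝ, F) 𝓘(ℝ, E) f p₀ : F →L[ℝ] E) v := by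
  have h1 := dparam_fderiv_localMap hf center_mem_localDom v (p₀ := p₀)
  rw [localMap_center] at h1
  have h2 : ∀ p, p = p₀ → ∀ w : F, (mfderiv 𝓘(ℝ, F) 𝓘(ℝ, E) f p : F →L[ℝ] E) w =
      (mfderiv 𝓘(ℝ, F) 𝓘(ℝ, E) f p₀ : F →L[ℝ] E) w := by
    rintro p rfl w; rfl
  refine (dparam_center (f p₀) (fderiv ℝ (localMap (E := E) f p₀) (extChartAt 𝓘(ℝ, F) p₀ p₀) v)).symm.trans
    (h1.trans ((h2 _ (param_center p₀) _).trans ?_))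
  exact congrArg _ (dparam_center p₀ v)

variable {H : Type*} [NormedAddCommGroup H] [NormedSpace ℝ H] [FiniteDimensional ℝ H]
  {S : Type*} [TopologicalSpace S] [ChartedSpace H S] [IsManifold 𝓘(ℝ, H) ∞ S]
  {j : S → N}

theorem IsLeviCivita.mono {Ω Ω' : Set E} {B : E → E →L[ℝ] E →L[ℝ] ℝ}
    {Γ : E → E →L[ℝ] E →L[ℝ] E} (h : IsLeviCivita Ω B Γ) (hΩ' : IsOpen Ω') (hs : Ω' ⊆ Ω) :
    IsLeviCivita Ω' B Γ where
  isOpen := hΩ'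
  smooth_metric x hx := h.smooth_metric x (hs hx)
  symm_metric x hx := h.symm_metric x (hs hx)
  nondeg x hx := h.nondeg x (hs hx)
  smooth x hx := h.smooth x (hs hx)
  symm x hx := h.symm x (hs hx)
  compat x hx := h.compat x (hs hx)

theorem mfderiv_apply_congr {f : N → M} {p p' : N} (h : p = p') (v : F) :
    (mfderiv 𝓘(ℝ, F) 𝓘(ℝ, E) f p : F →L[ℝ] E) v =
      (mfderiv 𝓘(ℝ, F) 𝓘(ℝ, E) f p' : F →L[ℝ] E) v := by
  subst h; rfl

variable (E F H) in
/-- The coordinate domain of a section, on which the hypersurface coordinates are defined too. -/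
def sectionDom (ι : N → M) (j : S → N) (s : S) : Set H :=
  localDom F H j s ∩ localMap j s ⁻¹' localDom E F ι (j s)

theorem isOpen_sectionDom (hι : ContMDiff 𝓘(ℝ, F) 𝓘(ℝ, E) ∞ ι)
    (hj : ContMDiff 𝓘(ℝ, H) 𝓘(ℝ, F) ∞ j) (s : S) : IsOpen (sectionDom E F H ι j s) :=
  ContinuousOn.isOpen_inter_preimage
    (fun _ hh => (contDiffAt_localMap hj hh).continuousAt.continuousWithinAt)
    (isOpen_localDom hj) (isOpen_localDom hι)

theorem center_mem_sectionDom (s : S) :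
    extChartAt 𝓘(ℝ, H) s s ∈ sectionDom E F H ι j s := by
  refine ⟨center_mem_localDom, ?_⟩
  rw [Set.mem_preimage, localMap_center]
  exact center_mem_localDom

theorem mfderiv_comp_param (hι : ContMDiff 𝓘(ℝ, F) 𝓘(ℝ, E) ∞ ι)
    (hj : ContMDiff 𝓘(ℝ, H) 𝓘(ℝ, F) ∞ j) {s : S} {h : H} (hh : h ∈ localDom F H j s) (a : H) :
    (mfderiv 𝓘(ℝ, H) 𝓘(ℝ, E) (ι ∘ j) (param H s h) : H →L[ℝ] E) (dparam H s h a) =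
      (mfderiv 𝓘(ℝ, F) 𝓘(ℝ, E) ι (param F (j s) (localMap j s h)) : F →L[ℝ] E)
        (dparam F (j s) (localMap j s h) (fderiv ℝ (localMap j s) h a)) := by
  have h1 := mfderiv_comp (param H s h) (hι.contMDiffAt.mdifferentiableAt (by simp))
    (hj.contMDiffAt.mdifferentiableAt (by simp))
  refine (congrArg (fun A : H →L[ℝ] E => A (dparam H s h a)) h1).trans ?_
  refine Eq.trans ?_ (mfderiv_apply_congr (param_localMap hh) _).symm
  exact congrArg _ (dparam_fderiv_localMap hj hh a).symm

theorem coordMetric_localMap_comp (g : PseudoMetric E M) (hι : ContMDiff 𝓘(ℝ, F) 𝓘(ℝ, E) ∞ ι)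
    (hj : ContMDiff 𝓘(ℝ, H) 𝓘(ℝ, F) ∞ j) {s : S} {h : H} (hh : h ∈ sectionDom E F H ι j s)
    (a b : H) :
    coordMetric g (ι (j s)) (localMap (F := F) ι (j s) (localMap j s h))
      (fderiv ℝ (localMap (F := F) ι (j s)) (localMap j s h) (fderiv ℝ (localMap j s) h a))
      (fderiv ℝ (localMap (F := F) ι (j s)) (localMap j s h) (fderiv ℝ (localMap j s) h b)) =
    pullbackForm g (ι ∘ j) (param H s h) (dparam H s h a) (dparam H s h b) := by
  have ha := mfderiv_comp_param hι hj hh.1 a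
  have hb := mfderiv_comp_param hι hj hh.1 b
  have h1 := g.val_congr (congrArg ι (param_localMap (E := F) (F := H) hh.1))
    ((mfderiv 𝓘(ℝ, F) 𝓘(ℝ, E) ι (param F (j s) (localMap j s h)) : F →L[ℝ] E)
      (dparam F (j s) (localMap j s h) (fderiv ℝ (localMap j s) h a)))
    ((mfderiv 𝓘(ℝ, F) 𝓘(ℝ, E) ι (param F (j s) (localMap j s h)) : F →L[ℝ] E)
      (dparam F (j s) (localMap j s h) (fderiv ℝ (localMap j s) h b)))
  rw [coordMetric_localMap g hι hh.2]
  refine Eq.trans h1 ?_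
  rw [← ha, ← hb]
  rfl

theorem IsSpacelikeSection.isSpacelikeMap (hN : IsIsolatedNullSurface g ι l)
    (hS : IsSpacelikeSection (G := H) g ι l j) (s : S) :
    IsSpacelikeMap (coordMetric g (ι (j s))) (localDom E F ι (j s)) (localMap ι (j s))
      (coordMetric (hS.metric hN.null_hypersurface) s) (sectionDom E F H ι j s)
      (localMap j s) where
  smooth h hh := contDiffAt_localMap hS.immersion.contMDiff hh.1
  maps h hh := hh.2
  codim := by
    have h1 := hS.codim_two
    have h2 := hN.null_hypersurface.codim_one
    omega
  metric h hh a b := by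
    rw [coordMetric_localMap_comp g hN.null_hypersurface.immersion.contMDiff
      hS.immersion.contMDiff hh a b]
    rfl
  pos h hh a ha := by
    have h1 : dparam H s h a ≠ 0 := fun h0 => ha (dparam_injective hh.1.1
      (h0.trans (map_zero (dparam H s h)).symm))
    exact hS.spacelike (param H s h) (dparam H s h a) h1

theorem IsIsolatedNullSurface.rotationFormOn_param (hN : IsIsolatedNullSurface g ι l)
    (hS : IsSpacelikeSection (G := H) g ι l j) {s : S} {h : H}
    (hh : h ∈ sectionDom E F H ι j s) (a : H) :
    rotationFormOn g ι l j (param H s h) (dparam H s h a) =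
      rot (christoffel g (ι (j s))) (localMap ι (j s)) (coordField (j s) l) (localMap j s h)
        (fderiv ℝ (localMap j s) h a) := by
  have h1 : ∀ p, p = j (param H s h) → ∀ v : F, rotationForm g ι l p v =
      rotationForm g ι l (j (param H s h)) v := by
    rintro p rfl v; rfl
  rw [← hN.rotationForm_param hh.2]
  refine Eq.trans ?_ (h1 _ (param_localMap hh.1) _).symm
  exact congrArg (fun v : F => rotationForm g ι l (j (param H s h)) v)
    (dparam_fderiv_localMap hS.immersion.contMDiff hh.1 a).symm

/-- The identity satisfied by the rotation form of an extremal isolated null surface on any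
spacelike section. -/
theorem IsIsolatedNullSurface.extremal_identity (hN : IsIsolatedNullSurface g ι l)
    (hext : IsExtremal g ι l) (hS : IsSpacelikeSection (G := H) g ι l j) (s : S) (a b : H) :
    (1 / 2 : ℝ) *
        ((hS.metric hN.null_hypersurface).covDerivOneForm (rotationFormOn g ι l j) s a b +
          (hS.metric hN.null_hypersurface).covDerivOneForm (rotationFormOn g ι l j) s b a) +
      rotationFormOn g ι l j s a * rotationFormOn g ι l j s b -
      (1 / 2 : ℝ) * (hS.metric hN.null_hypersurface).ricci s a b +
      (1 / 2 : ℝ) * g.ricci (ι (j s)) (mfderiv 𝓘(ℝ, H) 𝓘(ℝ, E) (ι ∘ j) s a)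
        (mfderiv 𝓘(ℝ, H) 𝓘(ℝ, E) (ι ∘ j) s b) = 0 := by
  have hι := hN.null_hypersurface.immersion.contMDiff
  have hj := hS.immersion.contMDiff
  set q := hS.metric hN.null_hypersurface with hq
  have hW := isOpen_sectionDom hι hj s
  have hh : extChartAt 𝓘(ℝ, H) s s ∈ sectionDom E F H ι j s := center_mem_sectionDom s
  have hM := hN.isNullMap (j s)
  have hB := christoffel_spec g (ι (j s))
  have hB' : IsLeviCivita (sectionDom E F H ι j s) (coordMetric q s) (christoffel q s) :=
    (christoffel_spec q s).mono hW fun h hh => hh.1.1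
  have key := IsSpacelikeMap.trace_riemLin hM hB
    (fun u w δ hδ z hz => hN.lie_connection_coord hδ hz)
    (fun z hz => hN.covAlong_normal_self hext hz) (hS.isSpacelikeMap hN s) hB' hh a b
  set ρ := fun (h c : H) => rot (christoffel g (ι (j s))) (localMap ι (j s))
    (coordField (j s) l) (localMap j s h) (fderiv ℝ (localMap j s) h c) with hρ
  have hρe : ∀ c, (fun h => rotationFormOn g ι l j (param H s h) (dparam H s h c)) =ᶠ[
      𝓝 (extChartAt 𝓘(ℝ, H) s s)] fun h => ρ h c := fun c => by
    filter_upwards [hW.mem_nhds hh] with h hh using hN.rotationFormOn_param hS hh c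
  have hρc : ∀ c : H, rotationFormOn g ι l j s c = ρ (extChartAt 𝓘(ℝ, H) s s) c := by
    intro c
    have h1 : ∀ s', s' = s → rotationFormOn g ι l j s' c = rotationFormOn g ι l j s c := by
      rintro s' rfl; rfl
    refine (h1 _ (param_center (E := H) s)).symm.trans (Eq.trans ?_ (hρe c).self_of_nhds)
    exact congrArg (fun v : H => rotationFormOn g ι l j _ v) (dparam_center s c).symm
  -- Differentiability is required for the coordinate form of the covariant derivative of `ω̃`; it
  -- follows from a representative of the rotation form with values in the dual space.
  have hρd : ∀ c, DifferentiableAt ℝ (fun h => ρ h c) (extChartAt 𝓘(ℝ, H) s s) := by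
    intro c
    obtain ⟨r, hr, hrv⟩ := hM.exists_rot_clm hB hh.2
    have hk := contDiffAt_localMap hj hh.1
    have h1 : DifferentiableAt ℝ (fun h => r (localMap j s h) (fderiv ℝ (localMap j s) h c))
        (extChartAt 𝓘(ℝ, H) s s) :=
      (hr.comp _ (hk.differentiableAt (by simp))).clm_apply
        ((contDiffAt_fderiv_apply hk contDiffAt_const).differentiableAt (by simp))
    refine h1.congr_of_eventuallyEq ?_
    filter_upwards [hW.mem_nhds hh] with h hh using (hrv _ hh.2 _).symm
  have hcov : ∀ c d, q.covDerivOneForm (rotationFormOn g ι l j) s c d =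
      fderiv ℝ (fun h => ρ h d) (extChartAt 𝓘(ℝ, H) s s) c -
        ρ (extChartAt 𝓘(ℝ, H) s s) (christoffel q s (extChartAt 𝓘(ℝ, H) s s) c d) := by
    intro c d
    rw [covDerivOneForm_center q s _ c d ((hρd d).congr_of_eventuallyEq (hρe d)),
      (hρe d).fderiv_eq, hρc]
  have hd : ∀ c : H, fderiv ℝ (fun h => localMap (E := E) (F := F) ι (j s) (localMap j s h))
      (extChartAt 𝓘(ℝ, H) s s) c = (mfderiv 𝓘(ℝ, H) 𝓘(ℝ, E) (ι ∘ j) s : H →L[ℝ] E) c := by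
    intro c
    have hk := (contDiffAt_localMap hj hh.1).differentiableAt (by simp)
    have hφ := (contDiffAt_localMap hι hh.2).differentiableAt (by simp)
    have h1 := congrArg (fun A : H →L[ℝ] E => A c) (fderiv_comp _ hφ hk)
    refine Eq.trans h1 ?_
    have h2 := mfderiv_comp s (hι.contMDiffAt.mdifferentiableAt (by simp))
      (hj.contMDiffAt.mdifferentiableAt (by simp))
    refine Eq.trans ?_ (congrArg (fun A : H →L[ℝ] E => A c) h2).symm
    change fderiv ℝ (localMap ι (j s)) (localMap j s (extChartAt 𝓘(ℝ, H) s s))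
      (fderiv ℝ (localMap j s) (extChartAt 𝓘(ℝ, H) s s) c) = _
    rw [localMap_center, fderiv_localMap_center hι, fderiv_localMap_center hj]
    rfl
  have hRq := ricci_center q s a b
  have hRg := ricci_center (E := E) g (ι (j s)) (mfderiv 𝓘(ℝ, H) 𝓘(ℝ, E) (ι ∘ j) s a)
    (mfderiv 𝓘(ℝ, H) 𝓘(ℝ, E) (ι ∘ j) s b)
  have hc : localMap (F := F) ι (j s) (localMap j s (extChartAt 𝓘(ℝ, H) s s)) =
      extChartAt 𝓘(ℝ, E) (ι (j s)) (ι (j s)) := by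
    rw [localMap_center, localMap_center]
  rw [hd, hd, hc] at key
  -- The final arithmetic is done on real numbers equal to the coordinate expressions, which
  -- separates it from the identification of tangent spaces with model spaces.
  have alg : ∀ x y u v r R : ℝ,
      x = fderiv ℝ (fun h => ρ h b) (extChartAt 𝓘(ℝ, H) s s) a -
        ρ (extChartAt 𝓘(ℝ, H) s s) (christoffel q s (extChartAt 𝓘(ℝ, H) s s) a b) →
      y = fderiv ℝ (fun h => ρ h a) (extChartAt 𝓘(ℝ, H) s s) b -
        ρ (extChartAt 𝓘(ℝ, H) s s) (christoffel q s (extChartAt 𝓘(ℝ, H) s s) b a) →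
      u = ρ (extChartAt 𝓘(ℝ, H) s s) a → v = ρ (extChartAt 𝓘(ℝ, H) s s) b →
      r = LinearMap.trace ℝ H (riemLin (christoffel q s) (extChartAt 𝓘(ℝ, H) s s) a b) →
      R = LinearMap.trace ℝ E (riemLin (christoffel g (ι (j s)))
        (extChartAt 𝓘(ℝ, E) (ι (j s)) (ι (j s)))
        ((mfderiv 𝓘(ℝ, H) 𝓘(ℝ, E) (ι ∘ j) s : H →L[ℝ] E) a)
        ((mfderiv 𝓘(ℝ, H) 𝓘(ℝ, E) (ι ∘ j) s : H →L[ℝ] E) b)) →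
      (1 / 2 : ℝ) * (x + y) + u * v - (1 / 2 : ℝ) * r + (1 / 2 : ℝ) * R = 0 := by
    rintro x y u v r R rfl rfl rfl rfl rfl rfl
    rw [key]
    simp only [hρ]
    ring
  exact alg _ _ _ _ _ _ (hcov a b) (hcov b a) (hρc a) (hρc b) hRq hRg

end HypersurfaceCoordinates

end NullGeom

end

theorem theorem4 (n : ℕ) (hn : 2 < n)
    {M : Type*} [TopologicalSpace M] [ChartedSpace (EuclideanSpace ℝ (Fin n)) M]
    [IsManifold 𝓘(ℝ, EuclideanSpace ℝ (Fin n)) ∞ M]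
    {N : Type*} [TopologicalSpace N] [ChartedSpace (EuclideanSpace ℝ (Fin (n - 1))) N]
    [IsManifold 𝓘(ℝ, EuclideanSpace ℝ (Fin (n - 1))) ∞ N]
    {S : Type*} [TopologicalSpace S] [ChartedSpace (EuclideanSpace ℝ (Fin (n - 2))) S]
    [IsManifold 𝓘(ℝ, EuclideanSpace ℝ (Fin (n - 2))) ∞ S]
    (g : NullGeom.PseudoMetric (EuclideanSpace ℝ (Fin n)) M) (hg : g.IsLorentzian)
    (ι : N → M) (l : Π p : N, TangentSpace 𝓘(ℝ, EuclideanSpace ℝ (Fin (n - 1))) p)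
    (hN : NullGeom.IsIsolatedNullSurface g ι l) (hext : NullGeom.IsExtremal g ι l)
    (j : S → N) (hS : NullGeom.IsSpacelikeSection (G := EuclideanSpace ℝ (Fin (n - 2))) g ι l j)
    (s : S) (a b : TangentSpace 𝓘(ℝ, EuclideanSpace ℝ (Fin (n - 2))) s) :
    let q := hS.metric hN.null_hypersurface
    let rot : Π s : S, TangentSpace 𝓘(ℝ, EuclideanSpace ℝ (Fin (n - 2))) s → ℝ :=
      NullGeom.rotationFormOn g ι l j
    let dφ := mfderiv 𝓘(ℝ, EuclideanSpace ℝ (Fin (n - 2))) 𝓘(ℝ, EuclideanSpace ℝ (Fin n))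
      (ι ∘ j) s
    (1 / 2 : ℝ) * (q.covDerivOneForm rot s a b + q.covDerivOneForm rot s b a)
      + rot s a * rot s b
      - (1 / 2 : ℝ) * q.ricci s a b
      + (1 / 2 : ℝ) * g.ricci (ι (j s)) (dφ a) (dφ b) = 0 :=
  hN.extremal_identity hext hS s a b
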